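/- Let $p\ge 2$, let $\theta_1^0\in\mathbb R^p$ be a unit vector, $v>0$, and $(r_n)_{n\ge1}$ a positive real sequence. For a unit vector $\theta\in\mathbb R^p$, let ${\rm P}_{\theta,r_n,v}$ be the law of a random sample $X_{n1},\dots,X_{nn}$ from the Gaussian distribution on $\mathbb R^p$ with mean $0$ and covariance matrix $I_p+r_nv\,\theta\theta'$. Let $\bar X_n=\frac1n\sum_iX_{ni}$ and $S_n=\frac1n\sum_i(X_{ni}-\bar X_n)(X_{ni}-\bar X_n)'$, let $\hat\lambda_{n1}\ge\dots\ge\hat\lambda_{np}$ be the eigenvalues of $S_n$, let $\hat\theta_{nj}$ be an arbitrarily chosen unit eigenvector of $S_n$ for $\hat\lambda_{nj}$, let $\tilde\theta_{n2},\dots,\tilde\theta_{np}$ result from the (normalized) Gram–Schmidt orthogonalization of $\theta_1^0,\hat\theta_{n2},\dots,\hat\theta_{np}$, and put $$Q_{\rm HPV}=\frac{n}{\hat\lambda_{n1}}\sum_{j=2}^p\hat\lambda_{nj}^{-1}\big(\tilde\theta_{nj}'S_n\theta_1^0\big)^2 .$$ For $\alpha\in(0,1)$, let $\chi^2_{p-1,1-\alpha}$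 be the upper $\alpha$-quantile of the $\chi^2_{p-1}$ distribution, and let $\phi_{\rm HPV}$ be the test of $\theta_1=\theta_1^0$ against $\theta_1\ne\theta_1^0$ that rejects when $Q_{\rm HPV}>\chi^2_{p-1,1-\alpha}$. Below, $(\tau_n)$ is any sequence in $\mathbb R^p$ such that $\theta_1^0+\tau_n$ is a unit vector for every $n$ and $\tau_n\to\tau$. (iii) Suppose that $r_n=1/\sqrt n$. Then, under ${\rm P}_{\theta_1^0+\tau_n,r_n,v}$, $Q_{\rm HPV}$ converges in distribution to the noncentral chi-square distribution with $p-1$ degrees of freedom and noncentrality parameter $$\frac{v^2}{16}\|\tau\|^2\big(4-\|\tau\|^2\big)\big(2-\|\tau\|^2\big)^2 .$$ Consequently $\phi_{\rm HPV}$ is rate-consistent: for every $\alpha\in(0,1)$, its null rejection probability under ${\rm P}_{\theta_1^0,r_n,v}$ converges to $\alpha$, its power under ${\rm P}_{\theta_1^0+\tau_n,r_n,v}$ converges to the probability $\beta$ that this noncentral chi-square distribution gives to $(\chi^2_{p-1,1-\alpha},\infty)$, and $\alpha<\beta<1$ whenever $\|\tau\|\notin\{0,\sqrt2,2\}$. (iv)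 Suppose that $r_n=o(1/\sqrt n)$. Then, for every $\alpha\in(0,1)$, $\phi_{\rm HPV}$ is locally asymptotically maximin at level $\alpha$ (for perturbations $\tau$ of $\theta_1^0$ at the constant rate $\nu_n\equiv1$): it satisfies $\limsup_n{\rm E}_{\theta_1^0,r_n,v}[\phi_{\rm HPV}]\le\alpha$ and, for all $0<\varepsilon\le C$ and every sequence of tests $\psi_n$ with $\limsup_n{\rm E}_{\theta_1^0,r_n,v}[\psi_n]\le\alpha$, $$\limsup_n\ \inf_\tau{\rm E}_{\theta_1^0+\tau,r_n,v}[\psi_n]\ \le\ \liminf_n\ \inf_\tau{\rm E}_{\theta_1^0+\tau,r_n,v}[\phi_{\rm HPV}],$$ where the infima are over all $\tau$ with $\varepsilon\le\|\tau\|\le C$ and $\|\theta_1^0+\tau\|=1$ (an infimum over the empty set is taken to be $0$). This optimality is trivial, since the power of $\phi_{\rm HPV}$ under ${\rm P}_{\theta_1^0+\tau_n,r_n,v}$ converges to $\alpha$ for every such sequence $(\tau_n)$. -/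

import Mathlib

open MeasureTheory ProbabilityTheory Filter Asymptotics
open scoped Topology

namespace WeakPCA

noncomputable section

/-! ### Chi-square distributions -/

/-- The (noncentral) chi-square distribution with `k` degrees of freedom and noncentrality
parameter `δ ≥ 0`: the law of `∑ i, Z i ^ 2` for independent `Z i ∼ N(m i, 1)`, `i < k`, with mean
vector `m = (√δ, 0, …, 0)`, whose squared norm is `δ`. -/
def noncentralChiSq (k : ℕ) (δ : ℝ) : Measure ℝ :=
  (Measure.pi fun i : Fin k => gaussianReal (if (i : ℕ) = 0 then √δ else 0) 1).map
    (fun z => ∑ i, z i ^ 2)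

instance (k : ℕ) (δ : ℝ) : IsProbabilityMeasure (noncentralChiSq k δ) :=
  Measure.isProbabilityMeasure_map (Measurable.aemeasurable (by fun_prop))

/-- The upper `α`-quantile of the central chi-square distribution with `k` degrees of freedom. -/
def chiSqUpperQuantile (k : ℕ) (α : ℝ) : ℝ :=
  sInf {x : ℝ | 1 - α ≤ cdf (noncentralChiSq k 0) x}

/-! ### The Gaussian single-spiked model -/

/-- The law of a random sample of size `n` from the centered Gaussian distribution on `ℝ^p` with
covariance matrix `I + r v θ θ'`. -/
def spikedLaw {p : ℕ} (n : ℕ) (r v : ℝ) (θ : EuclideanSpace ℝ (Fin p)) :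
    Measure (Fin n → EuclideanSpace ℝ (Fin p)) :=
  Measure.pi fun _ : Fin n =>
    multivariateGaussian 0 ((1 : Matrix (Fin p) (Fin p) ℝ) + (r * v) • Matrix.vecMulVec θ θ)

instance {p : ℕ} (n : ℕ) (r v : ℝ) (θ : EuclideanSpace ℝ (Fin p)) :
    IsProbabilityMeasure (spikedLaw n r v θ) := by
  unfold spikedLaw; infer_instance

/-! ### Sample covariance matrix, sample eigenvalues and eigenvectors -/

/-- The sample mean. -/
def sampleMean {p n : ℕ} (x : Fin n → EuclideanSpace ℝ (Fin p)) : EuclideanSpace ℝ (Fin p) :=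
  (n : ℝ)⁻¹ • ∑ i, x i

/-- The sample covariance matrix `(1/n) ∑ i, (X i - X̄) (X i - X̄)'`. -/
def sampleCov {p n : ℕ} (x : Fin n → EuclideanSpace ℝ (Fin p)) : Matrix (Fin p) (Fin p) ℝ :=
  (n : ℝ)⁻¹ • ∑ i, Matrix.vecMulVec (x i - sampleMean x).ofLp (x i - sampleMean x).ofLp

/-- The sample covariance matrix as a linear map of `ℝ^p`. -/
def sampleCovLin {p n : ℕ} (x : Fin n → EuclideanSpace ℝ (Fin p)) :
    EuclideanSpace ℝ (Fin p) →ₗ[ℝ] EuclideanSpace ℝ (Fin p) :=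
  Matrix.toEuclideanLin (sampleCov x)

theorem sampleCovLin_isSymmetric {p n : ℕ} (x : Fin n → EuclideanSpace ℝ (Fin p)) :
    (sampleCovLin x).IsSymmetric := by
  refine Matrix.isSymmetric_toEuclideanLin_iff.mpr ?_
  ext a b
  simp [sampleCov, Matrix.sum_apply, Matrix.vecMulVec_apply, mul_comm]

/-- The sample eigenvalues, with multiplicity and in decreasing order; index `0` is the largest. -/
def sampleEigenvalue {p n : ℕ} (x : Fin n → EuclideanSpace ℝ (Fin p)) : Fin p → ℝ :=
  (sampleCovLin_isSymmetric x).eigenvalues finrank_euclideanSpace_fin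

/-- `e` picks, for every sample size and every sample, and for every `j`, a unit eigenvector of the
sample covariance matrix associated with its `j`-th largest eigenvalue. The choice is arbitrary
(in particular no choice of signs is made). -/
def IsSampleEigenvectorChoice {p : ℕ}
    (e : ∀ n, (Fin n → EuclideanSpace ℝ (Fin p)) → Fin p → EuclideanSpace ℝ (Fin p)) : Prop :=
  ∀ n (x : Fin n → EuclideanSpace ℝ (Fin p)) (j : Fin p),
    ‖e n x j‖ = 1 ∧ sampleCovLin x (e n x j) = sampleEigenvalue x j • e n x j

/-! ### The test -/

/-- The vectors resulting from the (normalized) Gram-Schmidt orthogonalization of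
`θ₀, w 1, …, w (p - 1)`, where `w` is indexed from `0` and `w 0` is discarded. -/
def orthogonalized {p : ℕ} [NeZero p] (θ₀ : EuclideanSpace ℝ (Fin p))
    (w : Fin p → EuclideanSpace ℝ (Fin p)) : Fin p → EuclideanSpace ℝ (Fin p) :=
  InnerProductSpace.gramSchmidtNormed ℝ (Function.update w 0 θ₀)

/-- The test statistic
`Q = (n / λ̂₁) ∑_{j ≥ 2} λ̂ⱼ⁻¹ (θ̃ⱼ' S θ₀)²`, in terms of the chosen sample eigenvectors `w`. -/
def hpvStatistic {p n : ℕ} [NeZero p] (θ₀ : EuclideanSpace ℝ (Fin p))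
    (x : Fin n → EuclideanSpace ℝ (Fin p)) (w : Fin p → EuclideanSpace ℝ (Fin p)) : ℝ :=
  (n : ℝ) / sampleEigenvalue x 0 *
    ∑ j ∈ Finset.univ.erase (0 : Fin p),
      (sampleEigenvalue x j)⁻¹ * (inner ℝ (orthogonalized θ₀ w j) (sampleCovLin x θ₀)) ^ 2

open Classical in
/-- The test (as a critical function) that rejects when the statistic exceeds the upper
`α`-quantile of the chi-square distribution with `p - 1` degrees of freedom. -/
def hpvTest {p n : ℕ} [NeZero p] (α : ℝ) (θ₀ : EuclideanSpace ℝ (Fin p))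
    (x : Fin n → EuclideanSpace ℝ (Fin p)) (w : Fin p → EuclideanSpace ℝ (Fin p)) : ℝ :=
  if chiSqUpperQuantile (p - 1) α < hpvStatistic θ₀ x w then 1 else 0

/-! ### Asymptotic notions -/

/-- Convergence in distribution of the statistics `T n`, under `P n`, to the distribution `ν`. As
usual, `T n` need only be a genuine random variable for `n` large. -/
def ConvergesInLaw {Ω : ℕ → Type*} [∀ n, MeasurableSpace (Ω n)] (T : ∀ n, Ω n → ℝ)
    (P : ∀ n, Measure (Ω n)) [∀ n, IsProbabilityMeasure (P n)]
    (ν : Measure ℝ) [IsProbabilityMeasure ν] : Prop :=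
  ∃ N : ℕ, TendstoInDistribution (fun n => T (n + N)) atTop (id : ℝ → ℝ) (fun n => P (n + N)) ν

section Maximin

variable {p : ℕ} {Ω : ℕ → Type*} [∀ n, MeasurableSpace (Ω n)]

/-- A sequence of (possibly randomized) tests in the experiments `P n θ`, with `θ` ranging over the
unit sphere. -/
def IsTestSequence (P : ∀ n, EuclideanSpace ℝ (Fin p) → Measure (Ω n))
    (φ : ∀ n, Ω n → ℝ) : Prop :=
  (∀ n ω, φ n ω ∈ Set.Icc (0 : ℝ) 1) ∧
    ∀ᶠ n in atTop, ∀ θ : EuclideanSpace ℝ (Fin p), ‖θ‖ = 1 → AEMeasurable (φ n) (P n θ)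

/-- The tests `φ` of the null hypothesis `θ = θ₀` have asymptotic level `α`. -/
def HasAsymptoticLevel (P : ∀ n, EuclideanSpace ℝ (Fin p) → Measure (Ω n))
    (θ₀ : EuclideanSpace ℝ (Fin p)) (α : ℝ) (φ : ∀ n, Ω n → ℝ) : Prop :=
  limsup (fun n => ∫ ω, φ n ω ∂(P n θ₀)) atTop ≤ α

/-- The smallest power of the test `φ` against the local alternatives `θ₀ + ν τ` (unit vectors)
with `ε ≤ ‖τ‖ ≤ C`. -/
def minLocalPower {Ω : Type*} [MeasurableSpace Ω] (P : EuclideanSpace ℝ (Fin p) → Measure Ω)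
    (θ₀ : EuclideanSpace ℝ (Fin p)) (ν ε C : ℝ) (φ : Ω → ℝ) : ℝ :=
  ⨅ τ : {τ : EuclideanSpace ℝ (Fin p) // ε ≤ ‖τ‖ ∧ ‖τ‖ ≤ C ∧ ‖θ₀ + ν • τ‖ = 1},
    ∫ ω, φ ω ∂(P (θ₀ + ν • τ.1))

/-- The tests `φ` of `θ = θ₀` against `θ ≠ θ₀` are locally asymptotically maximin at level `α`, for
local alternatives `θ₀ + ν n • τ` at the (contiguity) rate `ν`: they have asymptotic level `α`, and
their asymptotic minimal power over any set of local alternatives `ε ≤ ‖τ‖ ≤ C` is not smaller than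
that of any other sequence of tests with asymptotic level `α`. -/
def IsLocallyAsymptoticallyMaximin (P : ∀ n, EuclideanSpace ℝ (Fin p) → Measure (Ω n))
    (θ₀ : EuclideanSpace ℝ (Fin p)) (ν : ℕ → ℝ) (α : ℝ) (φ : ∀ n, Ω n → ℝ) : Prop :=
  IsTestSequence P φ ∧ HasAsymptoticLevel P θ₀ α φ ∧
    ∀ ε C : ℝ, 0 < ε → ε ≤ C →
      ∀ ψ : ∀ n, Ω n → ℝ, IsTestSequence P ψ → HasAsymptoticLevel P θ₀ α ψ →
        limsup (fun n => minLocalPower (P n) θ₀ (ν n) ε C (ψ n)) atTop ≤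
          liminf (fun n => minLocalPower (P n) θ₀ (ν n) ε C (φ n)) atTop

end Maximin

end

end WeakPCA

open scoped ENNReal NNReal

/-! ### Null sets and densities -/

/-! A sample from the spiked law is the image of a standard Gaussian sample under `z ↦ z + d ⟨θ, z⟩
θ` with `d = √(1 + r v) - 1`, a square root of the covariance. All sample sizes are therefore
realised on one space, `stdGaussianSeq`, where `S_n` tends almost surely to the identity and all its
eigenvalues tend to 1.

Limit law. The statistic is built from arbitrary eigenvectors, but for `n ≥ 2p` almost no sample
covariance matrix has an eigenvector orthogonal to `θ₀`: this is the nonvanishing of a Krylov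
determinant, an analytic function of the data. For such samples the spectrum is simple, eigenvectors
are unique up to scale, and the Gram-Schmidt vectors complete `θ₀` to an orthonormal basis. So the
statistic is almost surely a measurable function of the data, and Parseval turns it, up to
eigenvalue factors tending to 1, into `n` times the squared norm of the component of `S_n θ₀`
orthogonal to `θ₀` (`HasGenericSpectrum.sum_sq_inner_gramSchmidt`, `abs_hpvStatistic_sub_le`).

Let `θ'` be the limit of the true directions and `κ` that of `√n r_n v`. In a basis `b` with `b 0 =
θ₀`, the `b j` coordinate of `√n S_n θ₀`, `j ≠ 0`, splits into a Gaussian term (central limit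
theorem), a drift tending to `κ ⟨θ', θ₀⟩ ⟨θ', b j⟩`, and a negligible correction for the sample
mean. Hence the limit is `‖g + m‖²` with `g` standard Gaussian and `‖m‖² = κ² i² (1 - i²)`, `i =
⟨θ', θ₀⟩ = 1 - ‖τ‖²/2`. With `κ = v` this is the stated noncentrality; with `κ = 0` it vanishes.

Power. The noncentral tail strictly exceeds the central one: freeze all coordinates but the shifted
one, and use that a centred interval has larger Gaussian mass than its translates
(`gaussianReal_Icc_lt`).

Optimality. The likelihood ratio of the spiked to the standard Gaussian sample has second moment `(1
- c²)^(-n/2)`, `c = r_n v`, which tends to 1 when `√n c → 0`. All laws of the model then merge in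
total variation, uniformly in `θ`. No test has asymptotic power above its level, so any test of
exact asymptotic level `α` is maximin. -/

theorem volume_zeroSet_eq_zero_of_analytic {g : ℝ → ℝ} (hg : ContDiff ℝ ⊤ g) {t₀ : ℝ}
    (h₀ : g t₀ ≠ 0) : volume {t | g t = 0} = 0 := by
  -- The smoothness exponent `⊤` is `ω`: the hypothesis is analyticity, not mere smoothness, so
  -- zeros are isolated and hence countable.
  have hg' : AnalyticOnNhd ℝ g Set.univ := fun x _ => hg.contDiffAt.analyticAt
  have h := hg'.preimage_zero_mem_codiscrete h₀
  have h2 : ({t | g t = 0} : Set ℝ).Countable := by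
    have h3 : IsDiscrete {t | g t = 0} := by
      rw [← Set.inter_univ {t | g t = 0}]
      exact isDiscrete_of_codiscreteWithin h
    have := h3.to_subtype
    exact Set.countable_coe_iff.1 (countable_of_Lindelof_of_discrete (X := {t | g t = 0}))
  exact h2.measure_zero _

/-- Restricted to each line through a point where `f` is nonzero, `f` has a null zero set. By Fubini
some dilation `t ≠ 0` makes the set of bad directions `z` null, and scaling by `t` preserves null
sets. -/
theorem addHaar_zeroSet_eq_zero_of_analytic {E : Type*} [NormedAddCommGroup E] [NormedSpace ℝ E]
    [FiniteDimensional ℝ E] [MeasurableSpace E] [BorelSpace E] (μ : Measure E) [μ.IsAddHaarMeasure]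
    {f : E → ℝ} (hf : ContDiff ℝ ⊤ f) {x₀ : E} (h₀ : f x₀ ≠ 0) : μ {x | f x = 0} = 0 := by
  set g : E → ℝ := fun z => f (x₀ + z) with hg
  have hgc : ContDiff ℝ ⊤ g := by fun_prop
  have hmeas : MeasurableSet {q : ℝ × E | g (q.1 • q.2) = 0} := by
    have : Continuous fun q : ℝ × E => g (q.1 • q.2) := by
      have := hgc.continuous
      fun_prop
    exact (isClosed_singleton.preimage this).measurableSet
  have hprod : (volume.prod μ) {q : ℝ × E | g (q.1 • q.2) = 0} = 0 := by
    rw [← Measure.prod_swap, Measure.map_apply measurable_swap hmeas]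
    refine Measure.measure_prod_null_of_ae_null (measurable_swap hmeas) (ae_of_all _ fun z => ?_)
    refine volume_zeroSet_eq_zero_of_analytic (g := fun t : ℝ => g (t • z)) (by fun_prop) (t₀ := 0) ?_
    simpa [hg] using h₀
  have hae := Measure.ae_ae_of_ae_prod (μ := (volume : Measure ℝ)) (ν := μ)
    (p := fun q => g (q.1 • q.2) ≠ 0) (by simpa [ae_iff] using hprod)
  have hne : ∀ᵐ t : ℝ, t ≠ 0 := by simp [ae_iff]
  obtain ⟨t, ht, ht0⟩ := (hae.and hne).exists
  have h1 : μ ((fun z : E => t • z) ⁻¹' {z | g z = 0}) = 0 := by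
    simpa [ae_iff] using ht
  rw [Measure.addHaar_preimage_smul μ ht0] at h1
  have h2 : μ {z | g z = 0} = 0 := by
    rcases mul_eq_zero.1 h1 with h | h
    · simp [ht0] at h
    · exact h
  have h3 : {x | f x = 0} = (fun x => -x₀ + x) ⁻¹' {z | g z = 0} := by
    ext x; simp [hg]
  rw [h3, measure_preimage_add, h2]

theorem lintegral_fin_prod_eq_prod {n : ℕ} {E : Type*} [MeasurableSpace E]
    (μ : (i : Fin n) → Measure E) [∀ i, SigmaFinite (μ i)] {f : (i : Fin n) → E → ℝ≥0∞}
    (hf : ∀ i, Measurable (f i)) :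
    ∫⁻ x : (i : Fin n) → E, ∏ i, f i (x i) ∂(Measure.pi μ) = ∏ i, ∫⁻ x, f i x ∂(μ i) := by
  induction n with
  | zero => simp
  | succ n n_ih =>
    calc
      _ = ∫⁻ x : E × (Fin n → E),
          f 0 x.1 * ∏ i : Fin n, f (Fin.succ i) (x.2 i)
          ∂((μ 0).prod (Measure.pi (fun i ↦ μ i.succ))) := by
        rw [← ((measurePreserving_piFinSuccAbove μ 0).symm).lintegral_comp_emb
          (MeasurableEquiv.measurableEmbedding _)]
        simp_rw [MeasurableEquiv.piFinSuccAbove_symm_apply, Fin.insertNthEquiv,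
          Fin.prod_univ_succ, Fin.insertNth_zero, Equiv.coe_fn_mk, Fin.cons_succ,
          Fin.zero_succAbove, cast_eq, Fin.cons_zero]
      _ = (∫⁻ x, f 0 x ∂μ 0)
          * ∏ i : Fin n, ∫⁻ (x : E), f (Fin.succ i) x ∂(μ i.succ) := by
        rw [← n_ih _ fun i => hf _, ← lintegral_prod_mul (hf 0).aemeasurable]
        exact (Finset.measurable_prod _ fun i _ => (hf _).comp (measurable_pi_apply i)).aemeasurable
      _ = ∏ i, ∫⁻ x, f i x ∂(μ i) := by rw [Fin.prod_univ_succ]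

theorem lintegral_fintype_prod_eq_prod {ι : Type*} [Fintype ι] {E : Type*}
    [MeasurableSpace E] (μ : (i : ι) → Measure E) [∀ i, SigmaFinite (μ i)]
    {f : (i : ι) → E → ℝ≥0∞} (hf : ∀ i, Measurable (f i)) :
    ∫⁻ x : (i : ι) → E, ∏ i, f i (x i) ∂(Measure.pi μ) = ∏ i, ∫⁻ x, f i x ∂(μ i) := by
  let e := (Fintype.equivFin ι).symm
  rw [← (measurePreserving_piCongrLeft _ e).lintegral_comp_emb
    (MeasurableEquiv.measurableEmbedding _)]
  simp_rw [← e.prod_comp, MeasurableEquiv.coe_piCongrLeft, Equiv.piCongrLeft_apply_apply]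
  exact lintegral_fin_prod_eq_prod _ fun i => hf _

theorem pi_withDensity {ι : Type*} [Fintype ι] {X : Type*} [MeasurableSpace X]
    (μ : ι → Measure X) [∀ i, SigmaFinite (μ i)] {f : ι → X → ℝ≥0∞}
    (hf : ∀ i, Measurable (f i)) [∀ i, SigmaFinite ((μ i).withDensity (f i))] :
    Measure.pi (fun i => (μ i).withDensity (f i)) =
      (Measure.pi μ).withDensity fun x => ∏ i, f i (x i) := by
  refine Measure.pi_eq fun s hs => ?_
  rw [withDensity_apply _ (MeasurableSet.univ_pi hs), ← lintegral_indicator (MeasurableSet.univ_pi hs)]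
  have : ((Set.univ.pi s).indicator fun x => ∏ i, f i (x i)) =
      fun x => ∏ i, (s i).indicator (f i) (x i) := by
    classical
    ext x
    by_cases hx : x ∈ Set.univ.pi s
    · rw [Set.indicator_of_mem hx]
      exact Finset.prod_congr rfl fun i _ => by rw [Set.indicator_of_mem (hx i trivial)]
    · rw [Set.indicator_of_notMem hx]
      simp only [Set.mem_pi, Set.mem_univ, true_imp_iff, not_forall] at hx
      obtain ⟨i, hi⟩ := hx
      exact (Finset.prod_eq_zero (Finset.mem_univ i) (by simp [hi])).symm
  rw [this]
  rw [lintegral_fintype_prod_eq_prod μ fun i => (hf i).indicator (hs i)]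
  exact Finset.prod_congr rfl fun i _ => by
    rw [withDensity_apply _ (hs i), lintegral_indicator (hs i)]

theorem pi_absolutelyContinuous {ι : Type*} [Fintype ι] {X : Type*}
    [MeasurableSpace X] (μ ν : ι → Measure X) [∀ i, SigmaFinite (μ i)]
    [∀ i, SigmaFinite (ν i)] (h : ∀ i, μ i ≪ ν i) : Measure.pi μ ≪ Measure.pi ν := by
  have h1 : ∀ i, (ν i).withDensity ((μ i).rnDeriv (ν i)) = μ i := fun i =>
    Measure.withDensity_rnDeriv_eq _ _ (h i)
  have h2 : ∀ i, SigmaFinite ((ν i).withDensity ((μ i).rnDeriv (ν i))) := fun i => by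
    rw [h1]; infer_instance
  have := pi_withDensity ν (fun i => Measure.measurable_rnDeriv (μ i) (ν i))
  simp only [h1] at this
  rw [this]
  exact withDensity_absolutelyContinuous _ _

/-! ### Gram-Schmidt and eigenvectors -/

section GramSchmidt

variable {E ι : Type*} [NormedAddCommGroup E] [InnerProductSpace ℝ E] [LinearOrder ι]
  [LocallyFiniteOrderBot ι] [WellFoundedLT ι]

theorem gramSchmidt_smul (f : ι → E) {c : ι → ℝ} (hc : ∀ i, c i ≠ 0) (i : ι) :
    InnerProductSpace.gramSchmidt ℝ (fun j => c j • f j) i =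
      c i • InnerProductSpace.gramSchmidt ℝ f i := by
  induction i using WellFoundedLT.induction with
  | ind i ih =>
    rw [InnerProductSpace.gramSchmidt_def, InnerProductSpace.gramSchmidt_def ℝ f, smul_sub,
      Finset.smul_sum]
    congr 1
    refine Finset.sum_congr rfl fun j hj => ?_
    rw [ih j (Finset.mem_Iio.1 hj), map_smul]
    congr 2
    have : (ℝ ∙ (c j • InnerProductSpace.gramSchmidt ℝ f j)) =
        ℝ ∙ InnerProductSpace.gramSchmidt ℝ f j :=
      Submodule.span_singleton_smul_eq (IsUnit.mk0 _ (hc j)) _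
    simp only [this]

/-- Rescaling the inputs changes the normalized outputs only by signs, which the square removes.
This is why the statistic ignores the choice of eigenvectors once these are unique up to scale. -/
theorem sq_inner_gramSchmidtNormed_smul (f : ι → E) {c : ι → ℝ} (hc : ∀ i, c i ≠ 0) (i : ι)
    (u : E) :
    inner ℝ (InnerProductSpace.gramSchmidtNormed ℝ (fun j => c j • f j) i) u ^ 2 =
      inner ℝ (InnerProductSpace.gramSchmidtNormed ℝ f i) u ^ 2 := by
  simp only [InnerProductSpace.gramSchmidtNormed, gramSchmidt_smul f hc, norm_smul,
    inner_smul_left, RCLike.ofReal_real_eq_id, id, Real.norm_eq_abs]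
  simp only [map_inv₀, conj_trivial, mul_inv, mul_pow, inv_pow, sq_abs]
  have := hc i
  field_simp

theorem measurable_gramSchmidtNormed {Ω : Type*} [MeasurableSpace Ω] [MeasurableSpace E]
    [BorelSpace E] [SecondCountableTopology E] {f : Ω → ι → E}
    (hf : ∀ i, Measurable fun x => f x i) (i : ι) :
    Measurable fun x => InnerProductSpace.gramSchmidtNormed ℝ (f x) i := by
  have h : ∀ i, Measurable fun x => InnerProductSpace.gramSchmidt ℝ (f x) i := by
    intro i
    induction i using WellFoundedLT.induction with
    | ind i ih =>
      simp only [InnerProductSpace.gramSchmidt_def ℝ _ i, Submodule.starProjection_singleton]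
      refine (hf i).sub (Finset.measurable_fun_sum _ fun j hj => ?_)
      have := ih j (Finset.mem_Iio.1 hj)
      have := hf i
      refine Measurable.smul (Measurable.div ?_ ?_) ?_
      · exact Measurable.inner ‹_› ‹_›
      · simp only [RCLike.ofReal_real_eq_id, id]; fun_prop
      · assumption
  have := h i
  simp only [InnerProductSpace.gramSchmidtNormed, RCLike.ofReal_real_eq_id, id]
  fun_prop

end GramSchmidt

/-- No eigenvector of `T` is orthogonal to `θ`. -/
def HasGenericSpectrum {E : Type*} [NormedAddCommGroup E] [InnerProductSpace ℝ E]
    (T : E →ₗ[ℝ] E) (θ : E) : Prop :=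
  ∀ u : E, u ≠ 0 → ∀ μ : ℝ, T u = μ • u → inner ℝ u θ ≠ 0

/-! ### Consequences of a generic spectrum -/

section Generic

variable {E : Type*} [NormedAddCommGroup E] [InnerProductSpace ℝ E] {T : E →ₗ[ℝ] E} {θ : E}

theorem hasGenericSpectrum_of_orthonormalBasis {ι : Type*} [Fintype ι] (hT : T.IsSymmetric)
    (f : OrthonormalBasis ι ℝ E) {d : ι → ℝ} (hd : Function.Injective d)
    (hf : ∀ k, T (f k) = d k • f k) (hθ : ∀ k, inner ℝ (f k) θ ≠ 0) :
    HasGenericSpectrum T θ := by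
  intro u hu μ hμ
  have h1 : ∀ k, μ * inner ℝ u (f k) = d k * inner ℝ u (f k) := fun k => by
    have := hT u (f k)
    rw [hμ, hf, inner_smul_left, inner_smul_right] at this
    simpa using this
  obtain ⟨k, hk⟩ : ∃ k, inner ℝ u (f k) ≠ 0 := by
    by_contra! h
    refine hu ?_
    rw [← f.sum_repr' u]
    exact Finset.sum_eq_zero fun k _ => by rw [real_inner_comm, h k, zero_smul]
  have hμk : μ = d k := mul_right_cancel₀ hk (h1 k)
  rw [← f.sum_inner_mul_inner u θ, Finset.sum_eq_single k]
  · exact mul_ne_zero hk (hθ k)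
  · intro l _ hl
    have : (d k - d l) * inner ℝ u (f l) = 0 := by rw [sub_mul, ← hμk, h1 l, sub_self]
    rcases mul_eq_zero.1 this with h | h
    · exact absurd (hd (sub_eq_zero.1 h)).symm hl
    · simp [h]
  · simp

/-- A two-dimensional eigenspace always meets the hyperplane orthogonal to `θ`; the vector `y` in
the proof is such an intersection. So a generic spectrum is simple. -/
theorem HasGenericSpectrum.eigenvalue_ne (hT : HasGenericSpectrum T θ) {u w : E} {μ : ℝ}
    (huw : inner ℝ u w = 0) (hu : u ≠ 0) (hw : w ≠ 0) (h1 : T u = μ • u) : T w ≠ μ • w := by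
  intro h2
  have hw0 := hT w hw μ h2
  set y := inner ℝ w θ • u - inner ℝ u θ • w with hy
  have hyn : y ≠ 0 := by
    intro h0
    have := congrArg (fun z => inner ℝ u z) h0
    simp [hy, inner_sub_right, inner_smul_right, huw, hw0, hu] at this
  refine hT y hyn μ ?_ ?_
  · simp [hy, h1, h2, smul_sub, smul_comm μ]
  · simp [hy, inner_sub_left, inner_smul_left, mul_comm]

variable [FiniteDimensional ℝ E] {p : ℕ} (hT : T.IsSymmetric) (hp : Module.finrank ℝ E = p)

theorem HasGenericSpectrum.eigenvalues_injective (h : HasGenericSpectrum T θ) :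
    Function.Injective (hT.eigenvalues hp) := by
  intro i j hij
  by_contra hne
  have hb := hT.apply_eigenvectorBasis hp
  refine h.eigenvalue_ne ((hT.eigenvectorBasis hp).orthonormal.2 hne)
    ((hT.eigenvectorBasis hp).orthonormal.ne_zero i)
    ((hT.eigenvectorBasis hp).orthonormal.ne_zero j) (hb i) ?_
  rw [hij]
  exact hb j

variable {w : Fin p → E} (hw : ∀ j, ‖w j‖ = 1) (hTw : ∀ j, T (w j) = hT.eigenvalues hp j • w j)
include hw hTw

theorem HasGenericSpectrum.orthonormal (h : HasGenericSpectrum T θ) : Orthonormal ℝ w := by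
  refine ⟨hw, fun i j hij => ?_⟩
  have h1 := hT (w i) (w j)
  rw [hTw, hTw, inner_smul_left, inner_smul_right] at h1
  have h2 : (hT.eigenvalues hp i - hT.eigenvalues hp j) * inner ℝ (w i) (w j) = 0 := by
    rw [sub_mul]; simp only [conj_trivial] at h1; linarith
  rcases mul_eq_zero.1 h2 with h3 | h3
  · exact absurd (h.eigenvalues_injective hT hp (sub_eq_zero.1 h3)) hij
  · exact h3

theorem HasGenericSpectrum.exists_orthonormalBasis (h : HasGenericSpectrum T θ) :
    ∃ b : OrthonormalBasis (Fin p) ℝ E, ∀ i, b i = w i := by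
  have ho := h.orthonormal hT hp hw hTw
  obtain ⟨b, hb⟩ := Orthonormal.exists_orthonormalBasis_extension_of_card_eq (𝕜 := ℝ) (E := E)
    (ι := Fin p) (by simpa using hp) (v := w) (s := Set.univ)
    (ho.comp (fun i : (Set.univ : Set (Fin p)) => (i : Fin p)) Subtype.val_injective)
  exact ⟨b, fun i => hb i trivial⟩

/-- Pairing a vanishing combination with the discarded `w 0` isolates the coefficient of `θ`,
because `⟨w 0, θ⟩ ≠ 0`. Independence keeps Gram-Schmidt from producing zero vectors. -/
theorem HasGenericSpectrum.linearIndependent_update [NeZero p] (h : HasGenericSpectrum T θ) :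
    LinearIndependent ℝ (Function.update w 0 θ) := by
  have ho := h.orthonormal hT hp hw hTw
  rw [Fintype.linearIndependent_iff]
  intro g hg
  have hg' : g 0 • θ + ∑ i ∈ Finset.univ.erase 0, g i • w i = 0 := by
    rw [← hg, ← Finset.add_sum_erase _ (fun i => g i • Function.update w 0 θ i)
      (Finset.mem_univ (0 : Fin p))]
    congr 1
    exact Finset.sum_congr rfl fun i hi => by
      rw [Function.update_of_ne (Finset.ne_of_mem_erase hi)]
  have key : ∀ j, inner ℝ (w j) (∑ i ∈ Finset.univ.erase 0, g i • w i) = if j = 0 then 0 else g j := by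
    intro j
    rw [inner_sum]
    simp only [inner_smul_right, orthonormal_iff_ite.1 ho, mul_ite, mul_one, mul_zero,
      Finset.sum_ite_eq, Finset.mem_erase, Finset.mem_univ, and_true, ite_not, ne_eq]
  have h0 : g 0 = 0 := by
    have := congrArg (fun z => inner ℝ (w 0) z) hg'
    simp only [inner_add_right, inner_smul_right, key, if_true, add_zero, inner_zero_right] at this
    exact (mul_eq_zero.1 this).resolve_right (h (w 0) (ho.ne_zero 0) _ (hTw 0))
  intro j
  by_cases hj : j = 0
  · rw [hj, h0]
  · have := congrArg (fun z => inner ℝ (w j) z) hg'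
    simpa only [inner_add_right, inner_smul_right, key, h0, hj, zero_mul, zero_add, if_false,
      inner_zero_right] using this

/-- Parseval in an orthonormal basis whose first vector is `θ`: the eigenvectors drop out of the
sum. -/
theorem HasGenericSpectrum.sum_sq_inner_gramSchmidt [NeZero p] (h : HasGenericSpectrum T θ)
    (hθ : ‖θ‖ = 1) (u : E) :
    ∑ j ∈ Finset.univ.erase (0 : Fin p),
      inner ℝ (InnerProductSpace.gramSchmidtNormed ℝ (Function.update w 0 θ) j) u ^ 2 =
      ‖u‖ ^ 2 - inner ℝ θ u ^ 2 := by
  have hl := h.linearIndependent_update hT hp hw hTw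
  have ho := InnerProductSpace.gramSchmidtNormed_orthonormal hl
  obtain ⟨b, hb⟩ := Orthonormal.exists_orthonormalBasis_extension_of_card_eq (𝕜 := ℝ) (E := E)
    (ι := Fin p) (by simpa using hp) (s := Set.univ)
    (ho.comp (fun i : (Set.univ : Set (Fin p)) => (i : Fin p)) Subtype.val_injective)
  have h0 : InnerProductSpace.gramSchmidtNormed ℝ (Function.update w 0 θ) 0 = θ := by
    simp only [InnerProductSpace.gramSchmidtNormed]
    have : InnerProductSpace.gramSchmidt ℝ (Function.update w 0 θ) 0 = θ := by
      rw [InnerProductSpace.gramSchmidt_def]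
      have : Finset.Iio (0 : Fin p) = ∅ := by ext x; simp
      rw [this]; simp
    rw [this, hθ]; simp
  have hs := b.sum_sq_norm_inner_right u
  rw [← Finset.add_sum_erase _ _ (Finset.mem_univ (0 : Fin p))] at hs
  simp only [hb _ (Set.mem_univ _), h0, Real.norm_eq_abs, sq_abs] at hs
  linarith

/-- In the eigenbasis this polynomial in `T` kills every component of `θ` but the `j`-th, which
survives by simplicity and genericity. It gives an explicit, hence measurable, eigenvector. -/
theorem HasGenericSpectrum.exists_smul_eq (h : HasGenericSpectrum T θ) (j : Fin p) :
    ∃ c : ℝ, c ≠ 0 ∧ Polynomial.aeval T (∏ k ∈ Finset.univ.erase j,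
      (Polynomial.X - Polynomial.C (hT.eigenvalues hp k))) θ = c • w j := by
  obtain ⟨b, hb⟩ := h.exists_orthonormalBasis hT hp hw hTw
  have hn := (h.orthonormal hT hp hw hTw).ne_zero
  set P := ∏ k ∈ Finset.univ.erase j, (Polynomial.X - Polynomial.C (hT.eigenvalues hp k)) with hP
  refine ⟨inner ℝ (w j) θ * P.eval (hT.eigenvalues hp j), ?_, ?_⟩
  · refine mul_ne_zero (h _ (hn j) _ (hTw j)) ?_
    rw [hP, Polynomial.eval_prod, Finset.prod_ne_zero_iff]
    intro k hk
    simp only [Polynomial.eval_sub, Polynomial.eval_X, Polynomial.eval_C, sub_ne_zero]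
    exact fun e => Finset.ne_of_mem_erase hk (h.eigenvalues_injective hT hp e).symm
  · conv_lhs => rw [← b.sum_repr' θ]
    rw [map_sum, Finset.sum_eq_single j]
    · rw [map_smul, hb, Module.End.aeval_apply_of_hasEigenvector (μ := hT.eigenvalues hp j)
        ⟨Module.End.mem_eigenspace_iff.2 (hTw j), hn j⟩, smul_smul]
    · intro k _ hk
      rw [map_smul, hb, Module.End.aeval_apply_of_hasEigenvector (μ := hT.eigenvalues hp k)
        ⟨Module.End.mem_eigenspace_iff.2 (hTw k), hn k⟩]
      have : P.eval (hT.eigenvalues hp k) = 0 := by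
        rw [hP, Polynomial.eval_prod]
        exact Finset.prod_eq_zero (Finset.mem_erase.2 ⟨hk, Finset.mem_univ _⟩) (by simp)
      rw [this, zero_smul, smul_zero]
    · simp

end Generic

/-! ### The Krylov determinant as a test of genericity -/

section Krylov

variable {p : ℕ}

/-- The Krylov matrix, with columns `T ^ j θ`. -/
def krylovMatrix (T : EuclideanSpace ℝ (Fin p) →ₗ[ℝ] EuclideanSpace ℝ (Fin p))
    (θ : EuclideanSpace ℝ (Fin p)) : Matrix (Fin p) (Fin p) ℝ :=
  Matrix.of fun i j => ((T ^ (j : ℕ)) θ) i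

variable {T : EuclideanSpace ℝ (Fin p) →ₗ[ℝ] EuclideanSpace ℝ (Fin p)}
  {θ : EuclideanSpace ℝ (Fin p)}

theorem inner_pow_apply_of_eigenvector (hT : T.IsSymmetric) {u : EuclideanSpace ℝ (Fin p)} {μ : ℝ}
    (hμ : T u = μ • u) (j : ℕ) : inner ℝ u ((T ^ j) θ) = μ ^ j * inner ℝ u θ := by
  induction j with
  | zero => simp
  | succ j ih =>
    rw [pow_succ', Module.End.mul_apply, ← hT, hμ, inner_smul_left, ih, pow_succ']
    simp [mul_assoc]

/-- Pairing with an eigenvector turns the column `T ^ j θ` into `μ ^ j ⟨u, θ⟩`. In the generic case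
a linear relation between columns would be a polynomial of degree below `p` with `p` distinct roots;
conversely an eigenvector orthogonal to `θ` lies in the left kernel. -/
theorem hasGenericSpectrum_iff_det_krylovMatrix_ne_zero (hT : T.IsSymmetric) :
    HasGenericSpectrum T θ ↔ (krylovMatrix T θ).det ≠ 0 := by
  constructor
  · intro h hdet
    obtain ⟨c, hc, hKc⟩ := Matrix.exists_mulVec_eq_zero_iff.2 hdet
    refine hc (Matrix.eq_zero_of_forall_index_sum_pow_mul_eq_zero
      (h.eigenvalues_injective hT finrank_euclideanSpace_fin) fun i => ?_)
    have h0 : ∑ j, c j • (T ^ (j : ℕ)) θ = 0 := by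
      ext i
      simpa [krylovMatrix, Matrix.mulVec, dotProduct, mul_comm] using congrFun hKc i
    set b := hT.eigenvectorBasis finrank_euclideanSpace_fin with hb
    have h1 : T (b i) = hT.eigenvalues finrank_euclideanSpace_fin i • b i :=
      hT.apply_eigenvectorBasis finrank_euclideanSpace_fin i
    have h2 := congrArg (fun z => inner ℝ (b i) z) h0
    simp only [inner_sum, inner_smul_right, inner_zero_right,
      inner_pow_apply_of_eigenvector hT h1] at h2
    have h3 : (∑ j : Fin p, hT.eigenvalues finrank_euclideanSpace_fin i ^ (j : ℕ) * c j) *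
        inner ℝ (b i) θ = 0 := by
      rw [← h2, Finset.sum_mul]
      exact Finset.sum_congr rfl fun j _ => by ring
    exact (mul_eq_zero.1 h3).resolve_right (h _ (b.orthonormal.ne_zero i) _ h1)
  · intro hdet u hu μ hμ h0
    refine hu ?_
    have : (fun i => u i) = 0 := by
      refine Matrix.eq_zero_of_vecMul_eq_zero hdet ?_
      ext j
      have := inner_pow_apply_of_eigenvector (θ := θ) hT hμ j
      rw [h0, mul_zero, PiLp.inner_apply] at this
      simpa [krylovMatrix, Matrix.vecMul, dotProduct, mul_comm] using this
    ext i
    exact congrFun this i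

theorem exists_orthonormalBasis_inner_ne_zero [NeZero p] (hθ : ‖θ‖ = 1) :
    ∃ f : OrthonormalBasis (Fin p) ℝ (EuclideanSpace ℝ (Fin p)), ∀ k, inner ℝ (f k) θ ≠ 0 := by
  have hp : 0 < (p : ℝ) := by exact_mod_cast Nat.pos_of_ne_zero (NeZero.ne p)
  set a : EuclideanSpace ℝ (Fin p) := WithLp.toLp 2 fun _ => (√(p : ℝ))⁻¹ with ha
  have hna : ‖a‖ = ‖θ‖ := by
    rw [hθ, EuclideanSpace.norm_eq]
    simp [ha, Real.sq_sqrt hp.le, hp.ne']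
  -- The reflection exchanging `θ` with the flat unit vector `a` carries the standard basis, whose
  -- inner products with `a` are all nonzero, to the required basis.
  have hR := Submodule.reflection_sub hna
  set R := (ℝ ∙ (a - θ))ᗮ.reflection
  refine ⟨(EuclideanSpace.basisFun (Fin p) ℝ).map R, fun k => ?_⟩
  rw [← hR, OrthonormalBasis.map_apply, LinearIsometryEquiv.inner_map_map]
  rw [EuclideanSpace.basisFun_apply, EuclideanSpace.inner_single_left]
  simp [ha, NeZero.ne p]

end Krylov

namespace WeakPCA

variable {p n : ℕ}

/-! ### Measurability of the statistic -/

theorem sampleCovLin_apply (x : Fin n → EuclideanSpace ℝ (Fin p)) (u : EuclideanSpace ℝ (Fin p)) :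
    sampleCovLin x u =
      (n : ℝ)⁻¹ • ∑ i, inner ℝ (x i - sampleMean x) u • (x i - sampleMean x) := by
  ext k
  simp [sampleCovLin, sampleCov, Matrix.vecMulVec_mulVec, PiLp.inner_apply, dotProduct, mul_comm]

theorem contDiff_sampleMean :
    ContDiff ℝ ⊤ (sampleMean : (Fin n → EuclideanSpace ℝ (Fin p)) → _) := by
  unfold sampleMean
  fun_prop

theorem contDiff_sampleCovLin {F : Type*} [NormedAddCommGroup F] [NormedSpace ℝ F]
    {X : F → Fin n → EuclideanSpace ℝ (Fin p)} {y : F → EuclideanSpace ℝ (Fin p)}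
    (hX : ContDiff ℝ ⊤ X) (hy : ContDiff ℝ ⊤ y) :
    ContDiff ℝ ⊤ fun a => sampleCovLin (X a) (y a) := by
  simp only [sampleCovLin_apply]
  have h1 : ContDiff ℝ ⊤ fun a => sampleMean (X a) := contDiff_sampleMean.comp hX
  have h2 : ∀ i, ContDiff ℝ ⊤ fun a => X a i - sampleMean (X a) := fun i =>
    (contDiff_pi.1 hX i).sub h1
  refine ContDiff.const_smul _ (ContDiff.sum fun i _ => ?_)
  exact ((h2 i).inner ℝ hy).smul (h2 i)

theorem measurable_sampleCovLin {Ω : Type*} [MeasurableSpace Ω]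
    {X : Ω → Fin n → EuclideanSpace ℝ (Fin p)} {y : Ω → EuclideanSpace ℝ (Fin p)}
    (hX : Measurable X) (hy : Measurable y) :
    Measurable fun a => sampleCovLin (X a) (y a) := by
  simp only [sampleCovLin_apply]
  have h1 : Measurable fun a => sampleMean (X a) :=
    contDiff_sampleMean.continuous.measurable.comp hX
  have h2 : ∀ i, Measurable fun a => X a i - sampleMean (X a) := fun i =>
    ((measurable_pi_apply i).comp hX).sub h1
  refine Measurable.fun_const_smul (Finset.measurable_fun_sum _ fun i _ => ?_) _
  exact Measurable.fun_smul (Measurable.inner (h2 i) hy) (h2 i)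

theorem eval_charpoly_sampleCovLin (x : Fin n → EuclideanSpace ℝ (Fin p)) (t : ℝ) :
    ∏ i, (t - sampleEigenvalue x i) = (Matrix.scalar (Fin p) t - sampleCov x).det := by
  rw [← Matrix.eval_charpoly]
  have h1 : (sampleCov x).charpoly = (sampleCovLin x).charpoly := by
    rw [← LinearMap.charpoly_toMatrix (sampleCovLin x) (EuclideanSpace.basisFun (Fin p) ℝ).toBasis,
      sampleCovLin, Matrix.toEuclideanLin_eq_toLin_orthonormal, LinearMap.toMatrix_toLin]
  rw [h1, (sampleCovLin_isSymmetric x).charpoly_eq finrank_euclideanSpace_fin,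
    Polynomial.eval_prod]
  simp [sampleEigenvalue]

/-- A polynomial is determined by its values at the naturals, and its roots listed in decreasing
order recover the tuple. -/
theorem injective_prod_natCast_sub :
    Function.Injective fun (l : {l : Fin p → ℝ // Antitone l}) (k : ℕ) => ∏ i, ((k : ℝ) - l.1 i) := by
  intro l l' h
  have hpoly : ∏ i, (Polynomial.X - Polynomial.C (l.1 i)) =
      ∏ i, (Polynomial.X - Polynomial.C (l'.1 i)) := by
    refine Polynomial.eq_of_infinite_eval_eq _ _ ((Set.infinite_range_of_injective
      (Nat.cast_injective (R := ℝ))).mono ?_)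
    rintro _ ⟨k, rfl⟩
    simpa [Polynomial.eval_prod] using congrFun h k
  have hroots := congrArg Polynomial.roots hpoly
  have hr : ∀ l : Fin p → ℝ, (∏ i, (Polynomial.X - Polynomial.C (l i))).roots =
      (List.ofFn l : Multiset ℝ) := fun l => by
    rw [Polynomial.roots_prod _ _ (Finset.prod_ne_zero_iff.2 fun i _ => Polynomial.X_sub_C_ne_zero _)]
    simp [Multiset.bind_singleton, Fin.univ_val_map]
  rw [hr, hr, Multiset.coe_eq_coe] at hroots
  have := hroots.eq_of_pairwise' (List.sortedGE_iff_pairwise.1 l.2.sortedGE_ofFn)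
    (List.sortedGE_iff_pairwise.1 l'.2.sortedGE_ofFn)
  exact Subtype.ext (List.ofFn_injective this)

/-- Lusin-Souslin: a continuous injection of a Polish space is a measurable embedding. Measurability
of the ordered eigenvalues thus reduces to that of the values `det (k - S)`, which are continuous in
the data. -/
theorem measurable_sampleEigenvalue :
    Measurable (sampleEigenvalue : (Fin n → EuclideanSpace ℝ (Fin p)) → Fin p → ℝ) := by
  have hcl : IsClosed {l : Fin p → ℝ | Antitone l} := by
    simp only [Antitone, Set.ofPred_forall]
    exact isClosed_iInter fun i => isClosed_iInter fun j => isClosed_iInter fun _ =>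
      isClosed_le (continuous_apply j) (continuous_apply i)
  have : PolishSpace {l : Fin p → ℝ // Antitone l} := hcl.polishSpace
  have hemb : MeasurableEmbedding
      fun (l : {l : Fin p → ℝ // Antitone l}) (k : ℕ) => ∏ i, ((k : ℝ) - l.1 i) :=
    Continuous.measurableEmbedding (continuous_pi fun k => continuous_finsetProd _ fun i _ =>
      continuous_const.sub ((continuous_apply i).comp continuous_subtype_val)) injective_prod_natCast_sub
  let L : (Fin n → EuclideanSpace ℝ (Fin p)) → {l : Fin p → ℝ // Antitone l} := fun x =>
    ⟨sampleEigenvalue x, (sampleCovLin_isSymmetric x).eigenvalues_antitone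
      finrank_euclideanSpace_fin⟩
  have hL : Measurable L := by
    rw [← hemb.measurable_comp_iff]
    refine measurable_pi_lambda _ fun k => ?_
    simp only [L, Function.comp_def, eval_charpoly_sampleCovLin]
    have : Continuous fun x : Fin n → EuclideanSpace ℝ (Fin p) =>
        (Matrix.scalar (Fin p) (k : ℝ) - sampleCov x).det := by
      unfold sampleCov
      have := (contDiff_sampleMean (p := p) (n := n)).continuous
      refine Continuous.matrix_det (continuous_const.sub (Continuous.fun_const_smul
        (continuous_finsetSum _ fun i _ => Continuous.matrix_vecMulVec ?_ ?_) _)) <;> fun_prop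
    exact this.measurable
  exact measurable_subtype_coe.comp hL

/-- The vector `∏ k ≠ j, (S - λ_k) θ`, an eigenvector of `S` for `λ_j`. -/
noncomputable def eigenDirection (θ : EuclideanSpace ℝ (Fin p))
    (x : Fin n → EuclideanSpace ℝ (Fin p)) (j : Fin p) : EuclideanSpace ℝ (Fin p) :=
  Polynomial.aeval (sampleCovLin x) (∏ k ∈ Finset.univ.erase j,
    (Polynomial.X - Polynomial.C (sampleEigenvalue x k))) θ

theorem measurable_eigenDirection (θ : EuclideanSpace ℝ (Fin p)) (j : Fin p) :
    Measurable fun x : Fin n → EuclideanSpace ℝ (Fin p) => eigenDirection θ x j := by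
  unfold eigenDirection
  induction (Finset.univ.erase j) using Finset.induction_on with
  | empty => simp
  | insert k s hk ih =>
    simp only [Finset.prod_insert hk, map_mul, Module.End.mul_apply, map_sub, Polynomial.aeval_X,
      Polynomial.aeval_C, LinearMap.sub_apply, Module.algebraMap_end_apply]
    refine (measurable_sampleCovLin measurable_id ih).sub (Measurable.fun_smul ?_ ih)
    exact (measurable_pi_apply k).comp measurable_sampleEigenvalue

theorem measurable_hpvStatistic [NeZero p] (θ : EuclideanSpace ℝ (Fin p)) :
    Measurable fun x : Fin n → EuclideanSpace ℝ (Fin p) =>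
      hpvStatistic θ x (eigenDirection θ x) := by
  have hl : ∀ j, Measurable fun x : Fin n → EuclideanSpace ℝ (Fin p) => sampleEigenvalue x j :=
    fun j => (measurable_pi_apply j).comp measurable_sampleEigenvalue
  unfold hpvStatistic orthogonalized
  refine (measurable_const.div (hl 0)).mul (Finset.measurable_fun_sum _ fun j _ =>
    (hl j).inv.mul (Measurable.pow_const (Measurable.inner ?_ ?_) 2))
  · refine measurable_gramSchmidtNormed (fun i => ?_) j
    by_cases hi : i = 0
    · subst hi; simp
    · simpa [Function.update_of_ne hi] using measurable_eigenDirection θ i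
  · exact measurable_sampleCovLin measurable_id measurable_const

/-! ### Generic samples -/

theorem hpvStatistic_eq_of_hasGenericSpectrum [NeZero p] {θ : EuclideanSpace ℝ (Fin p)}
    {x : Fin n → EuclideanSpace ℝ (Fin p)} (h : HasGenericSpectrum (sampleCovLin x) θ)
    {w : Fin p → EuclideanSpace ℝ (Fin p)} (hw : ∀ j, ‖w j‖ = 1)
    (hTw : ∀ j, sampleCovLin x (w j) = sampleEigenvalue x j • w j) :
    hpvStatistic θ x w = hpvStatistic θ x (eigenDirection θ x) := by
  choose c hc hcw using h.exists_smul_eq (sampleCovLin_isSymmetric x)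
    finrank_euclideanSpace_fin hw hTw
  have : Function.update (eigenDirection θ x) 0 θ =
      fun j => Function.update c 0 1 j • Function.update w 0 θ j := by
    ext1 j
    by_cases hj : j = 0
    · subst hj; simp
    · simp only [Function.update_of_ne hj]
      exact hcw j
  unfold hpvStatistic orthogonalized
  congr 1
  refine Finset.sum_congr rfl fun j _ => ?_
  rw [this, sq_inner_gramSchmidtNormed_smul]
  intro i
  by_cases hi : i = 0
  · subst hi; simp
  · simpa [Function.update_of_ne hi] using hc i

theorem exists_hasGenericSpectrum [NeZero p] {θ : EuclideanSpace ℝ (Fin p)} (hθ : ‖θ‖ = 1)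
    (hn : 2 * p ≤ n) :
    ∃ x : Fin n → EuclideanSpace ℝ (Fin p), HasGenericSpectrum (sampleCovLin x) θ := by
  obtain ⟨f, hf⟩ := exists_orthonormalBasis_inner_ne_zero hθ
  have hp : 0 < p := Nat.pos_of_ne_zero (NeZero.ne p)
  have hn0 : (0 : ℝ) < n := by
    have : 0 < n := by omega
    exact_mod_cast this
  -- The points `±√k f_k`, padded with zeros, have mean zero, and their covariance matrix has
  -- eigenvector `f_k` with eigenvalue `2k/n`: distinct eigenvalues, and no `f_k` orthogonal to `θ`.
  -- This is where `2 * p ≤ n` comes from.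
  let y : ℕ → EuclideanSpace ℝ (Fin p) := fun i =>
    if h : i < p then (√(i : ℝ)) • f ⟨i, h⟩
    else if h : i < 2 * p then -(√((i - p : ℕ) : ℝ)) • f ⟨i - p, by omega⟩ else 0
  have hsum : ∀ {V : Type} [AddCommMonoid V] (g : EuclideanSpace ℝ (Fin p) → V) (_ : g 0 = 0),
      ∑ i : Fin n, g (y i) = ∑ k : Fin p, (g ((√(k : ℝ)) • f k) + g (-(√(k : ℝ)) • f k)) := by
    intro V _ g hg
    obtain ⟨m, rfl⟩ := Nat.exists_eq_add_of_le hn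
    rw [Fin.sum_univ_eq_sum_range (fun i => g (y i)) (2 * p + m), Finset.sum_range_add, two_mul,
      Finset.sum_range_add, Finset.sum_add_distrib]
    have h3 : ∑ i ∈ Finset.range m, g (y (p + p + i)) = 0 := by
      refine Finset.sum_eq_zero fun i _ => ?_
      have h1 : ¬ p + p + i < p := by omega
      have h2 : ¬ p + p + i < 2 * p := by omega
      simp only [y, h1, h2, dif_neg, not_false_eq_true, hg]
    rw [h3, add_zero]
    congr 1
    · rw [← Fin.sum_univ_eq_sum_range (fun i => g (y i))]
      exact Finset.sum_congr rfl fun i _ => by simp [y]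
    · rw [← Fin.sum_univ_eq_sum_range (fun i => g (y (p + i)))]
      refine Finset.sum_congr rfl fun i _ => ?_
      have h1 : ¬ p + (i : ℕ) < p := by omega
      have h2 : p + (i : ℕ) < 2 * p := by omega
      simp [y, h1, h2]
  refine ⟨fun i => y i, ?_⟩
  have hmean : sampleMean (fun i : Fin n => y i) = 0 := by
    unfold sampleMean
    rw [hsum (fun z => z) rfl]
    simp
  refine hasGenericSpectrum_of_orthonormalBasis (sampleCovLin_isSymmetric _) f
    (d := fun k => (n : ℝ)⁻¹ * (2 * (k : ℝ))) ?_ ?_ hf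
  · intro k l hkl
    have := mul_left_cancel₀ (inv_ne_zero hn0.ne') hkl
    have : (k : ℝ) = l := by linarith
    exact Fin.ext (by exact_mod_cast this)
  · intro k
    rw [sampleCovLin_apply, hmean]
    simp only [sub_zero]
    rw [hsum (fun z => inner ℝ z (f k) • z) (by simp), Finset.sum_eq_single k]
    · simp only [inner_smul_left, OrthonormalBasis.inner_eq_one, smul_smul, ← add_smul]
      congr 1
      have := Real.mul_self_sqrt (Nat.cast_nonneg (α := ℝ) (k : ℕ))
      simp only [conj_trivial]
      linear_combination 2 * (n : ℝ)⁻¹ * this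
    · intro l _ hl
      simp [inner_smul_left, f.orthonormal.2 hl]
    · simp

/-- In Gaussian coordinates the Krylov determinant is analytic and, by the sample just built, not
identically zero; the Gaussian law is absolutely continuous. -/
theorem ae_hasGenericSpectrum [NeZero p] {θ : EuclideanSpace ℝ (Fin p)} (hθ : ‖θ‖ = 1)
    (hn : 2 * p ≤ n) :
    ∀ᵐ x ∂(Measure.pi fun _ : Fin n => stdGaussian (EuclideanSpace ℝ (Fin p))),
      HasGenericSpectrum (sampleCovLin x) θ := by
  set b := EuclideanSpace.basisFun (Fin p) ℝ
  let Φ : (Fin n → Fin p → ℝ) → Fin n → EuclideanSpace ℝ (Fin p) := fun g i => WithLp.toLp 2 (g i)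
  have hΦ : MeasurePreserving Φ
      (Measure.pi fun _ : Fin n => Measure.pi fun _ : Fin p => gaussianReal 0 1)
      (Measure.pi fun _ : Fin n => stdGaussian (EuclideanSpace ℝ (Fin p))) := by
    refine measurePreserving_pi _ _ fun i => ⟨by fun_prop, ?_⟩
    exact map_pi_eq_stdGaussian
  have hΦc : ContDiff ℝ ⊤ Φ := by
    refine contDiff_pi.2 fun i => ?_
    fun_prop
  have hpow : ∀ j : ℕ, ContDiff ℝ ⊤ fun g => ((sampleCovLin (Φ g)) ^ j) θ := by
    intro j
    induction j with
    | zero => simpa using contDiff_const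
    | succ j ih =>
      simp only [pow_succ', Module.End.mul_apply]
      exact contDiff_sampleCovLin hΦc ih
  have hdet : ContDiff ℝ ⊤ fun g => (krylovMatrix (sampleCovLin (Φ g)) θ).det := by
    simp only [Matrix.det_apply, krylovMatrix, Matrix.of_apply]
    refine ContDiff.sum fun σ _ => ContDiff.const_smul _ (contDiff_prod fun i _ => ?_)
    have := hpow i
    fun_prop
  obtain ⟨x, hx⟩ := exists_hasGenericSpectrum hθ hn
  have hvol := addHaar_zeroSet_eq_zero_of_analytic (volume : Measure (Fin n → Fin p → ℝ)) hdet
    (x₀ := fun i => WithLp.ofLp (x i))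
    ((hasGenericSpectrum_iff_det_krylovMatrix_ne_zero (sampleCovLin_isSymmetric _)).1 (by simpa [Φ]))
  have hac : (Measure.pi fun _ : Fin n => Measure.pi fun _ : Fin p => gaussianReal 0 1) ≪
      (volume : Measure (Fin n → Fin p → ℝ)) :=
    pi_absolutelyContinuous _ _ fun _ => pi_absolutelyContinuous _ _ fun _ =>
      gaussianReal_absolutelyContinuous 0 one_ne_zero
  have h0 := hac hvol
  rw [← hΦ.map_eq, ae_map_iff hΦ.measurable.aemeasurable]
  · filter_upwards [compl_mem_ae_iff.2 h0] with g hg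
    exact (hasGenericSpectrum_iff_det_krylovMatrix_ne_zero (sampleCovLin_isSymmetric _)).2 hg
  · have hpow' : ∀ j : ℕ, Measurable fun x : Fin n → EuclideanSpace ℝ (Fin p) =>
        ((sampleCovLin x) ^ j) θ := by
      intro j
      induction j with
      | zero => simp
      | succ j ih =>
        simp only [pow_succ', Module.End.mul_apply]
        exact measurable_sampleCovLin measurable_id ih
    simp only [hasGenericSpectrum_iff_det_krylovMatrix_ne_zero (sampleCovLin_isSymmetric _),
      Matrix.det_apply, krylovMatrix, Matrix.of_apply]
    refine (measurableSet_singleton (0 : ℝ)).compl.preimage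
      (Finset.measurable_fun_sum _ fun σ _ => Measurable.const_smul
        (Finset.measurable_fun_prod _ fun i _ => ?_) _)
    have := hpow' i
    fun_prop

end WeakPCA

/-! ### Spiked Gaussian laws -/

section Spike

variable {E : Type*} [NormedAddCommGroup E] [InnerProductSpace ℝ E]

/-- The symmetric map `z ↦ z + d ⟨θ, z⟩ θ`. -/
def spikeMap (d : ℝ) (θ z : E) : E := z + (d * inner ℝ θ z) • θ

theorem inner_spikeMap_left (d : ℝ) (θ z t : E) :
    inner ℝ (spikeMap d θ z) t = inner ℝ z (spikeMap d θ t) := by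
  simp only [spikeMap, inner_add_left, inner_add_right, inner_smul_left, inner_smul_right,
    conj_trivial, real_inner_comm θ z]
  ring

theorem continuous_spikeMap (d : ℝ) (θ : E) : Continuous (spikeMap d θ) := by
  unfold spikeMap; fun_prop

/-- The value `d = √(1 + c) - 1` solves `(1 + d)² = 1 + c`, which makes `spikeMap d θ` a square root
of `I + c θθ'`. -/
theorem norm_sq_spikeMap {c : ℝ} (hc : 0 ≤ c) {θ : E} (hθ : ‖θ‖ = 1) (t : E) :
    ‖spikeMap (√(1 + c) - 1) θ t‖ ^ 2 = ‖t‖ ^ 2 + c * inner ℝ θ t ^ 2 := by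
  have h := Real.sq_sqrt (by linarith : 0 ≤ 1 + c)
  rw [spikeMap, norm_add_sq_real, norm_smul, hθ, inner_smul_right, real_inner_comm θ t, mul_one,
    Real.norm_eq_abs, sq_abs]
  linear_combination (inner ℝ θ t) ^ 2 * h

variable [FiniteDimensional ℝ E] [MeasurableSpace E] [BorelSpace E]

theorem map_inner_stdGaussian (t : E) :
    (stdGaussian E).map (fun z => inner ℝ t z) = gaussianReal 0 (‖t‖₊ ^ 2) := by
  have h := IsGaussian.map_eq_gaussianReal (μ := stdGaussian E) (innerSL ℝ t)
  rw [integral_strongDual_stdGaussian, variance_dual_stdGaussian] at h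
  have h2 : (‖innerSL ℝ t‖ ^ 2).toNNReal = ‖t‖₊ ^ 2 := by
    ext; simp
  rw [h2] at h
  exact h

end Spike

/-! ### The one-dimensional likelihood ratio -/

theorem withDensity_comp_map {α β : Type*} [MeasurableSpace α] [MeasurableSpace β] (μ : Measure α)
    {g : α → β} (hg : Measurable g) {f : β → ℝ≥0∞} (hf : Measurable f) :
    (μ.withDensity fun x => f (g x)).map g = (μ.map g).withDensity f := by
  ext s hs
  rw [Measure.map_apply hg hs, withDensity_apply _ (hg hs), withDensity_apply _ hs,
    setLIntegral_map hs hf hg]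

/-- The density of `N(0, 1 + c)` with respect to `N(0, 1)`. -/
noncomputable def spikeDensity (c x : ℝ) : ℝ := (√(1 + c))⁻¹ * Real.exp (c * x ^ 2 / (2 * (1 + c)))

theorem spikeDensity_pos {c : ℝ} (hc : 0 ≤ c) (x : ℝ) : 0 < spikeDensity c x := by
  unfold spikeDensity
  have : 0 < √(1 + c) := Real.sqrt_pos.2 (by linarith)
  positivity

theorem measurable_spikeDensity (c : ℝ) : Measurable (spikeDensity c) := by
  unfold spikeDensity; fun_prop

theorem gaussianPDFReal_mul_spikeDensity {c : ℝ} (hc : 0 ≤ c) (x : ℝ) :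
    gaussianPDFReal 0 1 x * spikeDensity c x = gaussianPDFReal 0 (1 + c).toNNReal x := by
  have h1 : (0 : ℝ) < 1 + c := by linarith
  simp only [gaussianPDFReal, spikeDensity, Real.coe_toNNReal _ h1.le, NNReal.coe_one, mul_one,
    sub_zero]
  rw [Real.sqrt_mul (by positivity) (1 + c), mul_inv]
  have : Real.exp (-x ^ 2 / (2 * (1 + c))) =
      Real.exp (-x ^ 2 / 2) * Real.exp (c * x ^ 2 / (2 * (1 + c))) := by
    rw [← Real.exp_add]
    congr 1
    field_simp
    ring
  rw [this]
  ring

theorem gaussianReal_withDensity_spikeDensity {c : ℝ} (hc : 0 ≤ c) :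
    (gaussianReal 0 1).withDensity (fun x => ENNReal.ofReal (spikeDensity c x)) =
      gaussianReal 0 (1 + c).toNNReal := by
  have h1 : (1 + c).toNNReal ≠ 0 := by
    rw [ne_eq, Real.toNNReal_eq_zero]; linarith
  rw [gaussianReal_of_var_ne_zero _ one_ne_zero, gaussianReal_of_var_ne_zero _ h1,
    ← withDensity_mul _ (measurable_gaussianPDF 0 1) (measurable_spikeDensity c).ennreal_ofReal]
  congr 1
  ext x
  rw [Pi.mul_apply, gaussianPDF, gaussianPDF, ← ENNReal.ofReal_mul (gaussianPDFReal_nonneg _ _ _),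
    gaussianPDFReal_mul_spikeDensity hc]

/-- This is one plus the `χ²` divergence of `N(0, 1 + c)` from `N(0, 1)`. It is again a Gaussian
integral, with rate `b = (1 - c) / (2 (1 + c))`; `c < 1` makes `b` positive. -/
theorem integral_spikeDensity_sq {c : ℝ} (hc : 0 ≤ c) (hc1 : c < 1) :
    ∫ x, spikeDensity c x ^ 2 ∂(gaussianReal 0 1) = (√(1 - c ^ 2))⁻¹ ∧
      Integrable (fun x => spikeDensity c x ^ 2) (gaussianReal 0 1) := by
  have h1 : (0 : ℝ) < 1 + c := by linarith
  have h2 : (0 : ℝ) < 1 - c := by linarith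
  set b := (1 - c) / (2 * (1 + c)) with hb
  have hb0 : 0 < b := by positivity
  have key : ∀ x, gaussianPDFReal 0 1 x • spikeDensity c x ^ 2 =
      ((√(2 * Real.pi))⁻¹ * (1 + c)⁻¹) * Real.exp (-b * x ^ 2) := by
    intro x
    simp only [gaussianPDFReal, spikeDensity, NNReal.coe_one, mul_one, sub_zero, smul_eq_mul]
    rw [mul_pow, inv_pow, Real.sq_sqrt h1.le, ← Real.exp_nat_mul]
    have : Real.exp (-b * x ^ 2) = Real.exp (-x ^ 2 / 2) *
        Real.exp ((2 : ℕ) * (c * x ^ 2 / (2 * (1 + c)))) := by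
      rw [← Real.exp_add]
      congr 1
      rw [hb]
      push_cast
      field_simp
      ring
    rw [this]
    ring
  constructor
  · rw [integral_gaussianReal_eq_integral_smul one_ne_zero]
    simp only [key]
    rw [integral_const_mul, integral_gaussian, hb]
    have e1 : Real.pi / ((1 - c) / (2 * (1 + c))) = (2 * Real.pi) * ((1 + c) ^ 2 / (1 - c ^ 2)) := by
      have : (1 - c ^ 2) = (1 - c) * (1 + c) := by ring
      rw [this]
      field_simp
    rw [e1, Real.sqrt_mul (by positivity) ((1 + c) ^ 2 / (1 - c ^ 2)),
      Real.sqrt_div (by positivity) (1 - c ^ 2), Real.sqrt_sq h1.le]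
    have : √(2 * Real.pi) ≠ 0 := by positivity
    field_simp
  · rw [gaussianReal_of_var_ne_zero _ one_ne_zero, gaussianPDF_def]
    rw [integrable_withDensity_iff_integrable_smul' (by fun_prop) (by simp)]
    have : (fun x => (ENNReal.ofReal (gaussianPDFReal 0 1 x)).toReal • spikeDensity c x ^ 2) =
        fun x => ((√(2 * Real.pi))⁻¹ * (1 + c)⁻¹) * Real.exp (-b * x ^ 2) := by
      ext x
      rw [ENNReal.toReal_ofReal (gaussianPDFReal_nonneg _ _ _), key]
    rw [this]
    exact (integrable_exp_neg_mul_sq hb0).const_mul _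

theorem integral_spikeDensity {c : ℝ} (hc : 0 ≤ c) :
    ∫ x, spikeDensity c x ∂(gaussianReal 0 1) = 1 ∧
      Integrable (spikeDensity c) (gaussianReal 0 1) := by
  have h1 : (1 + c).toNNReal ≠ 0 := by
    rw [ne_eq, Real.toNNReal_eq_zero]; linarith
  have hl : ∫⁻ x, ENNReal.ofReal (spikeDensity c x) ∂(gaussianReal 0 1) = 1 := by
    have := congrArg (fun m => m Set.univ) (gaussianReal_withDensity_spikeDensity hc)
    simpa using this
  have h2 : 0 ≤ᵐ[gaussianReal 0 1] spikeDensity c := ae_of_all _ fun x => (spikeDensity_pos hc x).le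
  constructor
  · rw [integral_eq_lintegral_of_nonneg_ae h2 (measurable_spikeDensity c).aestronglyMeasurable, hl]
    rfl
  · exact (lintegral_ofReal_ne_top_iff_integrable
      (measurable_spikeDensity c).aestronglyMeasurable h2).1 (by rw [hl]; simp)

/-! ### The spiked Gaussian law as an image and as a density -/

section Law

variable {p : ℕ} {c : ℝ} {θ : EuclideanSpace ℝ (Fin p)}

theorem dotProduct_spiked_mulVec (c : ℝ) (θ t : EuclideanSpace ℝ (Fin p)) :
    t.ofLp ⬝ᵥ ((1 : Matrix (Fin p) (Fin p) ℝ) + c • Matrix.vecMulVec θ θ).mulVec t.ofLp =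
      ‖t‖ ^ 2 + c * inner ℝ θ t ^ 2 := by
  have h1 : ‖t‖ ^ 2 = t.ofLp ⬝ᵥ t.ofLp := by
    rw [EuclideanSpace.real_norm_sq_eq]; simp [dotProduct, sq]
  have h2 : inner ℝ θ t = θ.ofLp ⬝ᵥ t.ofLp := by
    rw [PiLp.inner_apply]; simp [dotProduct, mul_comm]
  rw [h1, h2, Matrix.add_mulVec, Matrix.one_mulVec, Matrix.smul_mulVec, Matrix.vecMulVec_mulVec,
    dotProduct_add, dotProduct_smul, dotProduct_smul, dotProduct_comm t.ofLp θ.ofLp]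
  simp [sq]

theorem posSemidef_spiked (hc : 0 ≤ c) (θ : EuclideanSpace ℝ (Fin p)) :
    ((1 : Matrix (Fin p) (Fin p) ℝ) + c • Matrix.vecMulVec θ θ).PosSemidef :=
  Matrix.PosSemidef.one.add (Matrix.PosSemidef.smul (Matrix.posSemidef_vecMulVec_self_star θ.ofLp) hc)

theorem multivariateGaussian_spiked_eq_map (hc : 0 ≤ c) (hθ : ‖θ‖ = 1) :
    multivariateGaussian 0 ((1 : Matrix (Fin p) (Fin p) ℝ) + c • Matrix.vecMulVec θ θ) =
      (stdGaussian (EuclideanSpace ℝ (Fin p))).map (spikeMap (√(1 + c) - 1) θ) := by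
  have hm := (continuous_spikeMap (√(1 + c) - 1) θ).measurable
  have := Measure.isProbabilityMeasure_map
    (μ := stdGaussian (EuclideanSpace ℝ (Fin p))) hm.aemeasurable
  refine Measure.ext_of_charFun ?_
  ext t
  rw [charFun_multivariateGaussian (posSemidef_spiked hc θ), dotProduct_spiked_mulVec,
    charFun_apply, integral_map hm.aemeasurable (by fun_prop)]
  simp only [inner_spikeMap_left]
  rw [← charFun_apply, charFun_stdGaussian, ← Complex.ofReal_pow, norm_sq_spikeMap hc hθ]
  congr 1
  simp
  ring

/-- In an orthonormal basis starting with `θ` the spike map rescales the first coordinate only, so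
the density is that of a single coordinate. -/
theorem multivariateGaussian_spiked_eq_withDensity (hc : 0 ≤ c) (hθ : ‖θ‖ = 1) :
    multivariateGaussian 0 ((1 : Matrix (Fin p) (Fin p) ℝ) + c • Matrix.vecMulVec θ θ) =
      (stdGaussian (EuclideanSpace ℝ (Fin p))).withDensity
        fun z => ENNReal.ofReal (spikeDensity c (inner ℝ θ z)) := by
  have hp : p ≠ 0 := by
    rintro rfl
    rw [Subsingleton.elim θ 0] at hθ
    simp at hθ
  have : NeZero p := ⟨hp⟩
  obtain ⟨b, hb⟩ := Orthonormal.exists_orthonormalBasis_extension_of_card_eq (𝕜 := ℝ)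
    (E := EuclideanSpace ℝ (Fin p)) (ι := Fin p) (by simp) (v := fun _ => θ) (s := {0}) (by
      refine ⟨fun _ => hθ, fun i j hij => ?_⟩
      exact absurd (Subtype.ext ((Set.mem_singleton_iff.1 i.2).trans
        (Set.mem_singleton_iff.1 j.2).symm)) hij)
  have hb0 : b 0 = θ := hb 0 rfl
  let B : (Fin p → ℝ) → EuclideanSpace ℝ (Fin p) := fun x => ∑ i, x i • b i
  have hB : Measurable B := by fun_prop
  have hBθ : ∀ x, inner ℝ θ (B x) = x 0 := fun x => by
    simp only [B, ← hb0, inner_sum, inner_smul_right, orthonormal_iff_ite.1 b.orthonormal]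
    simp
  let s : Fin p → ℝ := fun j => if j = 0 then √(1 + c) else 1
  have hs : ∀ x, spikeMap (√(1 + c) - 1) θ (B x) = B fun j => s j * x j := fun x => by
    simp only [spikeMap, hBθ, B]
    rw [← Finset.add_sum_erase _ (fun i => x i • b i) (Finset.mem_univ (0 : Fin p)),
      ← Finset.add_sum_erase _ (fun i => (s i * x i) • b i) (Finset.mem_univ (0 : Fin p))]
    have : ∑ i ∈ Finset.univ.erase 0, (s i * x i) • b i = ∑ i ∈ Finset.univ.erase 0, x i • b i :=
      Finset.sum_congr rfl fun i hi => by simp [s, Finset.ne_of_mem_erase hi]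
    rw [this, hb0]
    simp only [s, if_true]
    module
  rw [multivariateGaussian_spiked_eq_map hc hθ, stdGaussian_eq_map_pi_orthonormalBasis b]
  have hmap : (Measure.pi fun _ : Fin p => gaussianReal 0 1).map (fun x j => s j * x j) =
      (Measure.pi fun _ : Fin p => gaussianReal 0 1).withDensity
        fun x => ENNReal.ofReal (spikeDensity c (x 0)) := by
    let f : Fin p → ℝ → ℝ≥0∞ := fun j x => if j = 0 then ENNReal.ofReal (spikeDensity c x) else 1
    have hf : ∀ j, Measurable (f j) := fun j => by
      by_cases hj : j = 0
      · simp only [f, hj, if_true]; exact (measurable_spikeDensity c).ennreal_ofReal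
      · simp only [f, hj, if_false]; exact measurable_const
    have h1 : ∀ j, (gaussianReal 0 1).map (fun x => s j * x) =
        (gaussianReal 0 1).withDensity (f j) := fun j => by
      rw [gaussianReal_map_const_mul]
      by_cases hj : j = 0
      · simp only [s, f, hj, if_true, gaussianReal_withDensity_spikeDensity hc, mul_zero, mul_one]
        congr 1
        ext
        rw [Real.coe_toNNReal _ (by linarith)]
        exact Real.sq_sqrt (by linarith)
      · have h2 : f j = 1 := by ext x; simp [f, hj]
        rw [h2, withDensity_one]
        simp only [s, hj, if_false, mul_zero]
        congr 1
        ext; simp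
    have h3 : ∀ j, IsProbabilityMeasure ((gaussianReal 0 1).withDensity (f j)) := fun j => by
      rw [← h1 j]
      exact Measure.isProbabilityMeasure_map (by fun_prop)
    rw [Measure.pi_map_pi (μ := fun _ : Fin p => gaussianReal 0 1) (f := fun j x => s j * x)
      (fun j => by fun_prop)]
    simp only [h1]
    rw [pi_withDensity _ hf]
    congr 1
    ext x
    rw [Finset.prod_eq_single 0]
    · simp [f]
    · intro j _ hj; simp [f, hj]
    · simp
  have hmeas : Measurable fun z : EuclideanSpace ℝ (Fin p) =>
      ENNReal.ofReal (spikeDensity c (inner ℝ θ z)) :=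
    ((measurable_spikeDensity c).comp (by fun_prop)).ennreal_ofReal
  rw [← withDensity_comp_map _ hB hmeas]
  simp only [hBθ]
  rw [← hmap, Measure.map_map hB (by fun_prop),
    Measure.map_map (continuous_spikeMap _ θ).measurable hB]
  congr 1
  ext1 x
  exact hs x

end Law

namespace WeakPCA

variable {p n : ℕ} {r v : ℝ} {θ : EuclideanSpace ℝ (Fin p)}

theorem spikedLaw_eq_map (hrv : 0 ≤ r * v) (hθ : ‖θ‖ = 1) :
    spikedLaw n r v θ = (Measure.pi fun _ : Fin n => stdGaussian (EuclideanSpace ℝ (Fin p))).map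
      fun x i => spikeMap (√(1 + r * v) - 1) θ (x i) := by
  have hm := (continuous_spikeMap (√(1 + r * v) - 1) θ).measurable
  have := Measure.isProbabilityMeasure_map
    (μ := stdGaussian (EuclideanSpace ℝ (Fin p))) hm.aemeasurable
  rw [Measure.pi_map_pi (fun _ => hm.aemeasurable), spikedLaw]
  simp only [multivariateGaussian_spiked_eq_map hrv hθ]

theorem spikedLaw_eq_withDensity (hrv : 0 ≤ r * v) (hθ : ‖θ‖ = 1) :
    spikedLaw n r v θ =
      (Measure.pi fun _ : Fin n => stdGaussian (EuclideanSpace ℝ (Fin p))).withDensity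
        fun x => ENNReal.ofReal (∏ i, spikeDensity (r * v) (inner ℝ θ (x i))) := by
  have hmeas : Measurable fun z : EuclideanSpace ℝ (Fin p) =>
      ENNReal.ofReal (spikeDensity (r * v) (inner ℝ θ z)) :=
    ((measurable_spikeDensity (r * v)).comp (by fun_prop)).ennreal_ofReal
  have h : IsProbabilityMeasure ((stdGaussian (EuclideanSpace ℝ (Fin p))).withDensity
      fun z => ENNReal.ofReal (spikeDensity (r * v) (inner ℝ θ z))) := by
    rw [← multivariateGaussian_spiked_eq_withDensity hrv hθ]; infer_instance
  rw [spikedLaw]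
  simp only [multivariateGaussian_spiked_eq_withDensity hrv hθ]
  rw [pi_withDensity _ fun _ => hmeas]
  congr 1
  ext x
  rw [ENNReal.ofReal_prod_of_nonneg fun i _ => (spikeDensity_pos hrv _).le]

theorem spikedLaw_absolutelyContinuous (hrv : 0 ≤ r * v) (hθ : ‖θ‖ = 1) :
    spikedLaw n r v θ ≪ Measure.pi fun _ : Fin n => stdGaussian (EuclideanSpace ℝ (Fin p)) := by
  rw [spikedLaw_eq_withDensity hrv hθ]
  exact withDensity_absolutelyContinuous _ _

theorem measurable_prod_spikeDensity (c : ℝ) (θ : EuclideanSpace ℝ (Fin p)) :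
    Measurable fun x : Fin n → EuclideanSpace ℝ (Fin p) => ∏ i, spikeDensity c (inner ℝ θ (x i)) :=
  Finset.measurable_fun_prod _ fun i _ => (measurable_spikeDensity c).comp (by fun_prop)

theorem absolutelyContinuous_spikedLaw (hrv : 0 ≤ r * v) (hθ : ‖θ‖ = 1) :
    (Measure.pi fun _ : Fin n => stdGaussian (EuclideanSpace ℝ (Fin p))) ≪ spikedLaw n r v θ := by
  rw [spikedLaw_eq_withDensity hrv hθ]
  refine withDensity_absolutelyContinuous' (measurable_prod_spikeDensity _ _).ennreal_ofReal.aemeasurable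
    (ae_of_all _ fun x => ?_)
  have : 0 < ∏ i, spikeDensity (r * v) (inner ℝ θ (x i)) :=
    Finset.prod_pos fun i _ => spikeDensity_pos hrv _
  simpa using this

/-- The `χ²` bound on the difference of the powers of a test under the spiked and null laws. -/
theorem abs_integral_spikedLaw_sub_le (hrv : 0 ≤ r * v) (hrv1 : r * v < 1) (hθ : ‖θ‖ = 1)
    {ψ : (Fin n → EuclideanSpace ℝ (Fin p)) → ℝ} (hψ : ∀ x, ψ x ∈ Set.Icc (0 : ℝ) 1)
    (hψm : AEMeasurable ψ (Measure.pi fun _ : Fin n => stdGaussian (EuclideanSpace ℝ (Fin p)))) :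
    |∫ x, ψ x ∂(spikedLaw n r v θ) -
      ∫ x, ψ x ∂(Measure.pi fun _ : Fin n => stdGaussian (EuclideanSpace ℝ (Fin p)))| ≤
      √((√(1 - (r * v) ^ 2))⁻¹ ^ n - 1) := by
  set c := r * v
  set μ := Measure.pi fun _ : Fin n => stdGaussian (EuclideanSpace ℝ (Fin p))
  set Λ : (Fin n → EuclideanSpace ℝ (Fin p)) → ℝ := fun x => ∏ i, spikeDensity c (inner ℝ θ (x i))
    with hΛ
  have hmap : (stdGaussian (EuclideanSpace ℝ (Fin p))).map (fun z => inner ℝ θ z) =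
      gaussianReal 0 1 := by
    rw [map_inner_stdGaussian]
    congr 1
    ext; simp [hθ]
  have hpos : ∀ x, 0 < Λ x := fun x => Finset.prod_pos fun i _ => spikeDensity_pos hrv _
  have hΛm : Measurable Λ := measurable_prod_spikeDensity c θ
  obtain ⟨e1, i1⟩ := integral_spikeDensity hrv
  obtain ⟨e2, i2⟩ := integral_spikeDensity_sq hrv hrv1
  have hin : AEMeasurable (fun z => inner ℝ θ z) (stdGaussian (EuclideanSpace ℝ (Fin p))) := by
    fun_prop
  have hsm := (measurable_spikeDensity c)
  rw [← hmap] at e1 i1 e2 i2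
  rw [integral_map hin hsm.aestronglyMeasurable] at e1
  rw [integral_map hin (by fun_prop)] at e2
  have i1' := i1.comp_aemeasurable hin
  have i2' := i2.comp_aemeasurable hin
  have E1 : ∫ x, Λ x ∂μ = 1 := by
    rw [hΛ, integral_fintype_prod_eq_pow fun z => spikeDensity c (inner ℝ θ z), e1, one_pow]
  have E2 : ∫ x, Λ x ^ 2 ∂μ = (√(1 - c ^ 2))⁻¹ ^ n := by
    simp only [hΛ, ← Finset.prod_pow]
    rw [integral_fintype_prod_eq_pow fun z => spikeDensity c (inner ℝ θ z) ^ 2, e2,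
      Fintype.card_fin]
  have I1 : Integrable Λ μ := Integrable.fintype_prod (f := fun _ z => spikeDensity c (inner ℝ θ z))
    fun _ => i1'
  have I2 : Integrable (fun x => Λ x ^ 2) μ := by
    simp only [hΛ, ← Finset.prod_pow]
    exact Integrable.fintype_prod (f := fun _ z => spikeDensity c (inner ℝ θ z) ^ 2) fun _ => i2'
  have hI : ∫ x, ψ x ∂(spikedLaw n r v θ) = ∫ x, Λ x * ψ x ∂μ := by
    rw [spikedLaw_eq_withDensity hrv hθ, integral_withDensity_eq_integral_toReal_smul
      hΛm.ennreal_ofReal (ae_of_all _ fun _ => ENNReal.ofReal_lt_top)]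
    refine integral_congr_ae (ae_of_all _ fun x => ?_)
    simp only [smul_eq_mul]
    rw [ENNReal.toReal_ofReal (hpos x).le]
  have Iψ : Integrable ψ μ := by
    refine Integrable.of_bound hψm.aestronglyMeasurable 1 (ae_of_all _ fun x => ?_)
    rw [Real.norm_eq_abs, abs_le]
    exact ⟨by linarith [(hψ x).1], (hψ x).2⟩
  have IΛψ : Integrable (fun x => Λ x * ψ x) μ := by
    refine I1.mono (hΛm.aestronglyMeasurable.mul hψm.aestronglyMeasurable) (ae_of_all _ fun x => ?_)
    rw [norm_mul]
    refine mul_le_of_le_one_right (norm_nonneg _) ?_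
    rw [Real.norm_eq_abs, abs_le]
    exact ⟨by linarith [(hψ x).1], (hψ x).2⟩
  -- Cauchy-Schwarz, in the form of nonnegativity of the variance of `|Λ - 1|`.
  have hvar : (∫ x, |Λ x - 1| ∂μ) ^ 2 ≤ ∫ x, (Λ x - 1) ^ 2 ∂μ := by
    have hL2 : MemLp (fun x => |Λ x - 1|) 2 μ := by
      rw [memLp_two_iff_integrable_sq (by fun_prop)]
      simp only [sq_abs, sub_sq]
      exact (I2.sub (by simpa using I1.const_mul 2)).add (by simp)
    have h0 := variance_nonneg (fun x => |Λ x - 1|) μ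
    rw [variance_eq_sub hL2] at h0
    simp only [Pi.pow_apply, sq_abs] at h0
    linarith
  have hsq : ∫ x, (Λ x - 1) ^ 2 ∂μ = (√(1 - c ^ 2))⁻¹ ^ n - 1 := by
    have : ∀ x, (Λ x - 1) ^ 2 = Λ x ^ 2 - 2 * Λ x + 1 := fun x => by ring
    simp only [this]
    have I3 : Integrable (fun x => Λ x ^ 2 - 2 * Λ x) μ := I2.sub (I1.const_mul 2)
    rw [integral_add I3 (integrable_const 1), integral_sub I2 (I1.const_mul 2),
      integral_const_mul, E1, E2]
    simp
    ring
  rw [hI, ← integral_sub IΛψ Iψ]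
  refine Real.le_sqrt_of_sq_le ?_
  rw [← hsq]
  refine le_trans ?_ hvar
  refine pow_le_pow_left₀ (abs_nonneg _) ?_ 2
  refine (abs_integral_le_integral_abs).trans ?_
  refine integral_mono (IΛψ.sub Iψ).abs (I1.sub (integrable_const _)).abs fun x => ?_
  have : Λ x * ψ x - ψ x = (Λ x - 1) * ψ x := by ring
  simp only [this, abs_mul]
  refine mul_le_of_le_one_right (abs_nonneg _) ?_
  rw [abs_le]
  exact ⟨by linarith [(hψ x).1], (hψ x).2⟩

end WeakPCA

/-! ### Limit theorems for standard Gaussian samples -/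

section StdGaussian

variable {E : Type*} [NormedAddCommGroup E] [InnerProductSpace ℝ E] [FiniteDimensional ℝ E]
  [MeasurableSpace E] [BorelSpace E]

theorem memLp_inner_stdGaussian (a : E) : MemLp (fun z => inner ℝ a z) 2 (stdGaussian E) :=
  (innerSL ℝ a).comp_memLp' (IsGaussian.memLp_two_id (μ := stdGaussian E))

theorem integral_inner_stdGaussian (a : E) : ∫ z, inner ℝ a z ∂(stdGaussian E) = 0 :=
  integral_strongDual_stdGaussian (innerSL ℝ a)

theorem covariance_inner_stdGaussian (a b : E) :
    cov[fun z => inner ℝ a z, fun z => inner ℝ b z; stdGaussian E] = inner ℝ a b := by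
  rw [← covarianceBilin_apply_eq_cov IsGaussian.memLp_two_id, covarianceBilin_stdGaussian]
  rfl

theorem integral_inner_mul_inner_stdGaussian (a b : E) :
    ∫ z, inner ℝ a z * inner ℝ b z ∂(stdGaussian E) = inner ℝ a b := by
  rw [← covariance_inner_stdGaussian, covariance_eq_sub (memLp_inner_stdGaussian a)
    (memLp_inner_stdGaussian b), integral_inner_stdGaussian, zero_mul, sub_zero]
  rfl

theorem indepFun_inner_stdGaussian {a b : E} (hab : inner ℝ a b = 0) :
    IndepFun (fun z => inner ℝ a z) (fun z => inner ℝ b z) (stdGaussian E) := by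
  refine HasGaussianLaw.indepFun_of_covariance_eq_zero ?_ ?_
  · exact (IsGaussian.hasGaussianLaw_id (μ := stdGaussian E)).map
      ((innerSL ℝ a).prod (innerSL ℝ b))
  · rw [covariance_inner_stdGaussian, hab]

theorem memLp_inner_mul_inner_stdGaussian {a b : E} (hab : inner ℝ a b = 0) :
    MemLp (fun z => inner ℝ a z * inner ℝ b z) 2 (stdGaussian E) ∧
      ∫ z, (inner ℝ a z * inner ℝ b z) ^ 2 ∂(stdGaussian E) = ‖a‖ ^ 2 * ‖b‖ ^ 2 := by
  have hind := (indepFun_inner_stdGaussian hab).comp (φ := fun x : ℝ => x ^ 2)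
    (ψ := fun x : ℝ => x ^ 2) (by fun_prop) (by fun_prop)
  have hsq : ∀ a : E, ∫ z, inner ℝ a z ^ 2 ∂(stdGaussian E) = ‖a‖ ^ 2 := fun a => by
    simp only [sq, integral_inner_mul_inner_stdGaussian, real_inner_self_eq_norm_mul_norm]
  have h1 := hind.integrable_mul (memLp_inner_stdGaussian a).integrable_sq
    (memLp_inner_stdGaussian b).integrable_sq
  have h2 := hind.integral_mul_eq_mul_integral
    (memLp_inner_stdGaussian a).integrable_sq.aestronglyMeasurable
    (memLp_inner_stdGaussian b).integrable_sq.aestronglyMeasurable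
  constructor
  · rw [memLp_two_iff_integrable_sq (by fun_prop)]
    simp only [mul_pow]
    exact h1
  · simp only [mul_pow]
    refine h2.trans ?_
    simp only [Function.comp_def, hsq]

variable (E) in
/-- The law of an infinite sample from the standard Gaussian law. -/
noncomputable def stdGaussianSeq : Measure (ℕ → E) := Measure.infinitePi fun _ : ℕ => stdGaussian E

instance : IsProbabilityMeasure (stdGaussianSeq E) := by
  unfold stdGaussianSeq; infer_instance

theorem measurePreserving_eval_stdGaussianSeq (i : ℕ) :
    MeasurePreserving (fun ω : ℕ → E => ω i) (stdGaussianSeq E) (stdGaussian E) :=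
  measurePreserving_eval_infinitePi _ i

theorem measurePreserving_sample_stdGaussianSeq (n : ℕ) :
    MeasurePreserving (fun (ω : ℕ → E) (i : Fin n) => ω i) (stdGaussianSeq E)
      (Measure.pi fun _ : Fin n => stdGaussian E) := by
  refine ⟨by fun_prop, ?_⟩
  rw [← Measure.infinitePi_eq_pi]
  exact Measure.map_infinitePi_infinitePi_of_inj (P := fun _ : ℕ => stdGaussian E)
    (f := fun i : Fin n => (i : ℕ)) Fin.val_injective

theorem iIndepFun_stdGaussianSeq {F : Type*} [MeasurableSpace F] {f : E → F} (hf : Measurable f) :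
    iIndepFun (fun (i : ℕ) (ω : ℕ → E) => f (ω i)) (stdGaussianSeq E) :=
  iIndepFun_infinitePi (P := fun _ : ℕ => stdGaussian E) (X := fun _ => f) fun _ => hf

theorem identDistrib_stdGaussianSeq {F : Type*} [MeasurableSpace F] {f : E → F} (hf : Measurable f)
    (i : ℕ) : IdentDistrib (fun ω : ℕ → E => f (ω i)) (fun ω : ℕ → E => f (ω 0))
      (stdGaussianSeq E) (stdGaussianSeq E) := by
  refine ⟨(hf.comp (measurable_pi_apply i)).aemeasurable,
    (hf.comp (measurable_pi_apply 0)).aemeasurable, ?_⟩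
  have h : ∀ i : ℕ, (stdGaussianSeq E).map (fun ω : ℕ → E => f (ω i)) = (stdGaussian E).map f :=
    fun i => by
      rw [← (measurePreserving_eval_stdGaussianSeq i).map_eq, Measure.map_map hf (by fun_prop)]
      rfl
  rw [h, h]

theorem integral_eval_stdGaussianSeq {F : Type*} [NormedAddCommGroup F] [NormedSpace ℝ F]
    {f : E → F} (hf : AEStronglyMeasurable f (stdGaussian E)) (i : ℕ) :
    ∫ ω, f (ω i) ∂(stdGaussianSeq E) = ∫ z, f z ∂(stdGaussian E) := by
  rw [← (measurePreserving_eval_stdGaussianSeq i).map_eq,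
    integral_map (measurable_pi_apply i).aemeasurable]
  rwa [(measurePreserving_eval_stdGaussianSeq i).map_eq]

theorem strongLaw_stdGaussianSeq {F : Type*} [NormedAddCommGroup F] [NormedSpace ℝ F]
    [CompleteSpace F] [MeasurableSpace F] [BorelSpace F]
    {f : E → F} (hf : Measurable f) (hint : Integrable f (stdGaussian E)) :
    ∀ᵐ ω ∂(stdGaussianSeq E), Tendsto (fun n : ℕ => (n : ℝ)⁻¹ • ∑ i ∈ Finset.range n, f (ω i)) atTop
      (𝓝 (∫ z, f z ∂(stdGaussian E))) := by
  rw [← integral_eval_stdGaussianSeq hint.aestronglyMeasurable 0]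
  exact strong_law_ae (μ := stdGaussianSeq E) (fun (i : ℕ) (ω : ℕ → E) => f (ω i))
    ((measurePreserving_eval_stdGaussianSeq 0).integrable_comp_of_integrable hint)
    (fun i j hij => (iIndepFun_stdGaussianSeq hf).indepFun hij)
    (identDistrib_stdGaussianSeq hf)

/-- For orthogonal `a` and `b` the two projections are independent, so their product is centred with
variance `‖a‖² ‖b‖²`. -/
theorem clt_stdGaussianSeq {a b : E} (ha : ‖a‖ = 1) (hab : inner ℝ a b = 0) :
    TendstoInDistribution (fun (n : ℕ) (ω : ℕ → E) =>
      (√(n : ℝ))⁻¹ * ∑ i ∈ Finset.range n, inner ℝ a (ω i) * inner ℝ b (ω i)) atTop (id : ℝ → ℝ)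
      (fun _ => stdGaussianSeq E) (gaussianReal 0 (‖b‖₊ ^ 2)) := by
  obtain ⟨h1, h2⟩ := memLp_inner_mul_inner_stdGaussian hab
  have hf : Measurable fun z : E => inner ℝ a z * inner ℝ b z := by fun_prop
  have hm : MemLp (fun ω : ℕ → E => inner ℝ a (ω 0) * inner ℝ b (ω 0)) 2 (stdGaussianSeq E) :=
    h1.comp_measurePreserving (measurePreserving_eval_stdGaussianSeq 0)
  have h0 : (stdGaussianSeq E)[fun ω : ℕ → E => inner ℝ a (ω 0) * inner ℝ b (ω 0)] = 0 := by
    rw [integral_eval_stdGaussianSeq (f := fun z : E => inner ℝ a z * inner ℝ b z)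
      hf.aestronglyMeasurable 0, integral_inner_mul_inner_stdGaussian, hab]
  have hv : Var[fun ω : ℕ → E => inner ℝ a (ω 0) * inner ℝ b (ω 0); stdGaussianSeq E] =
      ‖b‖ ^ 2 := by
    rw [variance_eq_sub hm, h0]
    simp only [Pi.pow_apply]
    rw [integral_eval_stdGaussianSeq (f := fun z : E => (inner ℝ a z * inner ℝ b z) ^ 2)
      (by fun_prop) 0, h2, ha]
    ring
  have := tendstoInDistribution_inv_sqrt_mul_sum_sub (P := stdGaussianSeq E)
    (X := fun (i : ℕ) (ω : ℕ → E) => inner ℝ a (ω i) * inner ℝ b (ω i)) (Y := (id : ℝ → ℝ))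
    (P' := gaussianReal 0 (‖b‖₊ ^ 2)) ⟨by fun_prop, by
      rw [Measure.map_id]
      congr 1
      ext
      rw [hv, Real.coe_toNNReal _ (by positivity)]
      simp⟩ hm (iIndepFun_stdGaussianSeq hf) (identDistrib_stdGaussianSeq hf)
  simp only at h0
  simpa only [h0, mul_zero, sub_zero] using this

theorem integral_sq_inner_sum_stdGaussianSeq (a : E) (n : ℕ) :
    ∫ ω, (∑ i ∈ Finset.range n, inner ℝ a (ω i)) ^ 2 ∂(stdGaussianSeq E) = n * ‖a‖ ^ 2 ∧
      MemLp (fun ω : ℕ → E => ∑ i ∈ Finset.range n, inner ℝ a (ω i)) 2 (stdGaussianSeq E) := by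
  have hf : Measurable fun z : E => inner ℝ a z := by fun_prop
  have hm : ∀ i : ℕ, MemLp (fun ω : ℕ → E => inner ℝ a (ω i)) 2 (stdGaussianSeq E) := fun i =>
    (memLp_inner_stdGaussian a).comp_measurePreserving (measurePreserving_eval_stdGaussianSeq i)
  have hms := memLp_finsetSum (Finset.range n) fun i _ => hm i
  have hsum : (∑ i ∈ Finset.range n, fun ω : ℕ → E => inner ℝ a (ω i)) =
      fun ω : ℕ → E => ∑ i ∈ Finset.range n, inner ℝ a (ω i) := by ext; simp
  refine ⟨?_, by simpa using hms⟩
  have h0 : ∀ i : ℕ, ∫ ω, inner ℝ a (ω i) ∂(stdGaussianSeq E) = 0 := fun i => by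
    rw [integral_eval_stdGaussianSeq (f := fun z : E => inner ℝ a z) hf.aestronglyMeasurable,
      integral_inner_stdGaussian]
  have hv := IndepFun.variance_sum (μ := stdGaussianSeq E) (s := Finset.range n)
    (X := fun (i : ℕ) (ω : ℕ → E) => inner ℝ a (ω i)) (fun i _ => hm i)
    (fun i _ j _ hij => (iIndepFun_stdGaussianSeq hf).indepFun hij)
  have hvi : ∀ i : ℕ, Var[fun ω : ℕ → E => inner ℝ a (ω i); stdGaussianSeq E] = ‖a‖ ^ 2 := fun i => by
    rw [variance_eq_sub (hm i), h0]
    simp only [Pi.pow_apply]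
    rw [integral_eval_stdGaussianSeq (f := fun z : E => (inner ℝ a z) ^ 2) (by fun_prop)]
    simp only [sq, integral_inner_mul_inner_stdGaussian, real_inner_self_eq_norm_mul_norm]
    ring
  simp only [hvi, Finset.sum_const, Finset.card_range, nsmul_eq_mul] at hv
  rw [hsum] at hv
  rw [← hv, variance_eq_sub (by rw [← hsum]; exact memLp_finsetSum' _ fun i _ => hm i),
    integral_finsetSum _ fun i _ => (hm i).integrable (by norm_num)]
  simp [h0]

/-- The mean of a standard Gaussian sample is of order `1 / √n`. -/
theorem tendsto_lintegral_norm_sq_mean_stdGaussianSeq :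
    Tendsto (fun n : ℕ => ∫⁻ ω, ENNReal.ofReal
      (√(n : ℝ) * ‖(n : ℝ)⁻¹ • ∑ i ∈ Finset.range n, ω i‖ ^ 2) ∂(stdGaussianSeq E)) atTop (𝓝 0) := by
  set b := stdOrthonormalBasis ℝ E
  have h1 : ∀ (n : ℕ) (ω : ℕ → E), √(n : ℝ) * ‖(n : ℝ)⁻¹ • ∑ i ∈ Finset.range n, ω i‖ ^ 2 =
      √(n : ℝ) * ((n : ℝ)⁻¹) ^ 2 * ∑ k, (∑ i ∈ Finset.range n, inner ℝ (b k) (ω i)) ^ 2 := by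
    intro n ω
    rw [norm_smul, mul_pow, ← b.sum_sq_norm_inner_right]
    simp [inner_sum, mul_assoc]
  have h2 : ∀ n : ℕ, ∫⁻ ω, ENNReal.ofReal
      (√(n : ℝ) * ‖(n : ℝ)⁻¹ • ∑ i ∈ Finset.range n, ω i‖ ^ 2) ∂(stdGaussianSeq E) =
      ENNReal.ofReal (Module.finrank ℝ E * (√(n : ℝ))⁻¹) := by
    intro n
    simp only [h1]
    have hi : ∀ k, Integrable (fun ω : ℕ → E => (∑ i ∈ Finset.range n, inner ℝ (b k) (ω i)) ^ 2)
        (stdGaussianSeq E) := fun k =>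
      (integral_sq_inner_sum_stdGaussianSeq (b k) n).2.integrable_sq
    rw [← ofReal_integral_eq_lintegral_ofReal ((integrable_finsetSum _ fun k _ => hi k).const_mul _)
      (ae_of_all _ fun ω => by positivity), integral_const_mul, integral_finsetSum _ fun k _ => hi k]
    simp only [(integral_sq_inner_sum_stdGaussianSeq (b _) n).1, b.norm_eq_one]
    congr 1
    simp only [one_pow, mul_one, Finset.sum_const, Finset.card_univ, Fintype.card_fin, nsmul_eq_mul]
    rcases Nat.eq_zero_or_pos n with rfl | hn
    · simp
    · have hn' : (0 : ℝ) < n := by exact_mod_cast hn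
      have := Real.mul_self_sqrt hn'.le
      have hs : √(n : ℝ) ≠ 0 := (Real.sqrt_pos.2 hn').ne'
      field_simp
      linear_combination (Module.finrank ℝ E : ℝ) * this
  simp only [h2]
  rw [← ENNReal.ofReal_zero]
  refine ENNReal.tendsto_ofReal ?_
  have : Tendsto (fun n : ℕ => (√(n : ℝ))⁻¹) atTop (𝓝 0) :=
    (Real.tendsto_sqrt_atTop.comp tendsto_natCast_atTop_atTop).inv_tendsto_atTop
  simpa using this.const_mul (Module.finrank ℝ E : ℝ)

/-- A multivariate central limit theorem. -/
theorem multivariateCLT_stdGaussianSeq {k : ℕ} {a : E} (ha : ‖a‖ = 1) {b : Fin k → E}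
    (hb : Orthonormal ℝ b) (hab : ∀ j, inner ℝ a (b j) = 0) :
    TendstoInDistribution (fun (n : ℕ) (ω : ℕ → E) => (WithLp.toLp 2 fun j : Fin k =>
        (√(n : ℝ))⁻¹ * ∑ i ∈ Finset.range n, inner ℝ a (ω i) * inner ℝ (b j) (ω i) :
          EuclideanSpace ℝ (Fin k))) atTop id
      (fun _ => stdGaussianSeq E) (stdGaussian (EuclideanSpace ℝ (Fin k))) := by
  have hm : ∀ n : ℕ, Measurable fun (ω : ℕ → E) => (WithLp.toLp 2 fun j : Fin k =>
        (√(n : ℝ))⁻¹ * ∑ i ∈ Finset.range n, inner ℝ a (ω i) * inner ℝ (b j) (ω i) :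
          EuclideanSpace ℝ (Fin k)) := fun n => by fun_prop
  refine ⟨fun n => (hm n).aemeasurable, aemeasurable_id, ?_⟩
  refine ProbabilityMeasure.tendsto_iff_tendsto_charFun.2 fun t => ?_
  simp only [ProbabilityMeasure.coe_mk, Measure.map_id]
  -- Cramér-Wold: pairing the vector with `t` gives the scalar sum in the direction `h`, which is
  -- orthogonal to `a` and has norm `‖t‖`. The scalar theorem is then read off at frequency 1.
  set h : E := ∑ j, t j • b j with hh
  have hah : inner ℝ a h = 0 := by simp [hh, inner_sum, inner_smul_right, hab]
  have hnorm : ‖h‖ ^ 2 = ‖t‖ ^ 2 := by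
    rw [← real_inner_self_eq_norm_sq, hh, hb.inner_sum, EuclideanSpace.real_norm_sq_eq]
    simp [sq]
  have hclt := ProbabilityMeasure.tendsto_iff_tendsto_charFun.1
    (clt_stdGaussianSeq (E := E) ha hah).tendsto 1
  simp only [ProbabilityMeasure.coe_mk, Measure.map_id] at hclt
  have hlim : charFun (gaussianReal 0 (‖h‖₊ ^ 2)) 1 = charFun (stdGaussian (EuclideanSpace ℝ (Fin k))) t := by
    rw [charFun_gaussianReal, charFun_stdGaussian]
    have : ((‖h‖₊ ^ 2 : ℝ≥0) : ℂ) = ((‖t‖ : ℝ) : ℂ) ^ 2 := by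
      rw [← Complex.ofReal_pow, ← hnorm]; simp
    congr 1
    rw [this]
    simp
    ring
  rw [hlim] at hclt
  refine hclt.congr fun n => ?_
  rw [charFun_apply, charFun_apply, integral_map (by fun_prop) (by fun_prop),
    integral_map (hm n).aemeasurable (by fun_prop)]
  refine integral_congr_ae (ae_of_all _ fun ω => ?_)
  have : inner ℝ (WithLp.toLp 2 fun j : Fin k =>
        (√(n : ℝ))⁻¹ * ∑ i ∈ Finset.range n, inner ℝ a (ω i) * inner ℝ (b j) (ω i) :
          EuclideanSpace ℝ (Fin k)) t =
      (√(n : ℝ))⁻¹ * ∑ i ∈ Finset.range n, inner ℝ a (ω i) * inner ℝ h (ω i) := by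
    simp only [PiLp.inner_apply, hh, sum_inner, inner_smul_left, conj_trivial, Finset.mul_sum]
    rw [Finset.sum_comm]
    refine Finset.sum_congr rfl fun j _ => ?_
    simp only [RCLike.inner_apply, conj_trivial]
    exact Finset.sum_congr rfl fun i _ => by ring
  simp only [this]
  simp

end StdGaussian

/-! ### Consistency of the sample covariance matrix -/

section Operators

variable {E ι : Type*} [NormedAddCommGroup E] [InnerProductSpace ℝ E] [Fintype ι]
  (b : OrthonormalBasis ι ℝ E)

theorem norm_apply_sub_self_le (T : E →ₗ[ℝ] E) (u : E) :
    ‖T u - u‖ ≤ ‖u‖ * ∑ k, ‖T (b k) - b k‖ := by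
  have h : T u - u = ∑ k, inner ℝ (b k) u • (T (b k) - b k) := by
    conv_lhs => rw [← b.sum_repr' u]
    simp [map_sum, smul_sub, Finset.sum_sub_distrib]
  rw [h, Finset.mul_sum]
  refine (norm_sum_le _ _).trans (Finset.sum_le_sum fun k _ => ?_)
  rw [norm_smul]
  gcongr
  simpa [b.norm_eq_one] using norm_inner_le_norm (𝕜 := ℝ) (b k) u

/-- Convergence on a basis is uniform on bounded sets, so the argument may vary with `n`, as the
true direction `θ n` does. -/
theorem tendsto_apply_of_basis {T : ℕ → E →ₗ[ℝ] E} (hT : ∀ k, Tendsto (fun n => T n (b k)) atTop (𝓝 (b k)))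
    {u : ℕ → E} {u₀ : E} (hu : Tendsto u atTop (𝓝 u₀)) :
    Tendsto (fun n => T n (u n)) atTop (𝓝 u₀) := by
  have h1 : Tendsto (fun n => ‖u n‖ * ∑ k, ‖T n (b k) - b k‖) atTop (𝓝 (‖u₀‖ * ∑ k, ‖b k - b k‖)) :=
    hu.norm.mul (tendsto_finsetSum _ fun k _ => ((hT k).sub_const _).norm)
  simp only [sub_self, norm_zero, Finset.sum_const_zero, mul_zero] at h1
  have h2 := squeeze_zero_norm (fun n => norm_apply_sub_self_le b (T n) (u n)) h1
  simpa using h2.add hu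

end Operators

theorem tendsto_spikeMap {E : Type*} [NormedAddCommGroup E] [InnerProductSpace ℝ E] {d : ℕ → ℝ}
    (hd : Tendsto d atTop (𝓝 0)) {θ u : ℕ → E} {θ' u' : E}
    (hθ : Tendsto θ atTop (𝓝 θ')) (hu : Tendsto u atTop (𝓝 u')) :
    Tendsto (fun n => spikeMap (d n) (θ n) (u n)) atTop (𝓝 u') := by
  unfold spikeMap
  simpa using hu.add ((hd.mul (hθ.inner hu)).smul hθ)

namespace WeakPCA

/-! ### Deterministic identities and bounds for the sample covariance -/

section Deterministic

variable {p n : ℕ}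

theorem sampleMean_spikeMap (d : ℝ) (θ : EuclideanSpace ℝ (Fin p))
    (z : Fin n → EuclideanSpace ℝ (Fin p)) :
    sampleMean (fun i => spikeMap d θ (z i)) = spikeMap d θ (sampleMean z) := by
  simp only [sampleMean, spikeMap, Finset.sum_add_distrib, smul_add, inner_smul_right, inner_sum,
    ← Finset.sum_smul, ← Finset.mul_sum, smul_smul]
  congr 2
  ring

theorem spikeMap_sub (d : ℝ) (θ x y : EuclideanSpace ℝ (Fin p)) :
    spikeMap d θ x - spikeMap d θ y = spikeMap d θ (x - y) := by
  simp only [spikeMap, inner_sub_right]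
  module

/-- A symmetric linear map `A` applied to the data turns `S` into `A S A`. -/
theorem sampleCovLin_spikeMap (d : ℝ) (θ : EuclideanSpace ℝ (Fin p))
    (z : Fin n → EuclideanSpace ℝ (Fin p)) (u : EuclideanSpace ℝ (Fin p)) :
    sampleCovLin (fun i => spikeMap d θ (z i)) u =
      spikeMap d θ (sampleCovLin z (spikeMap d θ u)) := by
  rw [sampleCovLin_apply, sampleCovLin_apply, sampleMean_spikeMap]
  simp only [spikeMap_sub, inner_spikeMap_left]
  have key : ∀ y, spikeMap d θ y = y + (d * inner ℝ θ y) • θ := fun _ => rfl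
  rw [key ((n : ℝ)⁻¹ • _), inner_smul_right, inner_sum]
  simp only [inner_smul_right]
  rw [Finset.smul_sum, Finset.smul_sum, Finset.mul_sum, Finset.mul_sum, Finset.sum_smul,
    ← Finset.sum_add_distrib]
  refine Finset.sum_congr rfl fun i _ => ?_
  rw [key (z i - sampleMean z)]
  module

theorem sampleCovLin_apply' (z : Fin n → EuclideanSpace ℝ (Fin p)) (u : EuclideanSpace ℝ (Fin p)) :
    sampleCovLin z u =
      (n : ℝ)⁻¹ • ∑ i, inner ℝ (z i) u • z i - inner ℝ (sampleMean z) u • sampleMean z := by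
  rcases Nat.eq_zero_or_pos n with rfl | hn
  · rw [sampleCovLin_apply]; simp [sampleMean]
  have hn' : (n : ℝ) ≠ 0 := by exact_mod_cast hn.ne'
  rw [sampleCovLin_apply]
  have hsum : ∑ i, z i = (n : ℝ) • sampleMean z := by
    rw [sampleMean, smul_smul, mul_inv_cancel₀ hn', one_smul]
  set m := sampleMean z
  have h1 : ∀ i, inner ℝ (z i - m) u • (z i - m) =
      inner ℝ (z i) u • z i - inner ℝ m u • z i - (inner ℝ (z i) u • m - inner ℝ m u • m) := fun i => by
    rw [inner_sub_left]; module
  simp only [h1, Finset.sum_sub_distrib, ← Finset.smul_sum, ← Finset.sum_smul, ← sum_inner, hsum,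
    inner_smul_left, Finset.sum_const, Finset.card_univ, Fintype.card_fin, conj_trivial]
  rw [← Nat.cast_smul_eq_nsmul ℝ]
  simp only [smul_sub, smul_smul]
  have : (n : ℝ)⁻¹ * (inner ℝ m u * n) = inner ℝ m u := by field_simp
  have h3 : (n : ℝ)⁻¹ * (n * inner ℝ m u) = inner ℝ m u := by field_simp
  rw [this, h3]
  module

theorem abs_sampleEigenvalue_sub_one_le (b : OrthonormalBasis (Fin p) ℝ (EuclideanSpace ℝ (Fin p)))
    (x : Fin n → EuclideanSpace ℝ (Fin p)) (j : Fin p) :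
    |sampleEigenvalue x j - 1| ≤ ∑ k, ‖sampleCovLin x (b k) - b k‖ := by
  set f := (sampleCovLin_isSymmetric x).eigenvectorBasis finrank_euclideanSpace_fin
  have h1 : sampleCovLin x (f j) = sampleEigenvalue x j • f j :=
    (sampleCovLin_isSymmetric x).apply_eigenvectorBasis finrank_euclideanSpace_fin j
  have h2 := norm_apply_sub_self_le b (sampleCovLin x) (f j)
  have h3 : sampleEigenvalue x j • f j - f j = (sampleEigenvalue x j - 1) • f j := by module
  rwa [h1, h3, norm_smul, f.norm_eq_one, mul_one, one_mul, Real.norm_eq_abs] at h2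

/-- The weights `1 / (λ̂₁ λ̂ⱼ)` are compared with 1 term by term; with unit weights the sum is given
by Parseval. The error is relative to the main term, which need not be bounded separately. -/
theorem abs_hpvStatistic_sub_le [NeZero p] {θ : EuclideanSpace ℝ (Fin p)} (hθ : ‖θ‖ = 1)
    {x : Fin n → EuclideanSpace ℝ (Fin p)} (h : HasGenericSpectrum (sampleCovLin x) θ) :
    |hpvStatistic θ x (eigenDirection θ x) -
        n * (‖sampleCovLin x θ‖ ^ 2 - inner ℝ θ (sampleCovLin x θ) ^ 2)| ≤
      (∑ j, |(sampleEigenvalue x 0)⁻¹ * (sampleEigenvalue x j)⁻¹ - 1|) *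
        (n * (‖sampleCovLin x θ‖ ^ 2 - inner ℝ θ (sampleCovLin x θ) ^ 2)) := by
  set f := (sampleCovLin_isSymmetric x).eigenvectorBasis finrank_euclideanSpace_fin
  have hf : ∀ j, sampleCovLin x (f j) = sampleEigenvalue x j • f j :=
    (sampleCovLin_isSymmetric x).apply_eigenvectorBasis finrank_euclideanSpace_fin
  rw [← hpvStatistic_eq_of_hasGenericSpectrum h (fun j => f.norm_eq_one j) hf,
    ← h.sum_sq_inner_gramSchmidt (sampleCovLin_isSymmetric x) finrank_euclideanSpace_fin
      (fun j => f.norm_eq_one j) hf hθ (sampleCovLin x θ)]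
  rw [hpvStatistic]
  simp only [orthogonalized, Finset.mul_sum]
  rw [← Finset.sum_sub_distrib]
  refine (Finset.abs_sum_le_sum_abs _ _).trans (Finset.sum_le_sum fun j _ => ?_)
  rw [Finset.sum_mul]
  refine le_trans (le_of_eq ?_) (Finset.single_le_sum (fun i _ => by positivity) (Finset.mem_univ j))
  set g := inner ℝ (InnerProductSpace.gramSchmidtNormed ℝ (Function.update (⇑f) 0 θ) j)
    (sampleCovLin x θ) ^ 2 with hg
  have h0 : 0 ≤ (n : ℝ) * g := by positivity
  have : (n : ℝ) / sampleEigenvalue x 0 * ((sampleEigenvalue x j)⁻¹ * g) - n * g =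
      ((sampleEigenvalue x 0)⁻¹ * (sampleEigenvalue x j)⁻¹ - 1) * (n * g) := by
    rw [div_eq_mul_inv]; ring
  rw [this, abs_mul, abs_of_nonneg h0]

end Deterministic

section Consistency

variable {p : ℕ}

/-- The strong law for `⟨z, b k⟩ z`, whose mean is `b k` since the covariance is the identity; the
strong law for `z` removes the centring term. -/
theorem ae_tendsto_sampleCovLin_stdGaussianSeq (b : OrthonormalBasis (Fin p) ℝ (EuclideanSpace ℝ (Fin p))) :
    ∀ᵐ ω ∂(stdGaussianSeq (EuclideanSpace ℝ (Fin p))), ∀ k,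
      Tendsto (fun n : ℕ => sampleCovLin (fun i : Fin n => ω i) (b k)) atTop (𝓝 (b k)) := by
  have h1 := strongLaw_stdGaussianSeq (E := EuclideanSpace ℝ (Fin p)) (f := fun z => z)
    measurable_id IsGaussian.integrable_id
  rw [integral_id_stdGaussian] at h1
  have hint : ∀ k, Integrable (fun z : EuclideanSpace ℝ (Fin p) => inner ℝ z (b k) • z)
      (stdGaussian (EuclideanSpace ℝ (Fin p))) := fun k => by
    have h2 : MemLp (fun z : EuclideanSpace ℝ (Fin p) => inner ℝ z (b k)) 2
        (stdGaussian (EuclideanSpace ℝ (Fin p))) := by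
      simpa only [real_inner_comm] using memLp_inner_stdGaussian (b k)
    exact memLp_one_iff_integrable.1 ((IsGaussian.memLp_two_id
      (μ := stdGaussian (EuclideanSpace ℝ (Fin p)))).smul h2)
  have hmean : ∀ k, ∫ z, inner ℝ z (b k) • z ∂(stdGaussian (EuclideanSpace ℝ (Fin p))) = b k := by
    intro k
    refine ext_inner_left ℝ fun a => ?_
    rw [← integral_inner (hint k)]
    simp only [inner_smul_right]
    rw [← real_inner_comm, ← integral_inner_mul_inner_stdGaussian]
    simp only [real_inner_comm]
  have h2 : ∀ k, _ := fun k => strongLaw_stdGaussianSeq (E := EuclideanSpace ℝ (Fin p))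
    (f := fun z => inner ℝ z (b k) • z) (by fun_prop) (hint k)
  simp only [hmean] at h2
  filter_upwards [h1, ae_all_iff.2 h2] with ω hω1 hω2 k
  have h4 : Tendsto (fun n : ℕ => inner ℝ ((n : ℝ)⁻¹ • ∑ i ∈ Finset.range n, ω i) (b k)) atTop
      (𝓝 (inner ℝ 0 (b k))) := hω1.inner tendsto_const_nhds
  have h3 := (hω2 k).sub (h4.smul hω1)
  rw [inner_zero_left, zero_smul, sub_zero] at h3
  refine h3.congr fun n => ?_
  rw [sampleCovLin_apply', sampleMean, Fin.sum_univ_eq_sum_range (fun i => ω i),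
    Fin.sum_univ_eq_sum_range (fun i => inner ℝ (ω i) (b k) • ω i)]

end Consistency

end WeakPCA

/-! ### The limiting law of the statistic -/

/-- Rationalising, `√(1 + c) - 1 = c / (√(1 + c) + 1)`, whose denominator tends to 2. -/
theorem tendsto_sqrt_one_add_sub_one {c : ℕ → ℝ} {κ : ℝ} (hc : ∀ n, 1 ≤ n → 0 ≤ c n)
    (hκ : Tendsto (fun n : ℕ => √(n : ℝ) * c n) atTop (𝓝 κ)) :
    Tendsto c atTop (𝓝 0) ∧ Tendsto (fun n => √(1 + c n) - 1) atTop (𝓝 0) ∧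
      Tendsto (fun n : ℕ => √(n : ℝ) * (√(1 + c n) - 1)) atTop (𝓝 (κ / 2)) := by
  have hs : Tendsto (fun n : ℕ => (√(n : ℝ))⁻¹) atTop (𝓝 0) :=
    (Real.tendsto_sqrt_atTop.comp tendsto_natCast_atTop_atTop).inv_tendsto_atTop
  have hc0 : Tendsto c atTop (𝓝 0) := by
    have := hs.mul hκ
    rw [zero_mul] at this
    refine this.congr' ?_
    filter_upwards [eventually_ge_atTop 1] with n hn
    have : √(n : ℝ) ≠ 0 := (Real.sqrt_pos.2 (by exact_mod_cast hn)).ne'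
    field_simp
  have hsq : Tendsto (fun n => √(1 + c n)) atTop (𝓝 1) := by
    have := (Real.continuous_sqrt.tendsto (1 + 0)).comp (hc0.const_add 1)
    simpa [Function.comp_def] using this
  refine ⟨hc0, by simpa using hsq.sub_const 1, ?_⟩
  have h := hκ.div (hsq.add_const 1) (by norm_num)
  rw [one_add_one_eq_two] at h
  refine h.congr' ?_
  filter_upwards [eventually_ge_atTop 1] with n hn
  have h1 := Real.mul_self_sqrt (by linarith [hc n hn] : 0 ≤ 1 + c n)
  have h2 : √(1 + c n) + 1 ≠ 0 := by positivity
  simp only [Pi.div_apply]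
  field_simp
  linear_combination -h1

theorem tendstoInMeasure_zero_of_norm_le {Ω F : Type*} [MeasurableSpace Ω] {μ : Measure Ω}
    [NormedAddCommGroup F] {f : ℕ → Ω → F} {g : ℕ → Ω → ℝ} (hf : ∀ n, AEStronglyMeasurable (f n) μ)
    (h : ∀ n ω, ‖f n ω‖ ≤ g n ω)
    (hg : Tendsto (fun n => ∫⁻ ω, ENNReal.ofReal (g n ω) ∂μ) atTop (𝓝 0)) :
    TendstoInMeasure μ f atTop fun _ => 0 := by
  refine tendstoInMeasure_of_tendsto_eLpNorm one_ne_zero hf aestronglyMeasurable_const ?_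
  refine tendsto_of_tendsto_of_tendsto_of_le_of_le tendsto_const_nhds hg (fun _ => zero_le) fun n => ?_
  rw [eLpNorm_one_eq_lintegral_enorm]
  refine lintegral_mono fun ω => ?_
  simp only [Pi.sub_apply, sub_zero]
  rw [← ofReal_norm]
  exact ENNReal.ofReal_le_ofReal (h n ω)

theorem MeasureTheory.TendstoInDistribution.id_map {ι F Ω' : Type*} {Ω : ι → Type*}
    {m : ∀ i, MeasurableSpace (Ω i)} {μ : ∀ i, Measure (Ω i)} [∀ i, IsProbabilityMeasure (μ i)]
    [MeasurableSpace Ω'] {μ' : Measure Ω'} [IsProbabilityMeasure μ'] [MeasurableSpace F]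
    [TopologicalSpace F] [OpensMeasurableSpace F] {X : ∀ i, Ω i → F} {l : Filter ι} {Z : Ω' → F}
    (h : TendstoInDistribution X l Z μ μ') {ν : Measure F} [IsProbabilityMeasure ν]
    (hν : μ'.map Z = ν) : TendstoInDistribution X l (id : F → F) μ ν := by
  refine ⟨h.forall_aemeasurable, aemeasurable_id, ?_⟩
  have := h.tendsto
  simpa only [hν, Measure.map_id] using this

namespace WeakPCA

variable {k : ℕ}

theorem norm_sq_sub_sq_eq_sum (b : OrthonormalBasis (Fin (k + 1)) ℝ (EuclideanSpace ℝ (Fin (k + 1))))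
    (u : EuclideanSpace ℝ (Fin (k + 1))) :
    ‖u‖ ^ 2 - inner ℝ (b 0) u ^ 2 = ∑ j : Fin k, inner ℝ (b j.succ) u ^ 2 := by
  rw [← b.sum_sq_norm_inner_right, Fin.sum_univ_succ]
  simp

theorem inner_sampleCovLin {p n : ℕ} (z : Fin n → EuclideanSpace ℝ (Fin p))
    (a u : EuclideanSpace ℝ (Fin p)) :
    inner ℝ a (sampleCovLin z u) =
      (n : ℝ)⁻¹ * ∑ i, inner ℝ u (z i) * inner ℝ a (z i) -
        inner ℝ u (sampleMean z) * inner ℝ a (sampleMean z) := by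
  rw [sampleCovLin_apply']
  simp only [inner_sub_right, inner_smul_right, inner_sum, real_inner_comm u]

/-- Separates the part free of the spike, to which the central limit theorem applies, from the
drift. For `S` near the identity the drift is `2 d ⟨θ, u⟩ ⟨θ, a⟩` to first order in `d`; this 2
offsets the limit `κ / 2` of `√n d`. -/
theorem inner_sampleCovLin_spikeMap {p n : ℕ} (d : ℝ) (θ a u : EuclideanSpace ℝ (Fin p))
    (z : Fin n → EuclideanSpace ℝ (Fin p)) :
    inner ℝ a (sampleCovLin (fun i => spikeMap d θ (z i)) u) =
      inner ℝ a (sampleCovLin z u) + d * (inner ℝ θ u * inner ℝ a (sampleCovLin z θ) +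
        inner ℝ θ a * inner ℝ θ (sampleCovLin z u) +
        d * (inner ℝ θ a * inner ℝ θ u * inner ℝ θ (sampleCovLin z θ))) := by
  rw [sampleCovLin_spikeMap, ← inner_spikeMap_left]
  have : sampleCovLin z (spikeMap d θ u) =
      sampleCovLin z u + (d * inner ℝ θ u) • sampleCovLin z θ := by
    rw [spikeMap, map_add, map_smul]
  rw [this, spikeMap]
  simp only [inner_add_left, inner_add_right, inner_smul_left, inner_smul_right, conj_trivial]
  ring

/-- The weak limit of the statistic, as a functional of a standard Gaussian vector. -/
theorem tendstoInDistribution_hpvStatistic_stdGaussianSeq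
    {θ₀ : EuclideanSpace ℝ (Fin (k + 1))} (hθ₀ : ‖θ₀‖ = 1)
    (b : OrthonormalBasis (Fin (k + 1)) ℝ (EuclideanSpace ℝ (Fin (k + 1)))) (hb : b 0 = θ₀)
    {c : ℕ → ℝ} {κ : ℝ} (hc : ∀ n, 1 ≤ n → 0 ≤ c n)
    (hκ : Tendsto (fun n : ℕ => √(n : ℝ) * c n) atTop (𝓝 κ))
    {θ : ℕ → EuclideanSpace ℝ (Fin (k + 1))} {θ' : EuclideanSpace ℝ (Fin (k + 1))}
    (hθ : ∀ n, ‖θ n‖ = 1) (hθ' : Tendsto θ atTop (𝓝 θ')) :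
    TendstoInDistribution (fun (n : ℕ) (ω : ℕ → EuclideanSpace ℝ (Fin (k + 1))) =>
        hpvStatistic θ₀ (fun i : Fin n => spikeMap (√(1 + c n) - 1) (θ n) (ω i))
          (eigenDirection θ₀ (fun i : Fin n => spikeMap (√(1 + c n) - 1) (θ n) (ω i)))) atTop
      (fun g : EuclideanSpace ℝ (Fin k) =>
        ‖g + WithLp.toLp 2 fun j : Fin k => κ * (inner ℝ θ' θ₀ * inner ℝ θ' (b j.succ))‖ ^ 2)
      (fun _ => stdGaussianSeq (EuclideanSpace ℝ (Fin (k + 1))))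
      (stdGaussian (EuclideanSpace ℝ (Fin k))) := by
  obtain ⟨hc0, hd0, hd⟩ := tendsto_sqrt_one_add_sub_one hc hκ
  set d : ℕ → ℝ := fun n => √(1 + c n) - 1 with hd_def
  set μP := stdGaussianSeq (EuclideanSpace ℝ (Fin (k + 1)))
  set X : ∀ n : ℕ, (ℕ → EuclideanSpace ℝ (Fin (k + 1))) → Fin n → EuclideanSpace ℝ (Fin (k + 1)) :=
    fun n ω i => spikeMap (d n) (θ n) (ω i)
  set S : ∀ n : ℕ, (ℕ → EuclideanSpace ℝ (Fin (k + 1))) → _ := fun n ω =>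
    sampleCovLin fun i : Fin n => ω i
  have hXm : ∀ n, Measurable (X n) := fun n => measurable_pi_lambda _ fun i =>
    (continuous_spikeMap _ _).measurable.comp (measurable_pi_apply _)
  set m : EuclideanSpace ℝ (Fin k) :=
    WithLp.toLp 2 fun j : Fin k => κ * (inner ℝ θ' θ₀ * inner ℝ θ' (b j.succ))
  -- Coordinates orthogonal to `θ₀`: `W = V + U + C` is the vector of `√n ⟨b j, S θ₀⟩`, with `V` the
  -- Gaussian fluctuation, `C` the centring correction and `U` the drift.
  let V : ℕ → (ℕ → EuclideanSpace ℝ (Fin (k + 1))) → EuclideanSpace ℝ (Fin k) := fun n ω =>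
    WithLp.toLp 2 fun j => (√(n : ℝ))⁻¹ *
      ∑ i ∈ Finset.range n, inner ℝ θ₀ (ω i) * inner ℝ (b j.succ) (ω i)
  let C : ℕ → (ℕ → EuclideanSpace ℝ (Fin (k + 1))) → EuclideanSpace ℝ (Fin k) := fun n ω =>
    -WithLp.toLp 2 fun j : Fin k => √(n : ℝ) *
      (inner ℝ θ₀ ((n : ℝ)⁻¹ • ∑ i ∈ Finset.range n, ω i) *
        inner ℝ (b j.succ) ((n : ℝ)⁻¹ • ∑ i ∈ Finset.range n, ω i))
  let U : ℕ → (ℕ → EuclideanSpace ℝ (Fin (k + 1))) → EuclideanSpace ℝ (Fin k) := fun n ω =>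
    WithLp.toLp 2 fun j => (√(n : ℝ) * d n) * (inner ℝ (θ n) θ₀ * inner ℝ (b j.succ) (S n ω (θ n)) +
        inner ℝ (θ n) (b j.succ) * inner ℝ (θ n) (S n ω θ₀) +
        d n * (inner ℝ (θ n) (b j.succ) * inner ℝ (θ n) θ₀ * inner ℝ (θ n) (S n ω (θ n))))
  let W : ℕ → (ℕ → EuclideanSpace ℝ (Fin (k + 1))) → EuclideanSpace ℝ (Fin k) := fun n ω =>
    WithLp.toLp 2 fun j => √(n : ℝ) * inner ℝ (b j.succ) (sampleCovLin (X n ω) θ₀)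
  let Q : ℕ → (ℕ → EuclideanSpace ℝ (Fin (k + 1))) → ℝ := fun n ω =>
    hpvStatistic θ₀ (X n ω) (eigenDirection θ₀ (X n ω))
  -- The ratio of the statistic to `‖W‖²`. Where `W = 0` the relative error bound forces `Q = 0`, so
  -- the default value 1 keeps both `ρ → 1` and `ρ ‖W‖² = Q`.
  let ρ : ℕ → (ℕ → EuclideanSpace ℝ (Fin (k + 1))) → ℝ := fun n ω =>
    if ‖W n ω‖ ^ 2 = 0 then 1 else Q n ω / ‖W n ω‖ ^ 2
  have hQm : ∀ n, Measurable (Q n) := fun n => (measurable_hpvStatistic θ₀).comp (hXm n)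
  have hSm : ∀ n u, Measurable fun ω => S n ω u := fun n u =>
    measurable_sampleCovLin (measurable_pi_lambda _ fun i => measurable_pi_apply _) measurable_const
  have hUm : ∀ n, Measurable (U n) := fun n => by
    have h1 := hSm n (θ n)
    have h2 := hSm n θ₀
    simp only [U]
    fun_prop
  have hCm : ∀ n, Measurable (C n) := fun n => by
    simp only [C]
    fun_prop
  have hWm : ∀ n, Measurable (W n) := fun n => by
    have : Measurable fun ω => sampleCovLin (X n ω) θ₀ :=
      measurable_sampleCovLin (hXm n) measurable_const
    simp only [W]
    fun_prop
  have hρm : ∀ n, Measurable (ρ n) := fun n => by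
    have h1 : Measurable fun ω => ‖W n ω‖ ^ 2 := ((hWm n).norm).pow_const 2
    exact Measurable.ite (h1 (measurableSet_singleton 0)) measurable_const ((hQm n).div h1)
  have hW : ∀ n ω, W n ω = V n ω + U n ω + C n ω := by
    intro n ω
    ext j
    simp only [W, V, U, C, X, PiLp.add_apply, PiLp.neg_apply, inner_sampleCovLin_spikeMap]
    rw [inner_sampleCovLin (fun i : Fin n => ω i) (b j.succ) θ₀, sampleMean,
      Fin.sum_univ_eq_sum_range (fun i => ω i),
      Fin.sum_univ_eq_sum_range (fun i => inner ℝ θ₀ (ω i) * inner ℝ (b j.succ) (ω i))]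
    have hs : √(n : ℝ) * (n : ℝ)⁻¹ = (√(n : ℝ))⁻¹ := by
      rcases Nat.eq_zero_or_pos n with rfl | hn
      · simp
      have hn' : (0 : ℝ) < n := by exact_mod_cast hn
      have := Real.mul_self_sqrt hn'.le
      have hs : √(n : ℝ) ≠ 0 := (Real.sqrt_pos.2 hn').ne'
      field_simp
      linear_combination this
    rw [← hs]
    ring
  have hWn : ∀ n ω, ‖W n ω‖ ^ 2 = n * (‖sampleCovLin (X n ω) θ₀‖ ^ 2 -
      inner ℝ θ₀ (sampleCovLin (X n ω) θ₀) ^ 2) := by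
    intro n ω
    rw [← hb, norm_sq_sub_sq_eq_sum b, EuclideanSpace.real_norm_sq_eq, hb, Finset.mul_sum]
    simp only [W, mul_pow, Real.sq_sqrt (Nat.cast_nonneg n)]
  -- the Gaussian part
  have hV : TendstoInDistribution V atTop id (fun _ => μP) (stdGaussian (EuclideanSpace ℝ (Fin k))) := by
    refine multivariateCLT_stdGaussianSeq hθ₀ (b := fun j => b j.succ) ?_ ?_
    · exact b.orthonormal.comp _ (Fin.succ_injective k)
    · intro j
      rw [← hb]
      exact b.orthonormal.2 (Fin.succ_ne_zero j).symm
  -- the almost sure part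
  have hae := ae_tendsto_sampleCovLin_stdGaussianSeq b
  have hU : ∀ᵐ ω ∂μP, Tendsto (fun n => U n ω) atTop (𝓝 m) := by
    filter_upwards [hae] with ω hω
    have h1 : Tendsto (fun n => S n ω (θ n)) atTop (𝓝 θ') := tendsto_apply_of_basis b hω hθ'
    have h2 : Tendsto (fun n => S n ω θ₀) atTop (𝓝 θ₀) :=
      tendsto_apply_of_basis b hω tendsto_const_nhds
    have h0 : ∀ u : EuclideanSpace ℝ (Fin (k + 1)),
        Tendsto (fun n => inner ℝ (θ n) u) atTop (𝓝 (inner ℝ θ' u)) := fun u =>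
      hθ'.inner tendsto_const_nhds
    have key : ∀ j : Fin k, Tendsto (fun n : ℕ => (√(n : ℝ) * d n) *
        (inner ℝ (θ n) θ₀ * inner ℝ (b j.succ) (S n ω (θ n)) +
        inner ℝ (θ n) (b j.succ) * inner ℝ (θ n) (S n ω θ₀) +
        d n * (inner ℝ (θ n) (b j.succ) * inner ℝ (θ n) θ₀ * inner ℝ (θ n) (S n ω (θ n))))) atTop
        (𝓝 (κ / 2 * (inner ℝ θ' θ₀ * inner ℝ (b j.succ) θ' + inner ℝ θ' (b j.succ) * inner ℝ θ' θ₀ +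
          0 * (inner ℝ θ' (b j.succ) * inner ℝ θ' θ₀ * inner ℝ θ' θ')))) := fun j =>
      hd.mul ((((h0 θ₀).mul (tendsto_const_nhds.inner h1)).add
        ((h0 (b j.succ)).mul (hθ'.inner h2))).add
          (hd0.mul (((h0 (b j.succ)).mul (h0 θ₀)).mul (hθ'.inner h1))))
    have hpi := tendsto_pi_nhds.2 key
    have := ((PiLp.continuous_toLp 2 (fun _ : Fin k => ℝ)).tendsto _).comp hpi
    have hm : m = WithLp.toLp 2 fun j : Fin k => κ / 2 * (inner ℝ θ' θ₀ * inner ℝ (b j.succ) θ' +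
        inner ℝ θ' (b j.succ) * inner ℝ θ' θ₀ +
        0 * (inner ℝ θ' (b j.succ) * inner ℝ θ' θ₀ * inner ℝ θ' θ')) := by
      ext j
      simp only [m]
      rw [real_inner_comm θ' (b j.succ)]
      ring
    rw [hm]
    exact this
  have hρ : ∀ᵐ ω ∂μP, Tendsto (fun n => ρ n ω) atTop (𝓝 1) ∧
      ∀ᶠ n in atTop, ρ n ω * ‖W n ω‖ ^ 2 = Q n ω := by
    have hgen : ∀ᵐ ω ∂μP, ∀ n : ℕ, 2 * (k + 1) ≤ n →
        HasGenericSpectrum (sampleCovLin (X n ω)) θ₀ := by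
      refine ae_all_iff.2 fun n => ?_
      by_cases hn : 2 * (k + 1) ≤ n
      · have h1 := ae_hasGenericSpectrum hθ₀ hn
        -- The law depends on `r` and `v` through their product only; here `r = c n` and `v = 1`.
        have hcn : 0 ≤ c n * 1 := by rw [mul_one]; exact hc n (by omega)
        have hlaw := spikedLaw_eq_map (n := n) hcn (hθ n)
        have h2 := (spikedLaw_absolutelyContinuous (n := n) hcn (hθ n)).ae_le h1
        rw [hlaw] at h2
        have hmm : Measurable fun (x : Fin n → EuclideanSpace ℝ (Fin (k + 1))) i =>
            spikeMap (√(1 + c n * 1) - 1) (θ n) (x i) := measurable_pi_lambda _ fun i =>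
          (continuous_spikeMap _ _).measurable.comp (measurable_pi_apply _)
        have h3 := ae_of_ae_map hmm.aemeasurable h2
        have h4 := (measurePreserving_sample_stdGaussianSeq
          (E := EuclideanSpace ℝ (Fin (k + 1))) n).quasiMeasurePreserving.ae h3
        filter_upwards [h4] with ω hω _
        simpa only [mul_one] using hω
      · exact ae_of_all _ fun ω h => absurd h hn
    filter_upwards [hae, hgen] with ω hω hg
    have hXb : ∀ j, Tendsto (fun n => sampleCovLin (X n ω) (b j)) atTop (𝓝 (b j)) := by
      intro j
      simp only [X, sampleCovLin_spikeMap]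
      exact tendsto_spikeMap hd0 hθ' (tendsto_apply_of_basis b hω
        (tendsto_spikeMap hd0 hθ' tendsto_const_nhds))
    have hev : ∀ j, Tendsto (fun n => sampleEigenvalue (X n ω) j) atTop (𝓝 1) := by
      intro j
      rw [tendsto_iff_dist_tendsto_zero]
      have hz : Tendsto (fun n => ∑ l, ‖sampleCovLin (X n ω) (b l) - b l‖) atTop
          (𝓝 (∑ l, ‖b l - b l‖)) := tendsto_finsetSum _ fun l _ => ((hXb l).sub_const _).norm
      simp only [sub_self, norm_zero, Finset.sum_const_zero] at hz
      exact squeeze_zero (fun _ => dist_nonneg)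
        (fun n => abs_sampleEigenvalue_sub_one_le b (X n ω) j) hz
    have hη : Tendsto (fun n => ∑ j, |(sampleEigenvalue (X n ω) 0)⁻¹ *
        (sampleEigenvalue (X n ω) j)⁻¹ - 1|) atTop (𝓝 0) := by
      have : Tendsto (fun n => ∑ j, |(sampleEigenvalue (X n ω) 0)⁻¹ *
          (sampleEigenvalue (X n ω) j)⁻¹ - 1|) atTop
          (𝓝 (∑ _j : Fin (k + 1), |(1 : ℝ)⁻¹ * (1 : ℝ)⁻¹ - 1|)) := tendsto_finsetSum _ fun j _ =>
        ((((hev 0).inv₀ one_ne_zero).mul ((hev j).inv₀ one_ne_zero)).sub_const 1).abs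
      simpa using this
    have hbound : ∀ n, 2 * (k + 1) ≤ n → |Q n ω - ‖W n ω‖ ^ 2| ≤
        (∑ j, |(sampleEigenvalue (X n ω) 0)⁻¹ * (sampleEigenvalue (X n ω) j)⁻¹ - 1|) *
          ‖W n ω‖ ^ 2 := fun n hn => by
      rw [hWn]
      exact abs_hpvStatistic_sub_le hθ₀ (hg n hn)
    constructor
    · rw [tendsto_iff_dist_tendsto_zero]
      refine squeeze_zero' (Eventually.of_forall fun _ => dist_nonneg) ?_ hη
      filter_upwards [eventually_ge_atTop (2 * (k + 1))] with n hn
      have hB := hbound n hn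
      simp only [ρ]
      split_ifs with h0
      · simp only [dist_self]; positivity
      · have hpos : 0 < ‖W n ω‖ ^ 2 := lt_of_le_of_ne (by positivity) (Ne.symm h0)
        rw [Real.dist_eq, div_sub_one h0, abs_div, abs_of_pos hpos, div_le_iff₀ hpos]
        exact hB
    · filter_upwards [eventually_ge_atTop (2 * (k + 1))] with n hn
      have hB := hbound n hn
      simp only [ρ]
      split_ifs with h0
      · rw [h0, mul_zero, sub_zero] at hB
        rw [h0, mul_zero]
        exact (abs_eq_zero.1 (le_antisymm hB (abs_nonneg _))).symm
      · exact div_mul_cancel₀ _ h0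
  -- the correction for the mean
  have hC : TendstoInMeasure μP C atTop fun _ => 0 := by
    -- `‖C‖` is at most `√n` times the squared norm of the sample mean, whose expectation is of
    -- order `1 / √n`.
    refine tendstoInMeasure_zero_of_norm_le (fun n => (hCm n).aestronglyMeasurable) (fun n ω => ?_)
      (tendsto_lintegral_norm_sq_mean_stdGaussianSeq (E := EuclideanSpace ℝ (Fin (k + 1))))
    set z := (n : ℝ)⁻¹ • ∑ i ∈ Finset.range n, ω i
    have hz : |inner ℝ θ₀ z| ≤ ‖z‖ := by
      simpa [hθ₀] using abs_real_inner_le_norm θ₀ z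
    have h2 : ∑ j : Fin k, inner ℝ (b j.succ) z ^ 2 ≤ ‖z‖ ^ 2 := by
      rw [← norm_sq_sub_sq_eq_sum]
      linarith [sq_nonneg (inner ℝ (b 0) z)]
    refine le_of_sq_le_sq ?_ (by positivity)
    have h4 : ‖C n ω‖ ^ 2 = ∑ j : Fin k,
        √(n : ℝ) ^ 2 * (inner ℝ θ₀ z ^ 2 * inner ℝ (b j.succ) z ^ 2) := by
      simp only [C, norm_neg, EuclideanSpace.real_norm_sq_eq, mul_pow, z]
    rw [h4, mul_pow, ← Finset.mul_sum, ← Finset.mul_sum]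
    have h3 : inner ℝ θ₀ z ^ 2 ≤ ‖z‖ ^ 2 := by rw [← sq_abs]; gcongr
    calc √(n : ℝ) ^ 2 * (inner ℝ θ₀ z ^ 2 * ∑ j : Fin k, inner ℝ (b j.succ) z ^ 2)
        ≤ √(n : ℝ) ^ 2 * (‖z‖ ^ 2 * ‖z‖ ^ 2) := by gcongr
      _ = √(n : ℝ) ^ 2 * (‖z‖ ^ 2) ^ 2 := by ring
  have hVU := hV.add_of_tendstoInMeasure_const (Y := U) (c := m)
    (tendstoInMeasure_of_tendsto_ae (fun n => (hUm n).aestronglyMeasurable) hU)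
    fun n => (hUm n).aemeasurable
  have hVUC := hVU.add_of_tendstoInMeasure_const (Y := C) (c := 0) hC fun n => (hCm n).aemeasurable
  have hprod := hVUC.continuous_comp_prodMk_of_tendstoInMeasure_const (Y := ρ) (c := 1)
    (g := fun q : EuclideanSpace ℝ (Fin k) × ℝ => q.2 * ‖q.1‖ ^ 2) (by fun_prop)
    (tendstoInMeasure_of_tendsto_ae (fun n => (hρm n).aestronglyMeasurable)
      (hρ.mono fun ω h => h.1)) fun n => (hρm n).aemeasurable
  simp only [one_mul, add_zero, id] at hprod
  -- Almost surely `Q` agrees with `ρ ‖V + U + C‖²` only from some `n` on, which suffices for the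
  -- difference to vanish in measure.
  refine tendstoInDistribution_of_tendstoInMeasure_sub Q _ hprod ?_ fun n => (hQm n).aemeasurable
  refine tendstoInMeasure_of_tendsto_ae (fun n => ?_) ?_
  · refine ((hQm n).sub ((hρm n).mul (Measurable.pow_const (Measurable.norm ?_) 2))).aestronglyMeasurable
    have := hWm n
    have hWe : W n = V n + U n + C n := funext (hW n)
    rwa [hWe] at this
  · filter_upwards [hρ] with ω hω
    refine tendsto_const_nhds.congr' ?_
    filter_upwards [hω.2] with n hn
    simp only [Pi.sub_apply, Pi.add_apply, Pi.zero_apply]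
    rw [← hn, hW]
    ring

end WeakPCA

/-! ### Noncentral chi-square distributions -/

/-- A reflection carries `a` to `b` and preserves both the norm and the standard Gaussian law. Hence
the limit law depends on the drift through its norm alone. -/
theorem map_norm_add_sq_stdGaussian_congr {E : Type*} [NormedAddCommGroup E]
    [InnerProductSpace ℝ E] [FiniteDimensional ℝ E] [MeasurableSpace E] [BorelSpace E] {a b : E}
    (h : ‖a‖ = ‖b‖) :
    (stdGaussian E).map (fun g => ‖g + a‖ ^ 2) = (stdGaussian E).map fun g => ‖g + b‖ ^ 2 := by
  set R := (Submodule.span ℝ {a - b})ᗮ.reflection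
  have hR : R a = b := Submodule.reflection_sub h
  have hm : Measurable fun g : E => ‖g + b‖ ^ 2 := by fun_prop
  conv_rhs => rw [← stdGaussian_map R]
  rw [Measure.map_map hm R.continuous.measurable]
  congr 1
  ext g
  simp only [Function.comp_apply]
  rw [← hR, ← map_add, R.norm_map]

/-- Among intervals of a given length, the centred one has the largest Gaussian measure. -/
theorem gaussianReal_Icc_lt {m a : ℝ} (hm : 0 < m) (ha : 0 < a) :
    gaussianReal m 1 (Set.Icc (-a) a) < gaussianReal 0 1 (Set.Icc (-a) a) := by
  have hcont : Continuous (gaussianPDFReal 0 1) := by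
    unfold gaussianPDFReal
    fun_prop
  have hint : ∀ s t, IntervalIntegrable (gaussianPDFReal 0 1) volume s t := fun s t =>
    hcont.intervalIntegrable s t
  have heq : ∀ μ, gaussianReal μ 1 (Set.Icc (-a) a) =
      ENNReal.ofReal (∫ x in (-a)..a, gaussianPDFReal μ 1 x) := fun μ => by
    rw [gaussianReal_apply_eq_integral _ one_ne_zero, integral_Icc_eq_integral_Ioc,
      intervalIntegral.integral_of_le (by linarith)]
  have hmono : ∀ t ∈ Set.Ioc 0 m, gaussianPDFReal 0 1 (a + t) < gaussianPDFReal 0 1 (a - t) := by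
    intro t ht
    simp only [gaussianPDFReal]
    have : 0 < (√(2 * Real.pi * ((1 : ℝ≥0) : ℝ)))⁻¹ := by positivity
    refine mul_lt_mul_of_pos_left (Real.exp_lt_exp.2 ?_) this
    simp only [NNReal.coe_one, mul_one, sub_zero]
    nlinarith [ht.1]
  have hlt : ∫ t in (0 : ℝ)..m, gaussianPDFReal 0 1 (a + t) <
      ∫ t in (0 : ℝ)..m, gaussianPDFReal 0 1 (a - t) :=
    intervalIntegral.integral_lt_integral_of_continuousOn_of_le_of_exists_lt hm
      (by fun_prop) (by fun_prop) (fun t ht => (hmono t ht).le)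
      ⟨m, Set.right_mem_Icc.2 hm.le, hmono m (Set.right_mem_Ioc.2 hm)⟩
  rw [heq, heq]
  -- Recentring moves the interval to `[-a - m, a - m]`. Compared with `[-a, a]` it gains `[-a - m,
  -- -a]` and loses `[a - m, a]`; parametrised by `a + t` (after a sign change) and `a - t`, these
  -- are compared by `hmono`. Oriented integrals cover the case of disjoint intervals.
  have hshift : ∫ x in (-a)..a, gaussianPDFReal m 1 x =
      ∫ x in (-a - m)..(a - m), gaussianPDFReal 0 1 x := by
    rw [← intervalIntegral.integral_comp_sub_right]
    simp [gaussianPDFReal_sub]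
  have heven : ∫ t in (0 : ℝ)..m, gaussianPDFReal 0 1 (a + t) =
      ∫ x in (-a - m)..(-a), gaussianPDFReal 0 1 x := by
    rw [intervalIntegral.integral_comp_add_left, add_zero,
      show -a - m = -(a + m) by ring, ← intervalIntegral.integral_comp_neg]
    simp [gaussianPDFReal]
  have hrefl : ∫ t in (0 : ℝ)..m, gaussianPDFReal 0 1 (a - t) =
      ∫ x in (a - m)..a, gaussianPDFReal 0 1 x := by
    rw [intervalIntegral.integral_comp_sub_left, sub_zero]
  have hdiff := intervalIntegral.integral_interval_sub_interval_comm (hint (-a) a)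
    (hint (-a - m) (a - m)) (hint _ _)
  rw [intervalIntegral.integral_symm (-a - m) (-a), intervalIntegral.integral_symm (a - m) a]
    at hdiff
  rw [hshift]
  refine (ENNReal.ofReal_lt_ofReal_iff ?_).2 (by linarith)
  exact intervalIntegral.intervalIntegral_pos_of_pos_on (hint _ _)
    (fun x _ => gaussianPDFReal_pos 0 1 x one_ne_zero) (by linarith)

namespace WeakPCA

theorem noncentralChiSq_eq_map_stdGaussian {k : ℕ} (hk : k ≠ 0)
    (m : EuclideanSpace ℝ (Fin k)) :
    noncentralChiSq k (‖m‖ ^ 2) =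
      (stdGaussian (EuclideanSpace ℝ (Fin k))).map fun g => ‖g + m‖ ^ 2 := by
  have : NeZero k := ⟨hk⟩
  set a : EuclideanSpace ℝ (Fin k) :=
    WithLp.toLp 2 fun i : Fin k => if (i : ℕ) = 0 then √(‖m‖ ^ 2) else 0
  have ha : ‖a‖ = ‖m‖ := by
    have : a = EuclideanSpace.single (0 : Fin k) ‖m‖ := by
      ext i
      simp only [a, Real.sqrt_sq (norm_nonneg m), PiLp.single_apply, Fin.ext_iff,
        Fin.val_zero]
    rw [this]
    simp
  rw [← map_norm_add_sq_stdGaussian_congr ha, ← map_pi_eq_stdGaussian, Measure.map_map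
    (by fun_prop) (by fun_prop), noncentralChiSq]
  have hpi : (Measure.pi fun i : Fin k => gaussianReal (if (i : ℕ) = 0 then √(‖m‖ ^ 2) else 0) 1) =
      (Measure.pi fun _ : Fin k => gaussianReal 0 1).map fun z i => z i + a i := by
    have : ∀ i, SigmaFinite ((gaussianReal 0 1).map fun x => x + a i) := fun i => by
      rw [gaussianReal_map_add_const]; infer_instance
    have hmap := Measure.pi_map_pi (μ := fun _ : Fin k => gaussianReal 0 1)
      (f := fun i x => x + a i) fun i => by fun_prop
    rw [hmap]
    simp only [gaussianReal_map_add_const, zero_add, a]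
  rw [hpi, Measure.map_map (by fun_prop) (by fun_prop)]
  congr 1
  ext z
  simp [EuclideanSpace.real_norm_sq_eq]

theorem noncentralChiSq_singleton {k : ℕ} (hk : k ≠ 0) (δ x : ℝ) :
    noncentralChiSq k δ {x} = 0 := by
  have : NeZero k := ⟨hk⟩
  rw [noncentralChiSq, Measure.map_apply (by fun_prop) (measurableSet_singleton x)]
  refine pi_absolutelyContinuous _ (fun _ => volume)
    (fun _ => gaussianReal_absolutelyContinuous _ one_ne_zero) ?_
  rw [← volume_pi]
  have hf : ContDiff ℝ ⊤ fun z : Fin k → ℝ => ∑ i, z i ^ 2 - x := by fun_prop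
  have hset : (fun z : Fin k → ℝ => ∑ i, z i ^ 2) ⁻¹' {x} = {z | ∑ i, z i ^ 2 - x = 0} := by
    ext z
    simp [sub_eq_zero]
  rw [hset]
  by_cases hx : x = 0
  · refine addHaar_zeroSet_eq_zero_of_analytic volume hf (x₀ := fun _ => 1) ?_
    simpa [hx] using hk
  · refine addHaar_zeroSet_eq_zero_of_analytic volume hf (x₀ := fun _ => 0) ?_
    simpa using hx

theorem noncentralChiSq_Iic_zero {k : ℕ} (hk : k ≠ 0) (δ : ℝ) :
    noncentralChiSq k δ (Set.Iic 0) = 0 := by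
  refine measure_mono_null (t := Set.Iio 0 ∪ {0}) (fun x hx => ?_)
    (measure_union_null ?_ (noncentralChiSq_singleton hk δ 0))
  · exact lt_or_eq_of_le (show x ≤ 0 from hx)
  · rw [noncentralChiSq, Measure.map_apply (by fun_prop) measurableSet_Iio]
    convert measure_empty (μ := Measure.pi _)
    ext z
    simpa using Finset.sum_nonneg fun i _ => sq_nonneg (z i)

/-- The quantile is attained exactly because the law has no atoms: left limits of the distribution
function bound it above, right continuity bounds it below. -/
theorem noncentralChiSq_Iic_chiSqUpperQuantile {k : ℕ} (hk : k ≠ 0) {α : ℝ} (hα0 : 0 < α)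
    (hα1 : α < 1) :
    noncentralChiSq k 0 (Set.Iic (chiSqUpperQuantile k α)) = ENNReal.ofReal (1 - α) := by
  set ν := noncentralChiSq k 0
  set S := {x : ℝ | 1 - α ≤ cdf ν x}
  set q := chiSqUpperQuantile k α
  have hq : q = sInf S := rfl
  have hne : S.Nonempty :=
    ((tendsto_cdf_atTop ν).eventually (eventually_ge_nhds (by linarith : 1 - α < 1))).exists
  have hbdd : BddBelow S := by
    obtain ⟨y, hy⟩ := ((tendsto_cdf_atBot ν).eventually
      (eventually_lt_nhds (by linarith : 0 < 1 - α))).exists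
    exact ⟨y, fun x hx => le_of_not_gt fun h => (hx.trans (monotone_cdf ν h.le)).not_gt hy⟩
  apply le_antisymm
  · have h1 : ν (Set.Iic q) ≤ ν (Set.Iio q) := by
      rw [← Set.Iio_union_right]
      refine (measure_union_le _ _).trans_eq ?_
      rw [noncentralChiSq_singleton hk, add_zero]
    refine h1.trans ?_
    conv_lhs => rw [← measure_cdf ν]
    rw [StieltjesFunction.measure_Iio _ (tendsto_cdf_atBot ν), sub_zero]
    refine ENNReal.ofReal_le_ofReal ?_
    refine le_of_tendsto ((monotone_cdf ν).tendsto_leftLim q) ?_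
    filter_upwards [self_mem_nhdsWithin] with y hy
    exact le_of_not_gt fun h => (csInf_le hbdd (show y ∈ S from h.le)).not_gt hy
  · rw [← ofReal_cdf]
    refine ENNReal.ofReal_le_ofReal ?_
    have hr : Tendsto (cdf ν) (𝓝[>] q) (𝓝 (cdf ν q)) :=
      ((cdf ν).right_continuous q).mono_left (nhdsWithin_mono _ Set.Ioi_subset_Ici_self)
    refine ge_of_tendsto hr ?_
    filter_upwards [self_mem_nhdsWithin] with y hy
    obtain ⟨x, hx, hxy⟩ := exists_lt_of_csInf_lt hne (hq ▸ hy : sInf S < y)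
    exact le_trans hx (monotone_cdf ν hxy.le)

theorem noncentralChiSq_real_Ioi_chiSqUpperQuantile {k : ℕ} (hk : k ≠ 0) {α : ℝ} (hα0 : 0 < α)
    (hα1 : α < 1) :
    (noncentralChiSq k 0).real (Set.Ioi (chiSqUpperQuantile k α)) = α := by
  rw [← Set.compl_Iic, probReal_compl_eq_one_sub measurableSet_Iic, Measure.real,
    noncentralChiSq_Iic_chiSqUpperQuantile hk hα0 hα1, ENNReal.toReal_ofReal (by linarith)]
  ring

theorem chiSqUpperQuantile_pos {k : ℕ} (hk : k ≠ 0) {α : ℝ} (hα0 : 0 < α) (hα1 : α < 1) :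
    0 < chiSqUpperQuantile k α := by
  by_contra! h
  have h1 := noncentralChiSq_Iic_chiSqUpperQuantile hk hα0 hα1
  have h2 := measure_mono_null (Set.Iic_subset_Iic.2 h) (noncentralChiSq_Iic_zero hk 0)
  rw [h2, eq_comm, ENNReal.ofReal_eq_zero] at h1
  linarith

instance isOpenPosMeasure_gaussianReal (m : ℝ) : (gaussianReal m 1).IsOpenPosMeasure :=
  (gaussianReal_absolutelyContinuous' m one_ne_zero).isOpenPosMeasure

theorem noncentralChiSq_real_Ioi_lt_one (k : ℕ) (δ : ℝ) {q : ℝ} (hq : 0 < q) :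
    (noncentralChiSq k δ).real (Set.Ioi q) < 1 := by
  have hpos : 0 < noncentralChiSq k δ (Set.Iic q) := by
    refine lt_of_lt_of_le ?_ (measure_mono Set.Iio_subset_Iic_self)
    rw [noncentralChiSq, Measure.map_apply (by fun_prop) measurableSet_Iio]
    refine IsOpen.measure_pos _ (isOpen_Iio.preimage (by fun_prop)) ⟨0, ?_⟩
    simpa using hq
  rw [← Set.compl_Iic, probReal_compl_eq_one_sub measurableSet_Iic]
  have := ENNReal.toReal_pos hpos.ne' (measure_ne_top _ _)
  simp only [Measure.real]
  linarith

theorem noncentralChiSq_succ_Iic (l : ℕ) (δ q : ℝ) :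
    noncentralChiSq (l + 1) δ (Set.Iic q) =
      ∫⁻ z, gaussianReal √δ 1 {a | a ^ 2 + ∑ i, z i ^ 2 ≤ q}
        ∂(Measure.pi fun _ : Fin l => gaussianReal 0 1) := by
  have hs : MeasurableSet {w : ℝ × (Fin l → ℝ) | w.1 ^ 2 + ∑ i, w.2 i ^ 2 ≤ q} :=
    measurableSet_le (by fun_prop) measurable_const
  have hmp := measurePreserving_piFinSuccAbove
    (fun i : Fin (l + 1) => gaussianReal (if (i : ℕ) = 0 then √δ else 0) 1) 0
  have h := hmp.measure_preimage hs.nullMeasurableSet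
  simp only [Fin.val_zero, if_true, Fin.zero_succAbove, Fin.val_succ, Nat.succ_ne_zero,
    if_false] at h
  rw [Measure.prod_apply_symm hs] at h
  rw [noncentralChiSq, Measure.map_apply (by fun_prop) measurableSet_Iic]
  refine Eq.trans (congrArg _ ?_) h
  ext z
  simp [Fin.sum_univ_succ, MeasurableEquiv.piFinSuccAbove, Fin.insertNthEquiv, Fin.tail]

theorem gaussianReal_setOf_sq_add_le_lt {m s q : ℝ} (hm : 0 < m) (hs : s < q) :
    gaussianReal m 1 {a | a ^ 2 + s ≤ q} < gaussianReal 0 1 {a | a ^ 2 + s ≤ q} := by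
  have h : {a | a ^ 2 + s ≤ q} = Set.Icc (-√(q - s)) √(q - s) := by
    ext a
    rw [Set.mem_Icc, ← abs_le, ← Real.sqrt_sq_eq_abs, Real.sqrt_le_sqrt_iff (by linarith)]
    exact (le_sub_iff_add_le (a := a ^ 2) (b := s) (c := q)).symm
  rw [h]
  exact gaussianReal_Icc_lt hm (Real.sqrt_pos.2 (by linarith))

theorem gaussianReal_setOf_sq_add_le_eq_zero {m s q : ℝ} (hs : q ≤ s) :
    gaussianReal m 1 {a | a ^ 2 + s ≤ q} = 0 := by
  have := nullSingletonClass_gaussianReal (μ := m) one_ne_zero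
  refine measure_mono_null (t := {0}) (fun a ha => ?_) (measure_singleton 0)
  have ha' : a ^ 2 + s ≤ q := ha
  exact pow_eq_zero_iff two_ne_zero |>.1 (le_antisymm (by linarith) (sq_nonneg a))

/-- Given the coordinates of mean zero, the event is a centred interval for the remaining one, so
the shift can only lower its probability. The loss is strict on the open set `∑ z i ^ 2 < q`, which
has positive mass. -/
theorem noncentralChiSq_Iic_lt {k : ℕ} (hk : k ≠ 0) {δ q : ℝ} (hδ : 0 < δ) (hq : 0 < q) :
    noncentralChiSq k δ (Set.Iic q) < noncentralChiSq k 0 (Set.Iic q) := by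
  obtain ⟨l, rfl⟩ := Nat.exists_eq_succ_of_ne_zero hk
  have hfin : noncentralChiSq (l + 1) δ (Set.Iic q) ≠ ∞ := measure_ne_top _ _
  rw [Nat.succ_eq_add_one, noncentralChiSq_succ_Iic, noncentralChiSq_succ_Iic, Real.sqrt_zero]
  rw [noncentralChiSq_succ_Iic] at hfin
  have hmeas : Measurable fun z : Fin l → ℝ => gaussianReal 0 1 {a | a ^ 2 + ∑ i, z i ^ 2 ≤ q} := by
    have hs : MeasurableSet {w : ℝ × (Fin l → ℝ) | w.1 ^ 2 + ∑ i, w.2 i ^ 2 ≤ q} :=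
      measurableSet_le (by fun_prop) measurable_const
    exact measurable_measure_prodMk_right hs
  refine lintegral_strict_mono_of_ae_le_of_ae_lt_on hmeas.aemeasurable hfin
    (ae_of_all _ fun z => ?_) (s := {z | ∑ i, z i ^ 2 < q}) ?_
    (ae_of_all _ fun z hz => gaussianReal_setOf_sq_add_le_lt (Real.sqrt_pos.2 hδ) hz)
  · rcases lt_or_ge (∑ i, z i ^ 2) q with h | h
    · exact (gaussianReal_setOf_sq_add_le_lt (Real.sqrt_pos.2 hδ) h).le
    · exact (gaussianReal_setOf_sq_add_le_eq_zero h).trans_le zero_le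
  · refine (IsOpen.measure_pos _ (isOpen_lt (by fun_prop) continuous_const) ⟨0, ?_⟩).ne'
    simpa using hq

theorem noncentralChiSq_real_Ioi_lt {k : ℕ} (hk : k ≠ 0) {δ q : ℝ} (hδ : 0 < δ) (hq : 0 < q) :
    (noncentralChiSq k 0).real (Set.Ioi q) < (noncentralChiSq k δ).real (Set.Ioi q) := by
  have h := ENNReal.toReal_strict_mono (measure_ne_top _ _) (noncentralChiSq_Iic_lt hk hδ hq)
  rw [← Set.compl_Iic, probReal_compl_eq_one_sub measurableSet_Iic,
    probReal_compl_eq_one_sub measurableSet_Iic]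
  simp only [Measure.real]
  linarith

end WeakPCA

namespace WeakPCA

/-! ### Limiting law of the statistic and limiting power of the test -/

theorem exists_orthonormalBasis_zero_eq {k : ℕ} {θ : EuclideanSpace ℝ (Fin (k + 1))}
    (hθ : ‖θ‖ = 1) :
    ∃ b : OrthonormalBasis (Fin (k + 1)) ℝ (EuclideanSpace ℝ (Fin (k + 1))), b 0 = θ := by
  have hv : Orthonormal ℝ (({0} : Set (Fin (k + 1))).domRestrict fun _ => θ) := by
    refine ⟨fun _ => hθ, fun i j hij => absurd (Subsingleton.elim i j) hij⟩
  obtain ⟨b, hb⟩ := hv.exists_orthonormalBasis_extension_of_card_eq (by simp)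
  exact ⟨b, hb 0 rfl⟩

theorem ae_hpvStatistic_eq {p n : ℕ} [NeZero p] {θ₀ θ : EuclideanSpace ℝ (Fin p)} {r v : ℝ}
    (hrv : 0 ≤ r * v) (hθ₀ : ‖θ₀‖ = 1) (hθ : ‖θ‖ = 1) (hn : 2 * p ≤ n)
    {w : (Fin n → EuclideanSpace ℝ (Fin p)) → Fin p → EuclideanSpace ℝ (Fin p)}
    (hw : ∀ x j, ‖w x j‖ = 1 ∧ sampleCovLin x (w x j) = sampleEigenvalue x j • w x j) :
    (fun x => hpvStatistic θ₀ x (eigenDirection θ₀ x)) =ᵐ[spikedLaw n r v θ]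
      fun x => hpvStatistic θ₀ x (w x) := by
  filter_upwards [(spikedLaw_absolutelyContinuous hrv hθ).ae_le (ae_hasGenericSpectrum hθ₀ hn)]
    with x hx
  exact (hpvStatistic_eq_of_hasGenericSpectrum hx (fun j => (hw x j).1) fun j => (hw x j).2).symm

theorem map_hpvStatistic_spikedLaw {p n : ℕ} [NeZero p] {θ₀ θ : EuclideanSpace ℝ (Fin p)} {r v : ℝ}
    (hrv : 0 ≤ r * v) (hθ : ‖θ‖ = 1) :
    (spikedLaw n r v θ).map (fun x => hpvStatistic θ₀ x (eigenDirection θ₀ x)) =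
      (stdGaussianSeq (EuclideanSpace ℝ (Fin p))).map fun ω =>
        hpvStatistic θ₀ (fun i : Fin n => spikeMap (√(1 + r * v) - 1) θ (ω i))
          (eigenDirection θ₀ fun i : Fin n => spikeMap (√(1 + r * v) - 1) θ (ω i)) := by
  have hm : Measurable fun (x : Fin n → EuclideanSpace ℝ (Fin p)) i =>
      spikeMap (√(1 + r * v) - 1) θ (x i) := measurable_pi_lambda _ fun i =>
    (continuous_spikeMap _ _).measurable.comp (measurable_pi_apply _)
  have hs := measurePreserving_sample_stdGaussianSeq (E := EuclideanSpace ℝ (Fin p)) n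
  rw [spikedLaw_eq_map hrv hθ, ← hs.map_eq, Measure.map_map hm hs.measurable,
    Measure.map_map (measurable_hpvStatistic θ₀) (hm.comp hs.measurable)]
  rfl

theorem convergesInLaw_hpvStatistic {k : ℕ} (hk : k ≠ 0)
    {θ₀ : EuclideanSpace ℝ (Fin (k + 1))} (hθ₀ : ‖θ₀‖ = 1)
    {e : ∀ n, (Fin n → EuclideanSpace ℝ (Fin (k + 1))) → Fin (k + 1) →
      EuclideanSpace ℝ (Fin (k + 1))}
    (he : IsSampleEigenvectorChoice e) {r : ℕ → ℝ} {v κ : ℝ} (hrv : ∀ n, 1 ≤ n → 0 ≤ r n * v)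
    (hκ : Tendsto (fun n : ℕ => √(n : ℝ) * (r n * v)) atTop (𝓝 κ))
    {θ : ℕ → EuclideanSpace ℝ (Fin (k + 1))} {θ' : EuclideanSpace ℝ (Fin (k + 1))}
    (hθ : ∀ n, ‖θ n‖ = 1) (hθ' : Tendsto θ atTop (𝓝 θ')) :
    ConvergesInLaw (fun n x => hpvStatistic θ₀ x (e n x)) (fun n => spikedLaw n (r n) v (θ n))
      (noncentralChiSq k (κ ^ 2 * (inner ℝ θ' θ₀ ^ 2 * (1 - inner ℝ θ' θ₀ ^ 2)))) := by
  obtain ⟨b, hb⟩ := exists_orthonormalBasis_zero_eq hθ₀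
  have hlim := tendstoInDistribution_hpvStatistic_stdGaussianSeq hθ₀ b hb hrv hκ hθ hθ'
  have hnorm : ‖θ'‖ = 1 :=
    tendsto_nhds_unique hθ'.norm (by simpa only [hθ] using tendsto_const_nhds)
  set m : EuclideanSpace ℝ (Fin k) :=
    WithLp.toLp 2 fun j : Fin k => κ * (inner ℝ θ' θ₀ * inner ℝ θ' (b j.succ))
  have hm : ‖m‖ ^ 2 = κ ^ 2 * (inner ℝ θ' θ₀ ^ 2 * (1 - inner ℝ θ' θ₀ ^ 2)) := by
    have h := norm_sq_sub_sq_eq_sum b θ'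
    rw [hnorm, hb, one_pow, real_inner_comm] at h
    rw [h, EuclideanSpace.real_norm_sq_eq, Finset.mul_sum, Finset.mul_sum]
    refine Finset.sum_congr rfl fun j _ => ?_
    simp only [m]
    rw [real_inner_comm θ' (b j.succ)]
    ring
  rw [← hm]
  have hlim' := hlim.id_map (noncentralChiSq_eq_map_stdGaussian hk m).symm
  have hae : ∀ n, (fun x => hpvStatistic θ₀ x (eigenDirection θ₀ x))
      =ᵐ[spikedLaw (n + 2 * (k + 1)) (r (n + 2 * (k + 1))) v (θ (n + 2 * (k + 1)))]
      fun x => hpvStatistic θ₀ x (e (n + 2 * (k + 1)) x) := fun n =>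
    ae_hpvStatistic_eq (hrv _ (by omega)) hθ₀ (hθ _) (by omega) (he _)
  -- From this sample size on almost every sample is generic, so the statistic agrees almost
  -- everywhere with a measurable one, however irregular the choice `e` is.
  refine ⟨2 * (k + 1), fun n => (measurable_hpvStatistic θ₀).aemeasurable.congr (hae n),
    aemeasurable_id, ?_⟩
  refine (hlim'.tendsto.comp (tendsto_add_atTop_nat (2 * (k + 1)))).congr fun n =>
    Subtype.ext ?_
  exact (map_hpvStatistic_spikedLaw (hrv (n + 2 * (k + 1)) (by omega)) (hθ _)).symm.trans
    (Measure.map_congr (hae n))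

theorem ConvergesInLaw.tendsto_integral_indicator_Ioi {Ω : ℕ → Type*}
    [∀ n, MeasurableSpace (Ω n)] {T : ∀ n, Ω n → ℝ} {P : ∀ n, Measure (Ω n)}
    [∀ n, IsProbabilityMeasure (P n)] {ν : Measure ℝ} [IsProbabilityMeasure ν]
    (h : ConvergesInLaw T P ν) {q : ℝ} (hq : ν {q} = 0) :
    Tendsto (fun n => ∫ ω, (Set.Ioi q).indicator (fun _ => (1 : ℝ)) (T n ω) ∂(P n)) atTop
      (𝓝 (ν.real (Set.Ioi q))) := by
  obtain ⟨N, hN⟩ := h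
  refine (tendsto_add_atTop_iff_nat N).1 ?_
  have h0 : ν.map (id : ℝ → ℝ) (frontier (Set.Ioi q)) = 0 := by
    rw [Measure.map_id, frontier_Ioi, hq]
  have h1 := ProbabilityMeasure.tendsto_measure_of_null_frontier_of_tendsto' hN.tendsto h0
  simp only [ProbabilityMeasure.coe_mk, Measure.map_id] at h1
  refine ((ENNReal.tendsto_toReal (measure_ne_top ν _)).comp h1).congr fun n => ?_
  have hT := hN.forall_aemeasurable n
  rw [← integral_map (φ := T (n + N)) (f := (Set.Ioi q).indicator fun _ => (1 : ℝ)) hT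
    (Measurable.aestronglyMeasurable (measurable_const.indicator measurableSet_Ioi)),
    integral_indicator_const _ measurableSet_Ioi]
  simp [Measure.real]

theorem hpvTest_eq_indicator {p n : ℕ} [NeZero p] (α : ℝ) (θ₀ : EuclideanSpace ℝ (Fin p))
    (x : Fin n → EuclideanSpace ℝ (Fin p)) (w : Fin p → EuclideanSpace ℝ (Fin p)) :
    hpvTest α θ₀ x w = (Set.Ioi (chiSqUpperQuantile (p - 1) α)).indicator (fun _ => (1 : ℝ))
      (hpvStatistic θ₀ x w) := by
  classical
  simp [hpvTest, Set.indicator_apply]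

theorem tendsto_integral_hpvTest {k : ℕ} (hk : k ≠ 0)
    {θ₀ : EuclideanSpace ℝ (Fin (k + 1))} (hθ₀ : ‖θ₀‖ = 1)
    {e : ∀ n, (Fin n → EuclideanSpace ℝ (Fin (k + 1))) → Fin (k + 1) →
      EuclideanSpace ℝ (Fin (k + 1))}
    (he : IsSampleEigenvectorChoice e) {r : ℕ → ℝ} {v κ : ℝ} (hrv : ∀ n, 1 ≤ n → 0 ≤ r n * v)
    (hκ : Tendsto (fun n : ℕ => √(n : ℝ) * (r n * v)) atTop (𝓝 κ))
    {θ : ℕ → EuclideanSpace ℝ (Fin (k + 1))} {θ' : EuclideanSpace ℝ (Fin (k + 1))}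
    (hθ : ∀ n, ‖θ n‖ = 1) (hθ' : Tendsto θ atTop (𝓝 θ')) (α : ℝ) :
    Tendsto (fun n => ∫ x, hpvTest α θ₀ x (e n x) ∂(spikedLaw n (r n) v (θ n))) atTop
      (𝓝 ((noncentralChiSq k (κ ^ 2 * (inner ℝ θ' θ₀ ^ 2 * (1 - inner ℝ θ' θ₀ ^ 2)))).real
        (Set.Ioi (chiSqUpperQuantile k α)))) := by
  simp only [hpvTest_eq_indicator]
  exact (convergesInLaw_hpvStatistic hk hθ₀ he hrv hκ hθ hθ').tendsto_integral_indicator_Ioi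
    (noncentralChiSq_singleton hk _ _)

theorem isTestSequence_hpvTest {p : ℕ} [NeZero p] {θ₀ : EuclideanSpace ℝ (Fin p)} (hθ₀ : ‖θ₀‖ = 1)
    {e : ∀ n, (Fin n → EuclideanSpace ℝ (Fin p)) → Fin p → EuclideanSpace ℝ (Fin p)}
    (he : IsSampleEigenvectorChoice e) {r : ℕ → ℝ} {v : ℝ} (hrv : ∀ n, 1 ≤ n → 0 ≤ r n * v)
    (α : ℝ) :
    IsTestSequence (fun n θ => spikedLaw n (r n) v θ) fun n x => hpvTest α θ₀ x (e n x) := by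
  constructor
  · intro n x
    simp only [hpvTest]
    split_ifs <;> simp
  · filter_upwards [eventually_ge_atTop (2 * p)] with n hn θ hθ
    have hp := NeZero.pos p
    simp only [hpvTest_eq_indicator]
    exact (measurable_const.indicator measurableSet_Ioi).comp_aemeasurable
      ((measurable_hpvStatistic θ₀).aemeasurable.congr
        (ae_hpvStatistic_eq (hrv n (by omega)) hθ₀ hθ hn (he n)))

/-! ### Triviality of the strict contiguity regime -/

/-- Since `√x ≥ x` on `[0, 1]`, Bernoulli's inequality gives `√(1 - c²) ^ n ≥ 1 - n c²`, and `n c² →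
0`. -/
theorem tendsto_inv_sqrt_one_sub_sq_pow {c : ℕ → ℝ}
    (hc : Tendsto (fun n : ℕ => √(n : ℝ) * c n) atTop (𝓝 0)) (hc0 : Tendsto c atTop (𝓝 0)) :
    Tendsto (fun n : ℕ => √((√(1 - c n ^ 2))⁻¹ ^ n - 1)) atTop (𝓝 0) := by
  have hn : Tendsto (fun n : ℕ => 1 - n * c n ^ 2) atTop (𝓝 1) := by
    have := (hc.pow 2).const_sub 1
    simpa [mul_pow, Real.sq_sqrt (Nat.cast_nonneg _)] using this
  have hc1 : ∀ᶠ n in atTop, c n ^ 2 < 1 := by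
    have := hc0.pow 2
    rw [zero_pow two_ne_zero] at this
    exact this.eventually (gt_mem_nhds one_pos)
  have h1 : Tendsto (fun n : ℕ => √(1 - c n ^ 2) ^ n) atTop (𝓝 1) := by
    refine tendsto_of_tendsto_of_tendsto_of_le_of_le' hn tendsto_const_nhds ?_ ?_
    · filter_upwards [hc1] with n hn
      have hx : 1 - c n ^ 2 ≤ √(1 - c n ^ 2) := by
        refine Real.le_sqrt_of_sq_le ?_
        nlinarith [sq_nonneg (c n)]
      refine le_trans ?_ (pow_le_pow_left₀ (by linarith) hx n)
      have := one_add_mul_le_pow (a := -c n ^ 2) (by linarith) n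
      rw [← sub_eq_add_neg] at this
      linarith
    · refine Eventually.of_forall fun n => pow_le_one₀ (Real.sqrt_nonneg _) ?_
      rw [Real.sqrt_le_one]
      linarith [sq_nonneg (c n)]
  have h2 := ((h1.inv₀ one_ne_zero).sub_const 1).sqrt
  simpa [inv_pow] using h2

/-- If `r` is `o(1/√n)`, then all the laws of the model merge in total variation. -/
theorem exists_tendsto_zero_abs_integral_spikedLaw_sub_le {p : ℕ} {r : ℕ → ℝ} {v : ℝ}
    (hrv : ∀ n, 1 ≤ n → 0 ≤ r n * v)
    (hκ : Tendsto (fun n : ℕ => √(n : ℝ) * (r n * v)) atTop (𝓝 0)) :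
    ∃ δ : ℕ → ℝ, Tendsto δ atTop (𝓝 0) ∧ ∀ᶠ n in atTop,
      ∀ (θ₁ θ₂ : EuclideanSpace ℝ (Fin p)), ‖θ₁‖ = 1 → ‖θ₂‖ = 1 →
      ∀ ψ : (Fin n → EuclideanSpace ℝ (Fin p)) → ℝ, (∀ x, ψ x ∈ Set.Icc (0 : ℝ) 1) →
        AEMeasurable ψ (spikedLaw n (r n) v θ₁) →
        |∫ x, ψ x ∂(spikedLaw n (r n) v θ₁) - ∫ x, ψ x ∂(spikedLaw n (r n) v θ₂)| ≤ δ n := by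
  have hc0 := (tendsto_sqrt_one_add_sub_one hrv hκ).1
  -- The factor 2 comes from comparing both laws with the standard Gaussian sample.
  have hδ := (tendsto_inv_sqrt_one_sub_sq_pow hκ hc0).const_mul 2
  rw [mul_zero] at hδ
  refine ⟨_, hδ, ?_⟩
  filter_upwards [eventually_ge_atTop 1, hc0.eventually (gt_mem_nhds one_pos)]
    with n hn hc1 θ₁ θ₂ h₁ h₂ ψ hψ hψm
  have hψm' := hψm.mono_ac (absolutelyContinuous_spikedLaw (hrv n hn) h₁)
  have ha := abs_integral_spikedLaw_sub_le (hrv n hn) hc1 h₁ hψ hψm'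
  have hb := abs_integral_spikedLaw_sub_le (hrv n hn) hc1 h₂ hψ hψm'
  rw [abs_le] at ha hb ⊢
  constructor <;> linarith [ha.1, ha.2, hb.1, hb.2]

/-- Under merging every power function is asymptotically constant over the sphere: a competitor's
minimal power is at most about its level, while that of `φ` tends to `α`. -/
theorem isLocallyAsymptoticallyMaximin_of_merging {p : ℕ} {Ω : ℕ → Type*}
    [∀ n, MeasurableSpace (Ω n)] {P : ∀ n, EuclideanSpace ℝ (Fin p) → Measure (Ω n)}
    [∀ n θ, IsProbabilityMeasure (P n θ)] {θ₀ : EuclideanSpace ℝ (Fin p)} (hθ₀ : ‖θ₀‖ = 1) {ν : ℝ} {α : ℝ} {φ : ∀ n, Ω n → ℝ}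
    {δ : ℕ → ℝ} (hδ : Tendsto δ atTop (𝓝 0))
    (hP : ∀ᶠ n in atTop, ∀ θ₁ θ₂ : EuclideanSpace ℝ (Fin p), ‖θ₁‖ = 1 → ‖θ₂‖ = 1 →
      ∀ ψ : Ω n → ℝ, (∀ x, ψ x ∈ Set.Icc (0 : ℝ) 1) → AEMeasurable ψ (P n θ₁) →
        |∫ x, ψ x ∂(P n θ₁) - ∫ x, ψ x ∂(P n θ₂)| ≤ δ n)
    (hφ : IsTestSequence P φ)
    (hφα : Tendsto (fun n => ∫ x, φ n x ∂(P n θ₀)) atTop (𝓝 α)) :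
    IsLocallyAsymptoticallyMaximin P θ₀ (fun _ => ν) α φ := by
  refine ⟨hφ, hφα.limsup_eq.le, fun ε C _ _ ψ hψ hψα => ?_⟩
  rcases isEmpty_or_nonempty
    {τ : EuclideanSpace ℝ (Fin p) // ε ≤ ‖τ‖ ∧ ‖τ‖ ≤ C ∧ ‖θ₀ + ν • τ‖ = 1} with hempty | hne
  -- With no admissible `τ` the real infimum takes its default value 0 on both sides.
  · simp [minLocalPower, Real.iInf_of_isEmpty]
  obtain ⟨τ⟩ := hne
  have hnonneg : ∀ (χ : ∀ n, Ω n → ℝ), (∀ n ω, χ n ω ∈ Set.Icc (0 : ℝ) 1) → ∀ n,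
      0 ≤ minLocalPower (P n) θ₀ ν ε C (χ n) := fun χ hχ n =>
    Real.iInf_nonneg fun σ => integral_nonneg fun ω => (hχ n ω).1
  have hle : ∀ (χ : ∀ n, Ω n → ℝ), (∀ n ω, χ n ω ∈ Set.Icc (0 : ℝ) 1) → ∀ n,
      minLocalPower (P n) θ₀ ν ε C (χ n) ≤ ∫ ω, χ n ω ∂(P n (θ₀ + ν • τ.1)) := fun χ hχ n =>
    ciInf_le ⟨0, by rintro _ ⟨σ, rfl⟩; exact integral_nonneg fun ω => (hχ n ω).1⟩ τ
  have hmerge : ∀ (χ : ∀ n, Ω n → ℝ), IsTestSequence P χ → ∀ η > 0, ∀ᶠ n in atTop,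
      ∀ θ : EuclideanSpace ℝ (Fin p), ‖θ‖ = 1 →
        |∫ x, χ n x ∂(P n θ₀) - ∫ x, χ n x ∂(P n θ)| < η := fun χ hχ η hη => by
    filter_upwards [hP, hχ.2, hδ.eventually (gt_mem_nhds hη)] with n h1 h2 h3 θ hθ
    exact (h1 θ₀ θ hθ₀ hθ (χ n) (hχ.1 n) (h2 θ₀ hθ₀)).trans_lt h3
  have hle1 : ∀ (χ : ∀ n, Ω n → ℝ), (∀ n ω, χ n ω ∈ Set.Icc (0 : ℝ) 1) → ∀ n θ,
      ∫ ω, χ n ω ∂(P n θ) ≤ 1 := fun χ hχ n θ => by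
    have := integral_mono_of_nonneg (μ := P n θ) (ae_of_all _ fun ω => (hχ n ω).1)
      (integrable_const 1) (ae_of_all _ fun ω => (hχ n ω).2)
    simpa using this
  have hbdd : IsBoundedUnder (· ≤ ·) atTop fun n => ∫ ω, ψ n ω ∂(P n θ₀) :=
    ⟨1, eventually_map.2 (Eventually.of_forall fun n => hle1 ψ hψ.1 n θ₀)⟩
  have hupper : ∀ η > 0, ∀ᶠ n in atTop, minLocalPower (P n) θ₀ ν ε C (ψ n) ≤ α + 2 * η := by
    intro η hη
    filter_upwards [hmerge ψ hψ η hη,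
      eventually_lt_of_limsup_lt (lt_of_le_of_lt hψα (lt_add_of_pos_right α hη)) hbdd]
      with n h1 h2
    have h3 := (abs_lt.1 (h1 _ τ.2.2.2)).1
    linarith [hle ψ hψ.1 n]
  have hlower : ∀ η > 0, ∀ᶠ n in atTop, α - 2 * η ≤ minLocalPower (P n) θ₀ ν ε C (φ n) := by
    intro η hη
    filter_upwards [hmerge φ hφ η hη, hφα.eventually (lt_mem_nhds (sub_lt_self α hη))]
      with n h1 h2
    have : Nonempty {τ : EuclideanSpace ℝ (Fin p) // ε ≤ ‖τ‖ ∧ ‖τ‖ ≤ C ∧ ‖θ₀ + ν • τ‖ = 1} := ⟨τ⟩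
    refine le_ciInf fun σ => ?_
    linarith [(abs_lt.1 (h1 _ σ.2.2.2)).2]
  have hφb : IsCoboundedUnder (· ≥ ·) atTop fun n => minLocalPower (P n) θ₀ ν ε C (φ n) :=
    IsBoundedUnder.isCoboundedUnder_ge ⟨1, eventually_map.2 (Eventually.of_forall fun n =>
      (hle φ hφ.1 n).trans (hle1 φ hφ.1 n _))⟩
  have hψb : IsCoboundedUnder (· ≤ ·) atTop fun n => minLocalPower (P n) θ₀ ν ε C (ψ n) :=
    IsBoundedUnder.isCoboundedUnder_le ⟨0, eventually_map.2 (Eventually.of_forall (hnonneg ψ hψ.1))⟩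
  refine le_of_forall_pos_le_add fun η hη => ?_
  have h1 := limsup_le_of_le hψb (hupper (η / 4) (by positivity))
  have h2 := le_liminf_of_le hφb (hlower (η / 4) (by positivity))
  linarith

/-! ### The main theorem -/

theorem norm_sq_eq_of_norm_add_eq_one {p : ℕ} {θ τ : EuclideanSpace ℝ (Fin p)} (hθ : ‖θ‖ = 1)
    (h : ‖θ + τ‖ = 1) : ‖τ‖ ^ 2 = 2 - 2 * inner ℝ (θ + τ) θ := by
  have h1 : τ = (θ + τ) - θ := by abel
  conv_lhs => rw [h1]
  rw [norm_sub_sq_real, h, hθ]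
  ring

end WeakPCA

theorem theorem4p3 {p : ℕ} [NeZero p] (hp : 2 ≤ p)
    (θ₀ : EuclideanSpace ℝ (Fin p)) (hθ₀ : ‖θ₀‖ = 1)
    (v : ℝ) (hv : 0 < v)
    (r : ℕ → ℝ) (hr : ∀ n : ℕ, 1 ≤ n → 0 < r n)
    (e : ∀ n, (Fin n → EuclideanSpace ℝ (Fin p)) → Fin p → EuclideanSpace ℝ (Fin p))
    (he : WeakPCA.IsSampleEigenvectorChoice e) :
    -- the contiguity regime
    ((∀ n : ℕ, 1 ≤ n → r n = 1 / √(n : ℝ)) →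
      ∀ (τ : ℕ → EuclideanSpace ℝ (Fin p)) (τlim : EuclideanSpace ℝ (Fin p)),
        (∀ n, ‖θ₀ + τ n‖ = 1) → Tendsto τ atTop (𝓝 τlim) →
        WeakPCA.ConvergesInLaw
          (fun n x => WeakPCA.hpvStatistic θ₀ x (e n x))
          (fun n => WeakPCA.spikedLaw n (r n) v (θ₀ + τ n))
          (WeakPCA.noncentralChiSq (p - 1)
            (v ^ 2 / 16 * ‖τlim‖ ^ 2 * (4 - ‖τlim‖ ^ 2) * (2 - ‖τlim‖ ^ 2) ^ 2)) ∧
        -- rate-consistency: non-trivial limiting power at the contiguity rate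
        ∀ α : ℝ, 0 < α → α < 1 →
          Tendsto
            (fun n => ∫ x, WeakPCA.hpvTest α θ₀ x (e n x) ∂(WeakPCA.spikedLaw n (r n) v θ₀))
            atTop (𝓝 α) ∧
          ∃ β : ℝ,
            β = (WeakPCA.noncentralChiSq (p - 1)
              (v ^ 2 / 16 * ‖τlim‖ ^ 2 * (4 - ‖τlim‖ ^ 2) * (2 - ‖τlim‖ ^ 2) ^ 2)).real
                (Set.Ioi (WeakPCA.chiSqUpperQuantile (p - 1) α)) ∧
            Tendsto
              (fun n => ∫ x, WeakPCA.hpvTest α θ₀ x (e n x)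
                ∂(WeakPCA.spikedLaw n (r n) v (θ₀ + τ n)))
              atTop (𝓝 β) ∧
            (‖τlim‖ ≠ 0 → ‖τlim‖ ≠ √2 → ‖τlim‖ ≠ 2 → α < β ∧ β < 1)) ∧
    -- the strict contiguity regime
    ((r =o[atTop] fun n : ℕ => 1 / √(n : ℝ)) →
      ∀ α : ℝ, 0 < α → α < 1 →
        WeakPCA.IsLocallyAsymptoticallyMaximin
          (fun n θ => WeakPCA.spikedLaw n (r n) v θ) θ₀ (fun _ => 1) α
          (fun n x => WeakPCA.hpvTest α θ₀ x (e n x)) ∧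
        ∀ (τ : ℕ → EuclideanSpace ℝ (Fin p)) (τlim : EuclideanSpace ℝ (Fin p)),
          (∀ n, ‖θ₀ + τ n‖ = 1) → Tendsto τ atTop (𝓝 τlim) →
          Tendsto
            (fun n => ∫ x, WeakPCA.hpvTest α θ₀ x (e n x)
              ∂(WeakPCA.spikedLaw n (r n) v (θ₀ + τ n)))
            atTop (𝓝 α)) := by
  obtain ⟨k, rfl⟩ := Nat.exists_eq_add_of_le' (by omega : 1 ≤ p)
  have hk : k ≠ 0 := by omega
  have hrv : ∀ n, 1 ≤ n → 0 ≤ r n * v := fun n hn => (mul_pos (hr n hn) hv).le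
  have hlim : ∀ (τ : ℕ → EuclideanSpace ℝ (Fin (k + 1))) (τlim : EuclideanSpace ℝ (Fin (k + 1))),
      (∀ n, ‖θ₀ + τ n‖ = 1) → Tendsto τ atTop (𝓝 τlim) → ‖θ₀ + τlim‖ = 1 := fun τ τlim h h' =>
    tendsto_nhds_unique (h'.const_add θ₀).norm (by simpa only [h] using tendsto_const_nhds)
  constructor
  · intro hrn τ τlim hτ hτlim
    have hκ : Tendsto (fun n : ℕ => √(n : ℝ) * (r n * v)) atTop (𝓝 v) := by
      refine tendsto_const_nhds.congr' ?_
      filter_upwards [eventually_ge_atTop 1] with n hn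
      have : √(n : ℝ) ≠ 0 := (Real.sqrt_pos.2 (by exact_mod_cast hn)).ne'
      rw [hrn n hn]
      field_simp
    have hnorm := WeakPCA.norm_sq_eq_of_norm_add_eq_one hθ₀ (hlim τ τlim hτ hτlim)
    set i := inner ℝ (θ₀ + τlim) θ₀ with hi
    -- Here `i = 1 - ‖τlim‖² / 2`, so that `1 - i² = ‖τlim‖² (4 - ‖τlim‖²) / 4` and `i² = (2 -
    -- ‖τlim‖²)² / 4`.
    have hδ : v ^ 2 / 16 * ‖τlim‖ ^ 2 * (4 - ‖τlim‖ ^ 2) * (2 - ‖τlim‖ ^ 2) ^ 2 =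
        v ^ 2 * (i ^ 2 * (1 - i ^ 2)) := by
      rw [hnorm]; ring
    have hα : ∀ α : ℝ, 0 < α → α < 1 → Tendsto
        (fun n => ∫ x, WeakPCA.hpvTest α θ₀ x (e n x) ∂(WeakPCA.spikedLaw n (r n) v θ₀))
        atTop (𝓝 α) := fun α hα0 hα1 => by
      have h := WeakPCA.tendsto_integral_hpvTest hk hθ₀ he hrv hκ (fun _ => hθ₀)
        tendsto_const_nhds α
      rwa [real_inner_self_eq_norm_sq, hθ₀, one_pow, one_pow, sub_self, mul_zero, mul_zero,
        WeakPCA.noncentralChiSq_real_Ioi_chiSqUpperQuantile hk hα0 hα1] at h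
    have hθlim := hτlim.const_add θ₀
    refine ⟨?_, fun α hα0 hα1 => ⟨hα α hα0 hα1, _, rfl, ?_, fun h0 h2 h4 => ?_⟩⟩
    · have h := WeakPCA.convergesInLaw_hpvStatistic hk hθ₀ he hrv hκ hτ hθlim
      simp only [hδ]
      exact h
    · rw [hδ]
      exact WeakPCA.tendsto_integral_hpvTest hk hθ₀ he hrv hκ hτ hθlim α
    · have hq := WeakPCA.chiSqUpperQuantile_pos hk hα0 hα1
      have hpos : 0 < v ^ 2 / 16 * ‖τlim‖ ^ 2 * (4 - ‖τlim‖ ^ 2) * (2 - ‖τlim‖ ^ 2) ^ 2 := by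
        -- Equivalent to `‖τlim‖² ≤ 4`, which gives the factor `4 - ‖τlim‖²` its sign; the excluded
        -- norms are exactly the zeros of the noncentrality.
        have hi1 : -1 ≤ i := by
          have := abs_real_inner_le_norm (θ₀ + τlim) θ₀
          rw [hlim τ τlim hτ hτlim, hθ₀, one_mul, ← hi] at this
          exact (abs_le.1 this).1
        have hne4 : ‖τlim‖ ^ 2 ≠ 4 := fun h => h4 (by
          rw [← Real.sqrt_sq (norm_nonneg τlim), h]
          rw [show (4 : ℝ) = 2 ^ 2 by norm_num, Real.sqrt_sq (by norm_num)])
        have hne2 : ‖τlim‖ ^ 2 ≠ 2 := fun h => h2 (by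
          rw [← Real.sqrt_sq (norm_nonneg τlim), h])
        have h4' : 0 < 4 - ‖τlim‖ ^ 2 :=
          sub_pos.2 (lt_of_le_of_ne (by linarith) hne4)
        have h2' : 0 < (2 - ‖τlim‖ ^ 2) ^ 2 := by
          have := sub_ne_zero.2 hne2.symm
          positivity
        positivity
      refine ⟨?_, WeakPCA.noncentralChiSq_real_Ioi_lt_one _ _ hq⟩
      have h := WeakPCA.noncentralChiSq_real_Ioi_lt hk hpos hq
      rwa [WeakPCA.noncentralChiSq_real_Ioi_chiSqUpperQuantile hk hα0 hα1] at h
  · intro hro α hα0 hα1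
    have hκ : Tendsto (fun n : ℕ => √(n : ℝ) * (r n * v)) atTop (𝓝 0) := by
      have h := hro.tendsto_div_nhds_zero.mul_const v
      rw [zero_mul] at h
      refine h.congr fun n => ?_
      rw [div_div_eq_mul_div, div_one]
      ring
    have hpow : ∀ (τ : ℕ → EuclideanSpace ℝ (Fin (k + 1)))
        (τlim : EuclideanSpace ℝ (Fin (k + 1))), (∀ n, ‖θ₀ + τ n‖ = 1) →
        Tendsto τ atTop (𝓝 τlim) → Tendsto (fun n => ∫ x, WeakPCA.hpvTest α θ₀ x (e n x)
          ∂(WeakPCA.spikedLaw n (r n) v (θ₀ + τ n))) atTop (𝓝 α) := fun τ τlim hτ hτlim => by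
      have h := WeakPCA.tendsto_integral_hpvTest hk hθ₀ he hrv hκ hτ (hτlim.const_add θ₀) α
      rwa [zero_pow two_ne_zero, zero_mul,
        WeakPCA.noncentralChiSq_real_Ioi_chiSqUpperQuantile hk hα0 hα1] at h
    refine ⟨?_, hpow⟩
    obtain ⟨δ, hδ, hP⟩ := WeakPCA.exists_tendsto_zero_abs_integral_spikedLaw_sub_le
      (p := k + 1) hrv hκ
    refine WeakPCA.isLocallyAsymptoticallyMaximin_of_merging hθ₀ hδ hP
      (WeakPCA.isTestSequence_hpvTest hθ₀ he hrv α) ?_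
    simpa using hpow (fun _ => 0) 0 (by simpa using hθ₀) tendsto_const_nhds
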